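/- Let $M>0$ and let $g=(1-\tfrac{2M}{r})dt^2-(1-\tfrac{2M}{r})^{-1}dr^2-r^2(d\theta^2+\sin^2\theta\,d\phi^2)$ be the Schwarzschild metric on the exterior $\mathbb R\times(2M,\infty)\times S^2$. Put $\xi=\partial_t$, $Y_{ab}=-2r^3\sin\theta\,d\theta_{[a}d\phi_{b]}$, $U_a=-r^{-1}\nabla_a r$, and let $\widehat T=(1-\tfrac{2M}{r})^{-1/2}\partial_t$, $\widehat X=r^{-1}\partial_\theta$, $\widehat Y=r^{-1}\csc\theta\,\partial_\phi$, $\widehat Z=(1-\tfrac{2M}{r})^{1/2}\partial_r$. For a real 2-form $F_{ab}$ with Hodge dual ${*}F_{ab}$ define $$Z_{ab}=-\tfrac43\,{*}F_{[a}{}^{c}Y_{b]c},\qquad \beta_a=-\tfrac12U^bZ_{ab}-\tfrac12 i\,U^b{*}Z_{ab}-\tfrac12\nabla_bZ_a{}^b-\tfrac12 i\,\nabla_b{*}Z_a{}^b,$$ $$\mathbf H_{ab}=\beta_{(a}\bar\beta_{b)}-\tfrac12g_{ab}\beta^c\bar\beta_c,\qquad \mathbf W_{ab}=-\tfrac12Z_a{}^cZ_{bc}+\tfrac18g_{ab}Z_{cd}Z^{cd},$$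 and, for a spacelike hypersurface $\Sigma$ with future-directed unit normal $N^a$ and induced volume element $d\mu_\Sigma$, the superenergy $E_\xi(\Sigma)=\int_\Sigma\mathbf H_{ab}\xi^bN^a\,d\mu_\Sigma\in[0,\infty]$ (the integrand is nonnegative). With $\beta_\nu=\beta_a\nu^a$, put $$|\beta|^2_{1,\deg}=\tfrac{(r-3M)^2}{r^3}\bigl(|\beta_{\widehat X}|^2+|\beta_{\widehat Y}|^2\bigr)+\tfrac{M(r-2M)}{r^3}|\beta_{\widehat Z}|^2+\tfrac{M(r-3M)^2(r-2M)}{r^5}|\beta_{\widehat T}|^2,\qquad |Z|_2^2=\tfrac{r-2M}{r}\,\mathbf W_{\widehat T\widehat T}.$$ Let $\Sigma_1,\Sigma_2$ be connected smooth spherically symmetric spacelike hypersurfaces of the exterior, i.e. graphs $t=h_1(r)$, $t=h_2(r)$ over open intervals of radii, such that $\Sigma_2$ lies in the causal future of $\Sigma_1$ and $\Sigma_2\cup-\Sigma_1$ is the whole boundary of a region $\Omega$. The latter means that $h_1,h_2$ are defined on the same interval $I$, that $\Omega=\{r\in I,\ h_1(r)<t<h_2(r)\}$, and that a maximal radial null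 geodesic of the exterior meets $\Sigma_1$ if and only if it meets $\Sigma_2$ (so that nothing enters or leaves $\Omega$ through an edge, the horizon or infinity). If $F_{ab}$ is a smooth solution of the Maxwell equations $\nabla^aF_{ab}=0$, $\nabla_{[a}F_{bc]}=0$ on the exterior, then $$E_\xi(\Sigma_2)=E_\xi(\Sigma_1),\qquad \int_\Omega|\beta|^2_{1,\deg}+\frac{2M}{25r^4}|Z|_2^2\;d\mu_\Omega\le\frac{72}{5}E_\xi(\Sigma_1).$$ Moreover, for all real $q_E,q_B$ the Coulomb field $4\bigl(q_E\widehat T_{[a}\widehat Z_{b]}+q_B\widehat X_{[a}\widehat Y_{b]}\bigr)r^{-2}$ is a Maxwell field, and $Z_{ab}=0$ and $\beta_a=0$ for it. -/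

import Mathlib

open scoped ContDiff ENNReal

noncomputable section

namespace Schwarzschild

/-! ### Coordinate tensor calculus on open subsets of `ℝ⁴`

Indices are `0` (time) and `1, 2, 3`; covariant tensor fields are given by their components. -/

/-- Points of the coordinate space `ℝ⁴ ∋ (t, y₁, y₂, y₃)`. -/
abbrev Pt : Type := Fin 4 → ℝ

/-- A field of covariant 2-tensors (components `T x a b = T_{ab}(x)`). -/
abbrev Tensor2 : Type := Pt → Matrix (Fin 4) (Fin 4) ℝ

/-- Partial derivative `∂_a u` of a scalar function. -/
def pd (a : Fin 4) (u : Pt → ℝ) (x : Pt) : ℝ := fderiv ℝ u x (Pi.single a 1)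

/-- The Levi-Civita symbol, normalised by `leviCivita 0 1 2 3 = 1`. -/
def leviCivita (a b c d : Fin 4) : ℝ :=
  Matrix.det (Matrix.of fun i j : Fin 4 => if ![a, b, c, d] i = j then (1 : ℝ) else 0)

/-- Christoffel symbols `Γ^a_{bc}` of the metric `g`. -/
def christoffel (g : Tensor2) (x : Pt) (a b c : Fin 4) : ℝ :=
  (1 / 2) * ∑ d, (g x)⁻¹ a d *
    (pd b (fun z => g z d c) x + pd c (fun z => g z b d) x - pd d (fun z => g z b c) x)

/-- Covariant derivative `∇_c T_{ab}` for the Levi-Civita connection of `g`. -/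
def covDeriv (g T : Tensor2) (x : Pt) (c a b : Fin 4) : ℝ :=
  pd c (fun z => T z a b) x
    - ∑ d, christoffel g x d c a * T x d b - ∑ d, christoffel g x d c b * T x a d

/-- `∇_b T_a{}^b = g^{bc} ∇_c T_{ab}`. -/
def divergence (g T : Tensor2) (x : Pt) (a : Fin 4) : ℝ :=
  ∑ b, ∑ c, (g x)⁻¹ b c * covDeriv g T x c a b

/-- Density of the volume element of `g` with respect to Lebesgue measure, `|det g|^{1/2}`. -/
def volDensity (g : Tensor2) (x : Pt) : ℝ := Real.sqrt |(g x).det|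

/-- Hodge dual `*T_{ab} = ½ e_{ab}{}^{cd} T_{cd}`. -/
def hodge (g T : Tensor2) : Tensor2 := fun x =>
  Matrix.of fun a b => (1 / 2) * ∑ c, ∑ d, ∑ e, ∑ f,
    volDensity g x * leviCivita a b c d * (g x)⁻¹ c e * (g x)⁻¹ d f * T x e f

/-! ### The Schwarzschild exterior

The exterior `ℝ × (2M, ∞) × S²` is covered by the single chart `(t, y)`, `y = r ω`, `ω ∈ S²`,
i.e. by the open set `r = |y| > 2M` of `ℝ⁴`. -/

/-- The area radius `r = |y|`. -/
def radius (x : Pt) : ℝ := Real.sqrt (x 1 ^ 2 + x 2 ^ 2 + x 3 ^ 2)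

/-- The exterior region. -/
def exterior (M : ℝ) : Set Pt := {x | 2 * M < radius x}

/-- Components of `dt`. -/
def dt (a : Fin 4) : ℝ := if a = 0 then 1 else 0

/-- Components of `dr`. -/
def dr (x : Pt) (a : Fin 4) : ℝ := if a = 0 then 0 else x a / radius x

/-- The function `1 - 2M/r`. -/
def lapse (M r : ℝ) : ℝ := 1 - 2 * M / r

/-- The Schwarzschild metric `(1-2M/r) dt² - (1-2M/r)⁻¹ dr² - r² (dθ² + sin²θ dφ²)`, where
`r² (dθ² + sin²θ dφ²) = dy₁² + dy₂² + dy₃² - dr²`. -/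
def metric (M : ℝ) : Tensor2 := fun x => Matrix.of fun a b =>
  lapse M (radius x) * dt a * dt b - (lapse M (radius x))⁻¹ * dr x a * dr x b
    - ((if a = b ∧ a ≠ 0 then 1 else 0) - dr x a * dr x b)

/-- The Killing-Yano tensor `Y = -2 r³ sin θ dθ_{[a} dφ_{b]}`. Since
`r³ sin θ dθ ∧ dφ = y₁ dy₂ ∧ dy₃ + y₂ dy₃ ∧ dy₁ + y₃ dy₁ ∧ dy₂`, its Cartesian components are
`Y_{ij} = -ε_{ijk} y_k` and `Y_{0a} = 0`. -/
def killingYano : Tensor2 := fun x => Matrix.of fun a b => -∑ c, leviCivita 0 a b c * x c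

/-- `F` is a smooth real solution of the source-free Maxwell equations on the exterior. For an
antisymmetric tensor `∇_{[a} F_{bc]} = 0` is the vanishing of the cyclic sum. -/
structure IsMaxwellField (M : ℝ) (F : Tensor2) : Prop where
  smooth : ∀ a b, ContDiffOn ℝ ∞ (fun x => F x a b) (exterior M)
  antisymm : ∀ x ∈ exterior M, ∀ a b, F x a b = -F x b a
  div_eq_zero : ∀ x ∈ exterior M, ∀ b,
    ∑ a, ∑ c, (metric M x)⁻¹ a c * covDeriv (metric M) F x c a b = 0
  closed : ∀ x ∈ exterior M, ∀ a b c,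
    covDeriv (metric M) F x a b c + covDeriv (metric M) F x b c a
      + covDeriv (metric M) F x c a b = 0

/-- `Z_{ab} = -(4/3) *F_{[a}{}^c Y_{b]c}`. -/
def Z (M : ℝ) (F : Tensor2) : Tensor2 := fun x => Matrix.of fun a b =>
  -(4 / 3) * ((1 / 2) * ∑ c, ∑ d, (metric M x)⁻¹ c d *
    (hodge (metric M) F x a d * killingYano x b c - hodge (metric M) F x b d * killingYano x a c))

/-- `U_a = -r⁻¹ ∇_a r`. -/
def U (x : Pt) (a : Fin 4) : ℝ := -(radius x)⁻¹ * pd a radius x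

/-- `U^a`. -/
def Uup (M : ℝ) (x : Pt) (a : Fin 4) : ℝ := ∑ b, (metric M x)⁻¹ a b * U x b

/-- `β_a = -½ U^b Z_{ab} - ½ i U^b *Z_{ab} - ½ ∇_b Z_a{}^b - ½ i ∇_b *Z_a{}^b`. -/
def beta (M : ℝ) (F : Tensor2) (x : Pt) (a : Fin 4) : ℂ :=
  -(1 / 2) * ((∑ b, Uup M x b * Z M F x a b : ℝ) : ℂ)
    - (1 / 2) * Complex.I * ((∑ b, Uup M x b * hodge (metric M) (Z M F) x a b : ℝ) : ℂ)
    - (1 / 2) * ((divergence (metric M) (Z M F) x a : ℝ) : ℂ)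
    - (1 / 2) * Complex.I * ((divergence (metric M) (hodge (metric M) (Z M F)) x a : ℝ) : ℂ)

/-- The superenergy tensor `H_{ab} = β_{(a} β̄_{b)} - ½ g_{ab} β^c β̄_c`; note that
`β_{(a} β̄_{b)} = Re (β_a β̄_b)`. -/
def superenergyH (M : ℝ) (F : Tensor2) : Tensor2 := fun x => Matrix.of fun a b =>
  (beta M F x a * star (beta M F x b)).re
    - (1 / 2) * metric M x a b *
      ∑ c, ∑ d, (metric M x)⁻¹ c d * (beta M F x d * star (beta M F x c)).re

/-- The superenergy tensor `W_{ab} = -½ Z_a{}^c Z_{bc} + ⅛ g_{ab} Z_{cd} Z^{cd}`. -/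
def superenergyW (M : ℝ) (F : Tensor2) : Tensor2 := fun x => Matrix.of fun a b =>
  -(1 / 2) * (∑ c, ∑ d, (metric M x)⁻¹ c d * Z M F x a d * Z M F x b c)
    + (1 / 8) * metric M x a b *
      ∑ c, ∑ d, ∑ e, ∑ f, (metric M x)⁻¹ c e * (metric M x)⁻¹ d f * Z M F x c d * Z M F x e f

/-! ### Frame components and the weighted norms -/

/-- The Killing field `ξ = ∂_t`. -/
def xi (a : Fin 4) : ℝ := if a = 0 then 1 else 0

/-- The unit vector `T̂ = (1-2M/r)^{-1/2} ∂_t`. -/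
def frameT (M : ℝ) (x : Pt) (a : Fin 4) : ℝ :=
  if a = 0 then (Real.sqrt (lapse M (radius x)))⁻¹ else 0

/-- The unit vector `Ẑ = (1-2M/r)^{1/2} ∂_r`, where `∂_r = (y/r) · ∂_y`. -/
def frameZ (M : ℝ) (x : Pt) (a : Fin 4) : ℝ :=
  if a = 0 then 0 else Real.sqrt (lapse M (radius x)) * (x a / radius x)

/-- `β_ν = β_a ν^a`. -/
def contract (w : Fin 4 → ℂ) (v : Fin 4 → ℝ) : ℂ := ∑ a, w a * (v a : ℂ)

/-- The part of the covector `w` tangential to the sphere of radius `r` through `x`: the radial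
component `w(∂_r) dr` and the time component are removed. -/
def angularPart (x : Pt) (w : Fin 4 → ℂ) (a : Fin 4) : ℂ :=
  if a = 0 then 0 else w a - contract w (dr x) * (dr x a : ℂ)

/-- `|w_X̂|² + |w_Ŷ|²` for any orthonormal frame `X̂, Ŷ` tangent to the sphere through `x` (the sum
does not depend on the frame; on the spheres the metric is minus the Euclidean one). -/
def angularNormSq (x : Pt) (w : Fin 4 → ℂ) : ℝ := ∑ a, ‖angularPart x w a‖ ^ 2

/-- `|β|²_{1,deg}`. -/
def betaDegNormSq (M : ℝ) (F : Tensor2) (x : Pt) : ℝ :=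
  (radius x - 3 * M) ^ 2 / radius x ^ 3 * angularNormSq x (beta M F x)
    + M * (radius x - 2 * M) / radius x ^ 3 * ‖contract (beta M F x) (frameZ M x)‖ ^ 2
    + M * (radius x - 3 * M) ^ 2 * (radius x - 2 * M) / radius x ^ 5
      * ‖contract (beta M F x) (frameT M x)‖ ^ 2

/-- `W_{T̂T̂}`. -/
def superenergyWTT (M : ℝ) (F : Tensor2) (x : Pt) : ℝ :=
  ∑ a, ∑ b, superenergyW M F x a b * frameT M x a * frameT M x b

/-- `|Z|²_2 = ((r-2M)/r) W_{T̂T̂}`. -/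
def ZNormSq (M : ℝ) (F : Tensor2) (x : Pt) : ℝ :=
  (radius x - 2 * M) / radius x * superenergyWTT M F x

/-! ### Spherically symmetric spacelike hypersurfaces -/

/-- A connected spherically symmetric spacelike hypersurface of the exterior. Such a hypersurface
projects to a connected spacelike curve in the `(t, r)` half-plane; on this curve `dr ≠ 0`, so it is
a graph `t = h(r)` over an open interval `I ⊆ (2M, ∞)`, and spacelike means that the tangent vector
`h'(r) ∂_t + ∂_r` has negative square. -/
structure SphericalHypersurface (M : ℝ) where
  I : Set ℝ
  h : ℝ → ℝ
  isOpen : IsOpen I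
  ordConnected : I.OrdConnected
  subset : I ⊆ Set.Ioi (2 * M)
  smooth : ContDiffOn ℝ ∞ h I
  spacelike : ∀ r ∈ I, lapse M r * deriv h r ^ 2 - (lapse M r)⁻¹ < 0

namespace SphericalHypersurface

variable {M : ℝ}

/-- The hypersurface as a set of points of the exterior. -/
def carrier (S : SphericalHypersurface M) : Set Pt :=
  {x | radius x ∈ S.I ∧ x 0 = S.h (radius x)}

/-- Euclidean length in `ℝ³`. -/
def spatialRadius (y : Fin 3 → ℝ) : ℝ := Real.sqrt (y 0 ^ 2 + y 1 ^ 2 + y 2 ^ 2)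

/-- Parameter domain `{y ∈ ℝ³ | |y| ∈ I}`. -/
def domain (S : SphericalHypersurface M) : Set (Fin 3 → ℝ) := {y | spatialRadius y ∈ S.I}

/-- The embedding `y ↦ (h(|y|), y)` of the parameter domain onto the hypersurface. -/
def embed (S : SphericalHypersurface M) (y : Fin 3 → ℝ) : Pt :=
  Matrix.vecCons (S.h (spatialRadius y)) y

/-- Coordinate tangent vectors of the embedding. -/
def tangent (S : SphericalHypersurface M) (y : Fin 3 → ℝ) (i : Fin 3) : Pt :=
  fderiv ℝ S.embed y (Pi.single i 1)

/-- The induced metric in the parameters `y`. -/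
def inducedMetric (S : SphericalHypersurface M) (y : Fin 3 → ℝ) : Matrix (Fin 3) (Fin 3) ℝ :=
  Matrix.of fun i j => ∑ a, ∑ b, metric M (S.embed y) a b * S.tangent y i a * S.tangent y j b

/-- Density of the induced volume element with respect to `dy₁ dy₂ dy₃`. -/
def inducedVolDensity (S : SphericalHypersurface M) (y : Fin 3 → ℝ) : ℝ :=
  Real.sqrt |(S.inducedMetric y).det|

/-- The conormal `n_a = ∂_a (t - h(r))`. -/
def conormal (S : SphericalHypersurface M) (x : Pt) (a : Fin 4) : ℝ :=
  pd a (fun z => z 0 - S.h (radius z)) x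

/-- The future-directed unit normal `N^a = g^{ab} n_b / (g^{cd} n_c n_d)^{1/2}`. -/
def normal (S : SphericalHypersurface M) (x : Pt) (a : Fin 4) : ℝ :=
  (∑ b, (metric M x)⁻¹ a b * S.conormal x b)
    / Real.sqrt (∑ c, ∑ d, (metric M x)⁻¹ c d * S.conormal x c * S.conormal x d)

/-- The integrand `H_{ab} ν^b N^a` of the superenergy. -/
def fluxIntegrand (S : SphericalHypersurface M) (F : Tensor2) (ν : Fin 4 → ℝ) (x : Pt) : ℝ :=
  ∑ a, ∑ b, superenergyH M F x a b * ν b * S.normal x a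

/-- The superenergy `E_ξ(Σ) = ∫_Σ H_{ab} ξ^b N^a dμ_Σ`, as an element of `[0, ∞]`: the integrand is
nonnegative because `H` satisfies the dominant energy condition and `ξ`, `N` are timelike and
future-directed. -/
def energy (S : SphericalHypersurface M) (F : Tensor2) : ℝ≥0∞ :=
  ∫⁻ y in S.domain,
    ENNReal.ofReal (S.fluxIntegrand F xi (S.embed y) * S.inducedVolDensity y)

end SphericalHypersurface

/-- The tortoise coordinate, `dr_*/dr = (1-2M/r)⁻¹`. -/
def tortoise (M r : ℝ) : ℝ := r + 2 * M * Real.log (r / (2 * M) - 1)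

/-- The (image of the) maximal radial null geodesic `t = c + s r_*` in the direction `e ∈ S²`;
outgoing for `s = 1`, ingoing for `s = -1`. -/
def radialNullGeodesic (M s c : ℝ) (e : Fin 3 → ℝ) : Set Pt :=
  {x | ∃ r, 2 * M < r ∧ x = Matrix.vecCons (c + s * tortoise M r) (r • e)}

/-- The region `Ω` between two hypersurfaces over the same interval of radii. -/
def regionBetween {M : ℝ} (S₁ S₂ : SphericalHypersurface M) : Set Pt :=
  {x | radius x ∈ S₁.I ∧ S₁.h (radius x) < x 0 ∧ x 0 < S₂.h (radius x)}

/-- `Σ₂` lies in the (causal) future of `Σ₁`, and `Σ₂ ∪ -Σ₁` is the whole boundary of the region `Ω`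
between them: `Ω` has no further boundary part, neither in the exterior nor at the horizon or at
infinity, through which a light ray could enter or leave. -/
structure Bounds {M : ℝ} (S₁ S₂ : SphericalHypersurface M) : Prop where
  same_radii : S₁.I = S₂.I
  future : ∀ r ∈ S₁.I, S₁.h r ≤ S₂.h r
  no_further_boundary : ∀ s : ℝ, (s = 1 ∨ s = -1) → ∀ (c : ℝ) (e : Fin 3 → ℝ), ∑ i, e i ^ 2 = 1 →
    ((radialNullGeodesic M s c e ∩ S₁.carrier).Nonempty ↔
      (radialNullGeodesic M s c e ∩ S₂.carrier).Nonempty)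

/-- The integral over `Ω` of `|β|²_{1,deg} + (2M/(25 r⁴)) |Z|²_2` with respect to the spacetime
volume element (the integrand is nonnegative on the exterior). -/
def morawetzBulk (M : ℝ) (F : Tensor2) (Ω : Set Pt) : ℝ≥0∞ :=
  ∫⁻ x in Ω, ENNReal.ofReal
    ((betaDegNormSq M F x + 2 * M / (25 * radius x ^ 4) * ZNormSq M F x)
      * volDensity (metric M) x)

/-- The Coulomb solutions `4 (q_E T̂_{[a} Ẑ_{b]} + q_B X̂_{[a} Ŷ_{b]}) r⁻²`. Here `T̂_a`, `Ẑ_a` are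
lowered with the metric, and `2 X̂_{[a} Ŷ_{b]} = r² sin θ (dθ_a dφ_b - dφ_a dθ_b) = -Y_{ab} / r`. -/
def coulomb (M qE qB : ℝ) : Tensor2 := fun x => Matrix.of fun a b =>
  (2 * qE * ((∑ c, metric M x a c * frameT M x c) * (∑ c, metric M x b c * frameZ M x c)
      - (∑ c, metric M x b c * frameT M x c) * (∑ c, metric M x a c * frameZ M x c))
    + 2 * qB * (-killingYano x a b / radius x)) / radius x ^ 2

end Schwarzschild

end

noncomputable section

namespace Schwarzschild

open MeasureTheory Set Filter Topology
open scoped ContDiff ENNReal Matrix Pointwise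

/-! ### Parametric integrals over compact sets -/

section ParametricIntegral

variable {α : Type*} [MetricSpace α] [MeasurableSpace α] [BorelSpace α]
  {μ : Measure α} [IsFiniteMeasureOnCompacts μ]

/-! Everything reduces to two scalars. In the chart `(t, y)` let `E`, `B` be the electric and
magnetic vectors of `F`, and put `D = r (y · E)`, `K = r (y · B)`, which is r² times the radial
components. Maxwell's equations give β_a = (3r)⁻¹ ∂_a (D + iK) (`beta_eq`), so `H` is (9r²)⁻¹ times
the stress tensor of the scalars `D`, `K`. With f = 1 - 2M/r and Δ the Laplacian of the unit sphere,
both solve u_tt = ∂_{r*}² u + f r⁻² Δu. The factor r⁻² cancels the r² of the area element, so after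
integration over the spheres the conservation of superenergy is a balance law ∂_t p = ∂_r w in the
half-plane of `(t, r)`. For Coulomb fields `E` and `B` are parallel to `y` and `D`, `K` are
constant, whence `Z = 0` and `β = 0`.

Energy equality. A flux through a graph t = h(r) is a boundary term of the potential ∫₀ᵗ w dτ
(`BalanceLaw.integral_graph`), which replaces Stokes' theorem. An arc of Σ₂ together with the radial
null segments from its ends back to Σ₁ carries the same energy as the arc of Σ₁ below it
(`BalanceLaw.flux_sub_flux`). Fluxes through null segments are nonnegative, and the segments do
reach Σ₁ because no radial ray enters or leaves Ω otherwise. Exhaustion gives E(Σ₂) ≤ E(Σ₁), and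
time reversal the converse.

Bulk estimate. A Morawetz current (j, v) with source κ is built such that κ is at least the
integrand of the bulk term and |j ± f⁻¹ v| ≤ C (p ± f⁻¹ w) with C = 36/5. The source is the
difference of an upper and a lower flux, each at most C times the same energy; this gives 2C = 72/5
(`integral_source_le`).

The current starts from the multiplier C (1 - 3M/r) ∂_{r*}, which vanishes at the photon sphere r =
3M. Its bulk term is corrected by a multiple of the Lagrangian u_t² - u_{r*}² - f r⁻² |∇u|². The
undifferentiated `D`, `K` are not controlled by the energy, as they contain the charges; so the
Lagrangian is not obtained from u u_t. Instead the first order system is used: `D` and `K` have as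
time and tortoise derivatives, up to sign, the surface curls and divergences of the tangential
fields `e`, `b` (`ReducedSystem`), and the gradient of u is paired with these fields
(`TransportPair.potential_law`). What remains is quadratic in `e`, `b`. It is absorbed by the
estimate 2 ∫|X|² ≤ ∫ (div X)² + (curl X)² for tangential fields on the unit sphere
(`two_mul_sphereAvg_normSq_le`). Applied to `e ± b`, the null components of the field, this estimate
respects the two null directions separately, and so yields the domination of (j, v) by (p, w). Two
inequalities in u = M/r on (0, 1/2) finish the proof: `abs_multiplier_le` and
`multiplier_source_ge`. -/

theorem hasDerivAt_setIntegral_of_isCompact {K : Set α} (hK : IsCompact K) {U : Set ℝ}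
    (hU : IsOpen U) {f f' : ℝ → α → ℝ} (hf : ∀ r ∈ U, ContinuousOn (f r) K)
    (hf' : ContinuousOn (fun z : ℝ × α => f' z.1 z.2) (U ×ˢ K))
    (hd : ∀ r ∈ U, ∀ a ∈ K, HasDerivAt (fun s => f s a) (f' r a) r) {r : ℝ} (hr : r ∈ U) :
    HasDerivAt (fun s => ∫ a in K, f s a ∂μ) (∫ a in K, f' r a ∂μ) r := by
  obtain ⟨ε, hε, hεU⟩ := Metric.nhds_basis_closedBall.mem_iff.1 (hU.mem_nhds hr)
  have hcomp : IsCompact (Metric.closedBall r ε ×ˢ K) := (isCompact_closedBall r ε).prod hK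
  obtain ⟨C, hC⟩ := hcomp.exists_bound_of_continuousOn
    (hf'.mono (prod_mono hεU Subset.rfl))
  have hf'r : ContinuousOn (f' r) K :=
    hf'.comp (f := fun a => (r, a)) (by fun_prop) (fun a ha => ⟨hr, ha⟩)
  have hfin : IsFiniteMeasure (μ.restrict K) := ⟨by simpa using hK.measure_lt_top⟩
  refine (hasDerivAt_integral_of_dominated_loc_of_deriv_le (bound := fun _ => C)
    (Metric.closedBall_mem_nhds r hε) ?_ ?_ ?_ ?_ ?_ ?_).2
  · filter_upwards [hU.mem_nhds hr] with s hs
    exact (hf s hs).aestronglyMeasurable hK.measurableSet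
  · exact (hf r hr).integrableOn_compact hK
  · exact hf'r.aestronglyMeasurable hK.measurableSet
  · filter_upwards [ae_restrict_mem hK.measurableSet] with a ha s hs
    exact hC (s, a) ⟨hs, ha⟩
  · exact integrable_const _
  · filter_upwards [ae_restrict_mem hK.measurableSet] with a ha s hs
    exact hd s (hεU hs) a ha

/-- Local compactness of `U` gives each parameter a compact neighbourhood; on its product with `K`
the integrand is bounded, and dominated convergence applies. -/
theorem continuousOn_setIntegral_of_isCompact {X : Type*} [MetricSpace X]
    {K : Set α} (hK : IsCompact K) {U : Set X} [LocallyCompactSpace U]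
    {f : X → α → ℝ} (hf : ContinuousOn (fun z : X × α => f z.1 z.2) (U ×ˢ K)) :
    ContinuousOn (fun x => ∫ a in K, f x a ∂μ) U := by
  have key : ∀ x ∈ U, ContinuousWithinAt (fun x => ∫ a in K, f x a ∂μ) U x := by
    intro x hx
    have hcts : ContinuousOn (fun z : U × α => f z.1 z.2) (univ ×ˢ K) :=
      hf.comp (f := fun z : U × α => ((z.1 : X), z.2)) (by fun_prop)
        (fun z hz => ⟨z.1.2, hz.2⟩)
    have hfin : IsFiniteMeasure (μ.restrict K) := ⟨by simpa using hK.measure_lt_top⟩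
    obtain ⟨N, hN, hNx⟩ := exists_compact_mem_nhds (⟨x, hx⟩ : U)
    obtain ⟨C, hC⟩ := (hN.prod hK).exists_bound_of_continuousOn
      (hcts.mono (prod_mono (subset_univ _) Subset.rfl))
    rw [continuousWithinAt_iff_continuousAt_domRestrict _ hx]
    refine continuousAt_of_dominated (F := fun (x : U) a => f x a) (bound := fun _ => C)
      ?_ ?_ (integrable_const _) ?_
    · refine Eventually.of_forall fun y => ContinuousOn.aestronglyMeasurable ?_ hK.measurableSet
      exact hcts.comp (f := fun a => (y, a)) (by fun_prop) (fun a ha => ⟨trivial, ha⟩)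
    · filter_upwards [hNx] with y hy
      filter_upwards [ae_restrict_mem hK.measurableSet] with a ha
      exact hC (y, a) ⟨hy, ha⟩
    · filter_upwards [ae_restrict_mem hK.measurableSet] with a ha
      have : Continuous fun y : U => f y a := by
        rw [← continuousOn_univ]
        exact hcts.comp (f := fun y : U => (y, a)) (by fun_prop) (fun y _ => ⟨trivial, ha⟩)
      exact this.continuousAt
  exact key

end ParametricIntegral

/-! ### Balance laws in a half-plane -/

/-- The half-plane `{(t, r) | ρ < r}`. -/
def halfPlane (ρ : ℝ) : Set (ℝ × ℝ) := univ ×ˢ Ioi ρ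

theorem isOpen_halfPlane (ρ : ℝ) : IsOpen (halfPlane ρ) := isOpen_univ.prod isOpen_Ioi

/-- The balance law `∂_t p = ∂_r w + κ` on the half-plane `ρ < r`. -/
structure BalanceLaw (ρ : ℝ) (p w κ : ℝ → ℝ → ℝ) : Prop where
  cont_density : ContinuousOn (fun z : ℝ × ℝ => p z.1 z.2) (halfPlane ρ)
  cont_flux : ContinuousOn (fun z : ℝ × ℝ => w z.1 z.2) (halfPlane ρ)
  cont_source : ContinuousOn (fun z : ℝ × ℝ => κ z.1 z.2) (halfPlane ρ)
  exists_deriv : ∃ w' : ℝ → ℝ → ℝ,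
    ContinuousOn (fun z : ℝ × ℝ => w' z.1 z.2) (halfPlane ρ) ∧
    (∀ t r, ρ < r → HasDerivAt (w t) (w' t r) r) ∧
    ∀ t r, ρ < r → HasDerivAt (fun s => p s r) (w' t r + κ t r) t

theorem continuous_slice {ρ : ℝ} {u : ℝ → ℝ → ℝ}
    (hu : ContinuousOn (fun z : ℝ × ℝ => u z.1 z.2) (halfPlane ρ)) {r : ℝ} (hr : ρ < r) :
    Continuous fun t => u t r := by
  rw [← continuousOn_univ]
  exact hu.comp (f := fun t => (t, r)) (by fun_prop) (fun t _ => ⟨trivial, hr⟩)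

theorem continuousOn_primitive {ρ : ℝ} {u : ℝ → ℝ → ℝ}
    (hu : ContinuousOn (fun z : ℝ × ℝ => u z.1 z.2) (halfPlane ρ)) :
    ContinuousOn (fun z : ℝ × ℝ => ∫ τ in (0)..z.1, u τ z.2) (halfPlane ρ) := by
  have h1 : Continuous (Function.uncurry fun (z : halfPlane ρ) (τ : ℝ) => u τ z.1.2) := by
    rw [← continuousOn_univ]
    exact hu.comp (f := fun y : halfPlane ρ × ℝ => (y.2, y.1.1.2)) (by fun_prop)
      (fun y _ => ⟨trivial, y.1.2.2⟩)
  rw [continuousOn_iff_continuous_domRestrict]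
  exact intervalIntegral.continuous_parametric_intervalIntegral_of_continuous h1
    (s := fun z : halfPlane ρ => z.1.1) (by fun_prop)

theorem hasDerivAt_primitive {ρ : ℝ} {w w' : ℝ → ℝ → ℝ}
    (hw : ContinuousOn (fun z : ℝ × ℝ => w z.1 z.2) (halfPlane ρ))
    (hw' : ContinuousOn (fun z : ℝ × ℝ => w' z.1 z.2) (halfPlane ρ))
    (hd : ∀ t r, ρ < r → HasDerivAt (w t) (w' t r) r) (t : ℝ) {r : ℝ} (hr : ρ < r) :
    HasDerivAt (fun s => ∫ τ in (0)..t, w τ s) (∫ τ in (0)..t, w' τ r) r := by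
  have aux : ∀ a b : ℝ, a ≤ b →
      HasDerivAt (fun s => ∫ τ in a..b, w τ s) (∫ τ in a..b, w' τ r) r := by
    intro a b hab
    simp only [intervalIntegral.integral_of_le hab, ← integral_Icc_eq_integral_Ioc]
    refine hasDerivAt_setIntegral_of_isCompact (f := fun s τ => w τ s) (f' := fun s τ => w' τ s)
      isCompact_Icc (isOpen_Ioi (a := ρ)) ?_ ?_ ?_ hr
    · exact fun s hs => (continuous_slice hw hs).continuousOn
    · exact hw'.comp (f := fun z : ℝ × ℝ => (z.2, z.1)) (by fun_prop) (fun z hz => ⟨trivial, hz.1⟩)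
    · exact fun s hs τ _ => hd τ s hs
  rcases le_total 0 t with h | h
  · exact aux 0 t h
  · have := (aux t 0 h).neg
    simp only [intervalIntegral.integral_symm t 0]
    exact this

namespace BalanceLaw

variable {ρ : ℝ} {p w κ : ℝ → ℝ → ℝ}

/-- The stream function Φ(t, r) = ∫₀ᵗ w dτ has ∂_t Φ = w, and ∂_r Φ comes from integrating the
balance law in time. Its derivative along a graph is therefore the flux density, minus the density
at time 0 and the accumulated source. -/
theorem hasDerivAt_potential (h : BalanceLaw ρ p w κ) {H : ℝ → ℝ} {H' r : ℝ} (hr : ρ < r)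
    (hH : HasDerivAt H H' r) :
    HasDerivAt (fun s => ∫ τ in (0)..H s, w τ s)
      (p (H r) r + H' * w (H r) r - p 0 r - ∫ τ in (0)..H r, κ τ r) r := by
  obtain ⟨w', hw'c, hw'd, hp⟩ := h.exists_deriv
  -- The balance law integrated over [0, t] at fixed radius expresses the unspecified derivative
  -- `w'` through `p` and `κ`.
  have hint : ∀ t s, ρ < s → ∫ τ in (0)..t, w' τ s = p t s - p 0 s - ∫ τ in (0)..t, κ τ s := by
    intro t s hs
    have hc1 := continuous_slice hw'c hs
    have hc2 := continuous_slice h.cont_source hs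
    have := intervalIntegral.integral_eq_sub_of_hasDerivAt (f := fun t => p t s)
      (a := 0) (b := t) (fun x _ => hp x s hs) ((hc1.add hc2).intervalIntegrable _ _)
    rw [intervalIntegral.integral_add (hc1.intervalIntegrable _ _) (hc2.intervalIntegrable _ _)]
      at this
    linarith
  have hU := (isOpen_halfPlane ρ).mem_nhds (show (H r, r) ∈ halfPlane ρ from ⟨trivial, hr⟩)
  -- Continuous partial derivatives make the potential jointly differentiable, as the chain rule
  -- along the graph requires.
  have hpart := (hasStrictFDerivAt_uncurry_coprod (𝕜 := ℝ) (u := (H r, r))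
    (f := fun t s => ∫ τ in (0)..t, w τ s)
    (f₁ := fun t s => ContinuousLinearMap.toSpanSingleton ℝ (w t s))
    (f₂ := fun t s => ContinuousLinearMap.toSpanSingleton ℝ (∫ τ in (0)..t, w' τ s))
    (by
      filter_upwards [hU] with v hv
      have := continuous_slice h.cont_flux hv.2
      exact (intervalIntegral.integral_hasDerivAt_right (this.intervalIntegrable _ _)
        (this.stronglyMeasurableAtFilter _ _) this.continuousAt).hasFDerivAt)
    (by
      filter_upwards [hU] with v hv
      exact (hasDerivAt_primitive h.cont_flux hw'c hw'd v.1 hv.2).hasFDerivAt)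
    (by
      have : ContinuousAt (fun z : ℝ × ℝ => w z.1 z.2) (H r, r) := h.cont_flux.continuousAt hU
      exact (ContinuousLinearMap.toSpanSingletonCLE (𝕜 := ℝ)
        (E := ℝ)).continuous.continuousAt.comp this)
    (by
      have : ContinuousAt (fun z : ℝ × ℝ => ∫ τ in (0)..z.1, w' τ z.2) (H r, r) :=
        (continuousOn_primitive hw'c).continuousAt hU
      exact (ContinuousLinearMap.toSpanSingletonCLE (𝕜 := ℝ)
        (E := ℝ)).continuous.continuousAt.comp this)).hasFDerivAt
  have hcurve : HasDerivAt (fun s => (H s, s)) (H', 1) r := hH.prodMk (hasDerivAt_id r)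
  have := HasFDerivAt.comp_hasDerivAt (f := fun s => (H s, s)) r hpart hcurve
  refine this.congr_deriv ?_
  simp only [Function.HasUncurry.uncurry, ContinuousLinearMap.coprod_apply, id,
    ContinuousLinearMap.toSpanSingleton_apply, smul_eq_mul, hint _ _ hr]
  ring

/-- The flux through the graph `t = H(r)`, expressed by boundary values of a potential. -/
theorem integral_graph (h : BalanceLaw ρ p w κ) {H H' : ℝ → ℝ} {a b : ℝ} (ha : ρ < a) (hab : a ≤ b)
    (hH : ∀ r ∈ Icc a b, HasDerivAt H (H' r) r) (hH' : ContinuousOn H' (Icc a b)) :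
    ∫ r in a..b, (p (H r) r + H' r * w (H r) r)
      = (∫ τ in (0)..H b, w τ b) - (∫ τ in (0)..H a, w τ a)
        + ∫ r in a..b, (p 0 r + ∫ τ in (0)..H r, κ τ r) := by
  have hIcc : uIcc a b = Icc a b := uIcc_of_le hab
  have hmem : ∀ r ∈ Icc a b, ρ < r := fun r hr => ha.trans_le hr.1
  have hHc : ContinuousOn H (Icc a b) := fun r hr => (hH r hr).continuousAt.continuousWithinAt
  have hgr : ContinuousOn (fun r => (H r, r)) (Icc a b) := hHc.prodMk continuousOn_id
  have hmaps : MapsTo (fun r => (H r, r)) (Icc a b) (halfPlane ρ) :=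
    fun r hr => ⟨trivial, hmem r hr⟩
  have c1 : ContinuousOn (fun r => p (H r) r + H' r * w (H r) r) (Icc a b) :=
    (h.cont_density.comp hgr hmaps).add (hH'.mul (h.cont_flux.comp hgr hmaps))
  have c2 : ContinuousOn (fun r => p 0 r + ∫ τ in (0)..H r, κ τ r) (Icc a b) := by
    refine ContinuousOn.add ?_ ((continuousOn_primitive h.cont_source).comp hgr hmaps)
    exact h.cont_density.comp (f := fun r => ((0 : ℝ), r)) (by fun_prop)
      (fun r hr => ⟨trivial, hmem r hr⟩)
  have i1 : IntervalIntegrable (fun r => p (H r) r + H' r * w (H r) r) volume a b :=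
    (hIcc ▸ c1).intervalIntegrable
  have i2 : IntervalIntegrable (fun r => p 0 r + ∫ τ in (0)..H r, κ τ r) volume a b :=
    (hIcc ▸ c2).intervalIntegrable
  have := intervalIntegral.integral_eq_sub_of_hasDerivAt
    (f := fun s => ∫ τ in (0)..H s, w τ s)
    (f' := fun r => (p (H r) r + H' r * w (H r) r) - (p 0 r + ∫ τ in (0)..H r, κ τ r))
    (a := a) (b := b)
    (fun r hr => by
      rw [hIcc] at hr
      exact (h.hasDerivAt_potential (hmem r hr) (hH r hr)).congr_deriv (by ring))
    (i1.sub i2)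
  rw [intervalIntegral.integral_sub i1 i2] at this
  linarith

end BalanceLaw

/-! ### Energy comparison between spacelike graphs in a half-plane -/

/-- The flux density of the current `(p, w)` through the graph `t = h(r)`. -/
def graphFlux (p w : ℝ → ℝ → ℝ) (h h' : ℝ → ℝ) (r : ℝ) : ℝ := p (h r) r + h' r * w (h r) r

/-- A radial function `φ > 0` on `(ρ, ∞)` together with a primitive `x` of `1 / φ`. -/
structure TortoiseChart (ρ : ℝ) (φ x : ℝ → ℝ) : Prop where
  pos : ∀ r, ρ < r → 0 < φ r
  cont : ContinuousOn φ (Ioi ρ)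
  deriv : ∀ r, ρ < r → HasDerivAt x (φ r)⁻¹ r

/-- A graph over an interval which is spacelike for the null lines `t = c ± x(r)`. -/
structure SpacelikeGraph (ρ : ℝ) (φ : ℝ → ℝ) (I : Set ℝ) (h h' : ℝ → ℝ) : Prop where
  isOpen : IsOpen I
  ordConnected : I.OrdConnected
  subset : I ⊆ Ioi ρ
  deriv : ∀ r ∈ I, HasDerivAt h (h' r) r
  cont : ContinuousOn h' I
  spacelike : ∀ r ∈ I, |h' r| < (φ r)⁻¹

namespace SpacelikeGraph

variable {ρ : ℝ} {φ x : ℝ → ℝ} {I : Set ℝ} {h h' : ℝ → ℝ}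

theorem continuousOn (S : SpacelikeGraph ρ φ I h h') : ContinuousOn h I :=
  fun r hr => (S.deriv r hr).continuousAt.continuousWithinAt

/-- Along a spacelike graph the slope stays below that of an outgoing null line, so retarded time
strictly decreases with the radius. This orders the end points in `exists_endpoints`. -/
theorem strictAntiOn_sub (S : SpacelikeGraph ρ φ I h h') (X : TortoiseChart ρ φ x) :
    StrictAntiOn (fun r => h r - x r) I := by
  have hd : ∀ r ∈ I, HasDerivAt (fun r => h r - x r) (h' r - (φ r)⁻¹) r :=
    fun r hr => (S.deriv r hr).sub (X.deriv r (S.subset hr))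
  refine strictAntiOn_of_deriv_neg S.ordConnected.convex
    (fun r hr => (hd r hr).continuousAt.continuousWithinAt) fun r hr => ?_
  have hr' := interior_subset hr
  rw [(hd r hr').deriv]
  have := (abs_lt.1 (S.spacelike r hr')).2
  linarith

theorem strictMonoOn_add (S : SpacelikeGraph ρ φ I h h') (X : TortoiseChart ρ φ x) :
    StrictMonoOn (fun r => h r + x r) I := by
  have hd : ∀ r ∈ I, HasDerivAt (fun r => h r + x r) (h' r + (φ r)⁻¹) r :=
    fun r hr => (S.deriv r hr).add (X.deriv r (S.subset hr))
  refine strictMonoOn_of_deriv_pos S.ordConnected.convex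
    (fun r hr => (hd r hr).continuousAt.continuousWithinAt) fun r hr => ?_
  have hr' := interior_subset hr
  rw [(hd r hr').deriv]
  have := (abs_lt.1 (S.spacelike r hr')).1
  linarith

theorem neg (S : SpacelikeGraph ρ φ I h h') :
    SpacelikeGraph ρ φ I (fun r => -h r) (fun r => -h' r) where
  isOpen := S.isOpen
  ordConnected := S.ordConnected
  subset := S.subset
  deriv r hr := (S.deriv r hr).neg
  cont := S.cont.neg
  spacelike r hr := by simpa using S.spacelike r hr

end SpacelikeGraph

/-- An energy density `p` and flux `w` whose flux through null lines is nonnegative. -/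
structure EnergyLaw (ρ : ℝ) (φ : ℝ → ℝ) (p w : ℝ → ℝ → ℝ) : Prop where
  law : BalanceLaw ρ p w fun _ _ => 0
  outgoing : ∀ t r, ρ < r → 0 ≤ p t r + (φ r)⁻¹ * w t r
  ingoing : ∀ t r, ρ < r → 0 ≤ p t r - (φ r)⁻¹ * w t r

/-- The flux density is affine in the slope of the graph, so positivity in the two null directions
gives positivity for every slope between them. -/
theorem affine_nonneg_of_abs_le {p w c s : ℝ} (h1 : 0 ≤ p + c * w) (h2 : 0 ≤ p - c * w)
    (hs : |s| ≤ c) : 0 ≤ p + s * w := by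
  obtain ⟨hs1, hs2⟩ := abs_le.1 hs
  rcases le_total 0 w with hw | hw <;> nlinarith

theorem EnergyLaw.graphFlux_nonneg {ρ : ℝ} {φ : ℝ → ℝ} {p w : ℝ → ℝ → ℝ} (E : EnergyLaw ρ φ p w)
    {h h' : ℝ → ℝ} {r : ℝ} (hr : ρ < r) (hs : |h' r| ≤ (φ r)⁻¹) : 0 ≤ graphFlux p w h h' r :=
  affine_nonneg_of_abs_le (E.outgoing _ r hr) (E.ingoing _ r hr) hs

/-- Time reversal exchanges the two null directions. It turns the one-sided comparison of energies
into an equality in `graphEnergy_eq`. -/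
theorem EnergyLaw.neg {ρ : ℝ} {φ : ℝ → ℝ} {p w : ℝ → ℝ → ℝ} (E : EnergyLaw ρ φ p w) :
    EnergyLaw ρ φ (fun t r => p (-t) r) (fun t r => -w (-t) r) where
  law := by
    have hm : MapsTo (fun z : ℝ × ℝ => (-z.1, z.2)) (halfPlane ρ) (halfPlane ρ) :=
      fun z hz => ⟨trivial, hz.2⟩
    have hc : ContinuousOn (fun z : ℝ × ℝ => (-z.1, z.2)) (halfPlane ρ) := by fun_prop
    obtain ⟨w', h1, h2, h3⟩ := E.law.exists_deriv
    refine ⟨E.law.cont_density.comp hc hm, (E.law.cont_flux.comp hc hm).neg, continuousOn_const,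
      fun t r => -w' (-t) r, (h1.comp hc hm).neg, fun t r hr => (h2 (-t) r hr).neg, ?_⟩
    intro t r hr
    have := (h3 (-t) r hr).comp t (hasDerivAt_neg t)
    refine this.congr_deriv (by ring)
  outgoing t r hr := by simpa [sub_eq_add_neg] using E.ingoing (-t) r hr
  ingoing t r hr := by simpa [sub_eq_add_neg] using E.outgoing (-t) r hr

/-! ### Comparison of fluxes through two graphs joined by null segments -/

section Comparison

variable {ρ : ℝ} {φ x : ℝ → ℝ} {I : Set ℝ} {h₁ h₁' h₂ h₂' : ℝ → ℝ}

theorem continuousOn_graphFlux {p w : ℝ → ℝ → ℝ} {h h' : ℝ → ℝ}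
    (hp : ContinuousOn (fun z : ℝ × ℝ => p z.1 z.2) (halfPlane ρ))
    (hw : ContinuousOn (fun z : ℝ × ℝ => w z.1 z.2) (halfPlane ρ)) {s : Set ℝ} (hs : s ⊆ Ioi ρ)
    (hh : ContinuousOn h s) (hh' : ContinuousOn h' s) : ContinuousOn (graphFlux p w h h') s := by
  have hgr : ContinuousOn (fun r => (h r, r)) s := hh.prodMk continuousOn_id
  have hm : MapsTo (fun r => (h r, r)) s (halfPlane ρ) := fun r hr => ⟨trivial, hs hr⟩
  exact (hp.comp hgr hm).add (hh'.mul (hw.comp hgr hm))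

/-- The flux through an outgoing null segment, a graph and an ingoing null segment, compared with
the flux through a graph with the same end points. -/
theorem BalanceLaw.flux_sub_flux {p w κ : ℝ → ℝ → ℝ} (L : BalanceLaw ρ p w κ)
    (X : TortoiseChart ρ φ x)
    (S₁ : SpacelikeGraph ρ φ I h₁ h₁') (S₂ : SpacelikeGraph ρ φ I h₂ h₂') {a a' b' b : ℝ}
    (ha : a ∈ I) (hb : b ∈ I) (haa : a ≤ a') (hab : a' ≤ b') (hbb : b' ≤ b)
    (hl : h₁ a - x a = h₂ a' - x a') (hr : h₁ b + x b = h₂ b' + x b') :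
    ((∫ r in a..a', graphFlux p w (fun r => h₂ a' - x a' + x r) (fun r => (φ r)⁻¹) r)
      + (∫ r in a'..b', graphFlux p w h₂ h₂' r)
      + ∫ r in b'..b, graphFlux p w (fun r => h₂ b' + x b' - x r) (fun r => -(φ r)⁻¹) r)
      - ∫ r in a..b, graphFlux p w h₁ h₁' r
    = (∫ r in a..a', ∫ τ in (h₁ r)..(h₂ a' - x a' + x r), κ τ r)
      + (∫ r in a'..b', ∫ τ in (h₁ r)..(h₂ r), κ τ r)
      + ∫ r in b'..b, ∫ τ in (h₁ r)..(h₂ b' + x b' - x r), κ τ r := by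
  have hI : Icc a b ⊆ I := S₁.ordConnected.out ha hb
  have hρ : Icc a b ⊆ Ioi ρ := hI.trans S₁.subset
  have s1 : Icc a a' ⊆ Icc a b := Icc_subset_Icc le_rfl (hab.trans hbb)
  have s2 : Icc a' b' ⊆ Icc a b := Icc_subset_Icc haa hbb
  have s3 : Icc b' b ⊆ Icc a b := Icc_subset_Icc (haa.trans hab) le_rfl
  have hφ : ContinuousOn (fun r => (φ r)⁻¹) (Icc a b) :=
    (X.cont.mono hρ).inv₀ fun r hr => (X.pos r (hρ hr)).ne'
  have hx : ∀ r ∈ Icc a b, HasDerivAt x (φ r)⁻¹ r := fun r hr => X.deriv r (hρ hr)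
  have haρ : ρ < a := S₁.subset ha
  -- Potentials along the outgoing segment, the upper arc, the ingoing segment and the lower arc. By
  -- `hl` and `hr` these curves close up, so that the boundary values cancel at all four corners.
  have g1 := L.integral_graph haρ haa (H := fun r => h₂ a' - x a' + x r) (H' := fun r => (φ r)⁻¹)
    (fun r hr => (hx r (s1 hr)).const_add _) (hφ.mono s1)
  have g2 := L.integral_graph (haρ.trans_le haa) hab (H := h₂) (H' := h₂')
    (fun r hr => S₂.deriv r (hI (s2 hr))) (S₂.cont.mono (s2.trans hI))
  have g3 := L.integral_graph (haρ.trans_le (haa.trans hab)) hbb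
    (H := fun r => h₂ b' + x b' - x r) (H' := fun r => -(φ r)⁻¹)
    (fun r hr => (hx r (s3 hr)).const_sub _) (hφ.mono s3).neg
  have g4 := L.integral_graph haρ (haa.trans (hab.trans hbb)) (H := h₁) (H' := h₁')
    (fun r hr => S₁.deriv r (hI hr)) (S₁.cont.mono hI)
  have e1 : h₂ a' - x a' + x a = h₁ a := by linarith
  have e2 : h₂ b' + x b' - x b = h₁ b := by linarith
  simp only [sub_add_cancel, add_sub_cancel_right, e1, e2] at g1 g2 g3 g4
  have hx' : ContinuousOn x (Icc a b) := fun r hr => (hx r hr).continuousAt.continuousWithinAt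
  -- Measuring the accumulated source from the lower graph instead of from time 0 isolates the
  -- source between the two curves.
  have hkey : ∀ {c d : ℝ} {H : ℝ → ℝ}, c ≤ d → Icc c d ⊆ Icc a b → ContinuousOn H (Icc c d) →
      (∫ r in c..d, (p 0 r + ∫ τ in (0)..H r, κ τ r))
        = (∫ r in c..d, (p 0 r + ∫ τ in (0)..h₁ r, κ τ r))
          + ∫ r in c..d, ∫ τ in (h₁ r)..(H r), κ τ r := by
    intro c d H hcd hsub hH
    have hu : uIcc c d = Icc c d := uIcc_of_le hcd
    have hprim : ∀ {H : ℝ → ℝ}, ContinuousOn H (Icc c d) →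
        ContinuousOn (fun r => p 0 r + ∫ τ in (0)..H r, κ τ r) (Icc c d) := by
      intro H hH
      refine ContinuousOn.add ?_ ((continuousOn_primitive L.cont_source).comp
        (hH.prodMk continuousOn_id) (fun r hr => ⟨trivial, hρ (hsub hr)⟩))
      exact L.cont_density.comp (f := fun r => ((0 : ℝ), r)) (by fun_prop)
        (fun r hr => ⟨trivial, hρ (hsub hr)⟩)
    have hh₁ := S₁.continuousOn.mono (hsub.trans hI)
    have i1 : IntervalIntegrable (fun r => p 0 r + ∫ τ in (0)..H r, κ τ r) volume c d :=
      (hu ▸ hprim hH).intervalIntegrable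
    have i2 : IntervalIntegrable (fun r => p 0 r + ∫ τ in (0)..h₁ r, κ τ r) volume c d :=
      (hu ▸ hprim hh₁).intervalIntegrable
    rw [← sub_eq_iff_eq_add', ← intervalIntegral.integral_sub i1 i2]
    refine intervalIntegral.integral_congr fun r hr => ?_
    rw [hu] at hr
    have hc := continuous_slice L.cont_source (hρ (hsub hr))
    have := intervalIntegral.integral_interval_sub_left (a := 0) (b := H r) (c := h₁ r)
      (μ := volume) (f := fun τ => κ τ r) (hc.intervalIntegrable _ _) (hc.intervalIntegrable _ _)
    show _ = ∫ τ in (h₁ r)..(H r), κ τ r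
    rw [← this]
    ring
  have hint : ∀ {c d : ℝ}, c ≤ d → Icc c d ⊆ Icc a b →
      IntervalIntegrable (fun r => p 0 r + ∫ τ in (0)..h₁ r, κ τ r) volume c d := by
    intro c d hcd hsub
    refine ContinuousOn.intervalIntegrable ?_
    rw [uIcc_of_le hcd]
    refine ContinuousOn.add ?_ ((continuousOn_primitive L.cont_source).comp
      ((S₁.continuousOn.mono (hsub.trans hI)).prodMk continuousOn_id)
      (fun r hr => ⟨trivial, hρ (hsub hr)⟩))
    exact L.cont_density.comp (f := fun r => ((0 : ℝ), r)) (by fun_prop)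
      (fun r hr => ⟨trivial, hρ (hsub hr)⟩)
  rw [hkey haa s1 ((hx'.mono s1).const_add _)] at g1
  rw [hkey hab s2 (S₂.continuousOn.mono (s2.trans hI))] at g2
  rw [hkey (H := fun r => h₂ b' + x b' - x r) hbb s3 (continuousOn_const.sub (hx'.mono s3))] at g3
  have a1 := intervalIntegral.integral_add_adjacent_intervals (hint haa s1) (hint hab s2)
  have a2 := intervalIntegral.integral_add_adjacent_intervals
    ((hint haa s1).trans (hint hab s2)) (hint hbb s3)
  simp only [graphFlux]
  linarith

/-- The null lines through the ends of the upper arc are followed back to the lower graph. Since the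
upper graph lies in the future, monotonicity of h₁ ∓ x puts their feet outside the arc. -/
theorem exists_endpoints (X : TortoiseChart ρ φ x)
    (S₁ : SpacelikeGraph ρ φ I h₁ h₁') (hle : ∀ r ∈ I, h₁ r ≤ h₂ r)
    (hout : ∀ r ∈ I, ∃ s ∈ I, h₁ s - x s = h₂ r - x r)
    (hin : ∀ r ∈ I, ∃ s ∈ I, h₁ s + x s = h₂ r + x r) {a' b' : ℝ} (ha' : a' ∈ I) (hb' : b' ∈ I) :
    ∃ a ∈ I, ∃ b ∈ I, a ≤ a' ∧ b' ≤ b ∧ h₁ a - x a = h₂ a' - x a' ∧ h₁ b + x b = h₂ b' + x b' := by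
  obtain ⟨a, ha, hae⟩ := hout a' ha'
  obtain ⟨b, hb, hbe⟩ := hin b' hb'
  refine ⟨a, ha, b, hb, ?_, ?_, hae, hbe⟩
  · refine ((S₁.strictAntiOn_sub X).le_iff_ge ha' ha).1 ?_
    have := hle a' ha'
    linarith
  · refine ((S₁.strictMonoOn_add X).le_iff_le hb' hb).1 ?_
    have := hle b' hb'
    linarith

section NullSegments

variable {p w : ℝ → ℝ → ℝ}

theorem EnergyLaw.outgoing_flux_nonneg (E : EnergyLaw ρ φ p w) (X : TortoiseChart ρ φ x)
    {a b c : ℝ} (ha : ρ < a) (hab : a ≤ b) :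
    0 ≤ ∫ r in a..b, graphFlux p w (fun r => c + x r) (fun r => (φ r)⁻¹) r :=
  intervalIntegral.integral_nonneg hab fun r hr => by
    have hr' := ha.trans_le hr.1
    exact E.graphFlux_nonneg hr' (abs_of_pos (inv_pos.2 (X.pos r hr'))).le

theorem EnergyLaw.ingoing_flux_nonneg (E : EnergyLaw ρ φ p w) (X : TortoiseChart ρ φ x)
    {a b c : ℝ} (ha : ρ < a) (hab : a ≤ b) :
    0 ≤ ∫ r in a..b, graphFlux p w (fun r => c - x r) (fun r => -(φ r)⁻¹) r :=
  intervalIntegral.integral_nonneg hab fun r hr => by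
    have hr' := ha.trans_le hr.1
    refine E.graphFlux_nonneg hr' ?_
    rw [abs_neg]
    exact (abs_of_pos (inv_pos.2 (X.pos r hr'))).le

end NullSegments

/-- Without source, the upper arc and the two null segments together carry exactly the flux of the
lower arc, and the segments contribute nonnegatively. -/
theorem integral_graphFlux_le {p w : ℝ → ℝ → ℝ} (X : TortoiseChart ρ φ x)
    (S₁ : SpacelikeGraph ρ φ I h₁ h₁') (S₂ : SpacelikeGraph ρ φ I h₂ h₂') (E : EnergyLaw ρ φ p w)
    {a a' b' b : ℝ}
    (ha : a ∈ I) (hb : b ∈ I) (haa : a ≤ a') (hab : a' ≤ b') (hbb : b' ≤ b)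
    (hl : h₁ a - x a = h₂ a' - x a') (hr : h₁ b + x b = h₂ b' + x b') :
    ∫ r in a'..b', graphFlux p w h₂ h₂' r ≤ ∫ r in a..b, graphFlux p w h₁ h₁' r := by
  have haρ : ρ < a := S₁.subset ha
  have key := E.law.flux_sub_flux X S₁ S₂ ha hb haa hab hbb hl hr
  have n1 := E.outgoing_flux_nonneg X (c := h₂ a' - x a') haρ haa
  have n3 := E.ingoing_flux_nonneg X (c := h₂ b' + x b') (haρ.trans_le (haa.trans hab)) hbb
  simp only [intervalIntegral.integral_zero, add_zero] at key
  linarith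

theorem intervalIntegrable_graphFlux {p w : ℝ → ℝ → ℝ} {h h' : ℝ → ℝ} {a b : ℝ}
    (hp : ContinuousOn (fun z : ℝ × ℝ => p z.1 z.2) (halfPlane ρ))
    (hw : ContinuousOn (fun z : ℝ × ℝ => w z.1 z.2) (halfPlane ρ)) (hab : a ≤ b) (ha : ρ < a)
    (hh : ContinuousOn h (Icc a b)) (hh' : ContinuousOn h' (Icc a b)) :
    IntervalIntegrable (graphFlux p w h h') volume a b := by
  refine ContinuousOn.intervalIntegrable ?_
  rw [uIcc_of_le hab]
  exact continuousOn_graphFlux hp hw (fun r hr => ha.trans_le hr.1) hh hh'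

/-- The current `(j, v)` is dominated by `C` times the energy current `(p, w)` on null lines. -/
def Dominated (ρ : ℝ) (φ : ℝ → ℝ) (C : ℝ) (p w j v : ℝ → ℝ → ℝ) : Prop :=
  ∀ t r, ρ < r → |j t r + (φ r)⁻¹ * v t r| ≤ C * (p t r + (φ r)⁻¹ * w t r) ∧
    |j t r - (φ r)⁻¹ * v t r| ≤ C * (p t r - (φ r)⁻¹ * w t r)

/-- Domination says that the currents C (p, w) ± (j, v) have nonnegative flux in both null
directions, hence in all directions between. -/
theorem Dominated.abs_graphFlux_le {C : ℝ} {p w j v : ℝ → ℝ → ℝ} (D : Dominated ρ φ C p w j v)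
    {h h' : ℝ → ℝ} {r : ℝ} (hr : ρ < r) (hs : |h' r| ≤ (φ r)⁻¹) :
    |graphFlux j v h h' r| ≤ C * graphFlux p w h h' r := by
  obtain ⟨h1, h2⟩ := D (h r) r hr
  rw [abs_le] at h1 h2 ⊢
  have m1 := affine_nonneg_of_abs_le (p := C * p (h r) r - j (h r) r)
    (w := C * w (h r) r - v (h r) r) (c := (φ r)⁻¹) (by linarith) (by linarith) hs
  have m2 := affine_nonneg_of_abs_le (p := C * p (h r) r + j (h r) r)
    (w := C * w (h r) r + v (h r) r) (c := (φ r)⁻¹) (by linarith) (by linarith) hs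
  unfold graphFlux
  constructor <;> linarith

/-- The source below the upper chain is the difference of its `j`-flux and that of the lower arc.
Both are at most `C` times an energy flux, and the two energy fluxes agree by conservation; hence
the factor 2C. The null segments must be kept, for their energy pays for their `j`-flux. -/
theorem integral_source_le {p w j v κ : ℝ → ℝ → ℝ} {C : ℝ} (X : TortoiseChart ρ φ x)
    (S₁ : SpacelikeGraph ρ φ I h₁ h₁') (S₂ : SpacelikeGraph ρ φ I h₂ h₂')
    (E : EnergyLaw ρ φ p w) (L : BalanceLaw ρ j v κ)
    (hκ : ∀ t r, ρ < r → 0 ≤ κ t r) (D : Dominated ρ φ C p w j v) {a a' b' b : ℝ}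
    (ha : a ∈ I) (hb : b ∈ I) (haa : a ≤ a') (hab : a' ≤ b') (hbb : b' ≤ b)
    (hl : h₁ a - x a = h₂ a' - x a') (hr : h₁ b + x b = h₂ b' + x b') :
    ∫ r in a'..b', ∫ τ in (h₁ r)..(h₂ r), κ τ r
      ≤ 2 * C * ∫ r in a..b, graphFlux p w h₁ h₁' r := by
  have haρ : ρ < a := S₁.subset ha
  have hI : Icc a b ⊆ I := S₁.ordConnected.out ha hb
  have hρ : Icc a b ⊆ Ioi ρ := hI.trans S₁.subset
  have s1 : Icc a a' ⊆ Icc a b := Icc_subset_Icc le_rfl (hab.trans hbb)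
  have s2 : Icc a' b' ⊆ Icc a b := Icc_subset_Icc haa hbb
  have s3 : Icc b' b ⊆ Icc a b := Icc_subset_Icc (haa.trans hab) le_rfl
  have kE := E.law.flux_sub_flux X S₁ S₂ ha hb haa hab hbb hl hr
  have kL := L.flux_sub_flux X S₁ S₂ ha hb haa hab hbb hl hr
  simp only [intervalIntegral.integral_zero, add_zero] at kE
  have hφ : ContinuousOn (fun r => (φ r)⁻¹) (Icc a b) :=
    (X.cont.mono hρ).inv₀ fun r hr => (X.pos r (hρ hr)).ne'
  have hx : ContinuousOn x (Icc a b) :=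
    fun r hr => (X.deriv r (hρ hr)).continuousAt.continuousWithinAt
  have hcmp : ∀ {c d : ℝ} {h h' : ℝ → ℝ}, c ≤ d → Icc c d ⊆ Icc a b → ContinuousOn h (Icc c d) →
      ContinuousOn h' (Icc c d) → (∀ r ∈ Icc c d, |h' r| ≤ (φ r)⁻¹) →
      |∫ r in c..d, graphFlux j v h h' r| ≤ C * ∫ r in c..d, graphFlux p w h h' r := by
    intro c d h h' hcd hsub hh hh' hs
    have hc : ρ < c := hρ (hsub (left_mem_Icc.2 hcd))
    rw [← intervalIntegral.integral_const_mul]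
    refine (intervalIntegral.abs_integral_le_integral_abs hcd).trans
      (intervalIntegral.integral_mono_on hcd ?_ ?_ fun r hr =>
        D.abs_graphFlux_le (hρ (hsub hr)) (hs r hr))
    · exact (intervalIntegrable_graphFlux L.cont_density L.cont_flux hcd hc hh hh').abs
    · exact (intervalIntegrable_graphFlux E.law.cont_density E.law.cont_flux hcd hc hh
        hh').const_mul C
  have c1 := hcmp (h := fun r => h₂ a' - x a' + x r) (h' := fun r => (φ r)⁻¹) haa s1
    (continuousOn_const.add (hx.mono s1)) (hφ.mono s1)
    (fun r hr => (abs_of_pos (inv_pos.2 (X.pos r (hρ (s1 hr))))).le)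
  have c2 := hcmp (h := h₂) (h' := h₂') hab s2 (S₂.continuousOn.mono (s2.trans hI))
    (S₂.cont.mono (s2.trans hI)) (fun r hr => (S₂.spacelike r (hI (s2 hr))).le)
  have c3 := hcmp (h := fun r => h₂ b' + x b' - x r) (h' := fun r => -(φ r)⁻¹) hbb s3
    (continuousOn_const.sub (hx.mono s3)) (hφ.mono s3).neg
    (fun r hr => by
      rw [abs_neg]; exact (abs_of_pos (inv_pos.2 (X.pos r (hρ (s3 hr))))).le)
  have c4 := hcmp (h := h₁) (h' := h₁') (haa.trans (hab.trans hbb)) Subset.rfl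
    (S₁.continuousOn.mono hI) (S₁.cont.mono hI) (fun r hr => (S₁.spacelike r (hI hr)).le)
  -- Over the outer pieces the null segment lies above the lower graph, so the source there is
  -- nonnegative and can be dropped.
  have d1 : 0 ≤ ∫ r in a..a', ∫ τ in (h₁ r)..(h₂ a' - x a' + x r), κ τ r := by
    refine intervalIntegral.integral_nonneg haa fun r hr =>
      intervalIntegral.integral_nonneg ?_ fun τ _ => hκ τ r (hρ (s1 hr))
    have := (S₁.strictAntiOn_sub X).antitoneOn ha (hI (s1 hr)) hr.1
    linarith
  have d3 : 0 ≤ ∫ r in b'..b, ∫ τ in (h₁ r)..(h₂ b' + x b' - x r), κ τ r := by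
    refine intervalIntegral.integral_nonneg hbb fun r hr =>
      intervalIntegral.integral_nonneg ?_ fun τ _ => hκ τ r (hρ (s3 hr))
    have := (S₁.strictMonoOn_add X).monotoneOn (hI (s3 hr)) hb hr.2
    linarith
  have := (abs_le.1 c1).2
  have := (abs_le.1 c2).2
  have := (abs_le.1 c3).2
  have := (abs_le.1 c4).1
  -- Conservation of energy: the upper chain carries as much as the lower arc.
  have e : C * ((∫ r in a..a', graphFlux p w (fun r => h₂ a' - x a' + x r) (fun r => (φ r)⁻¹) r)
      + (∫ r in a'..b', graphFlux p w h₂ h₂' r)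
      + ∫ r in b'..b, graphFlux p w (fun r => h₂ b' + x b' - x r) (fun r => -(φ r)⁻¹) r)
      = C * ∫ r in a..b, graphFlux p w h₁ h₁' r := by
    rw [sub_eq_zero.1 kE]
  nlinarith

/-! ### Exhaustion -/

theorem ordConnected_eq_iUnion_Icc {I : Set ℝ} (hI : IsOpen I) (hc : I.OrdConnected) :
    I = ⋃ q : {q : ℚ × ℚ // (q.1 : ℝ) ∈ I ∧ (q.2 : ℝ) ∈ I}, Icc (q.1.1 : ℝ) (q.1.2 : ℝ) := by
  ext r
  simp only [mem_iUnion]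
  constructor
  · intro hr
    obtain ⟨ε, hε, hεI⟩ := Metric.isOpen_iff.1 hI r hr
    obtain ⟨q1, h1, h1'⟩ := exists_rat_btwn (show r - ε < r by linarith)
    obtain ⟨q2, h2, h2'⟩ := exists_rat_btwn (show r < r + ε by linarith)
    refine ⟨⟨(q1, q2), hεI ?_, hεI ?_⟩, h1'.le, h2.le⟩ <;>
      rw [Metric.mem_ball, Real.dist_eq, abs_lt] <;> constructor <;> linarith
  · rintro ⟨⟨q, h1, h2⟩, hr⟩
    exact hc.out h1 h2 hr

/-- Compact intervals with rational end points in `I` form a countable directed cover, so monotone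
convergence reduces the bound to such intervals. -/
theorem lintegral_le_of_forall_Icc {I : Set ℝ} (hI : IsOpen I) (hc : I.OrdConnected)
    {f : ℝ → ℝ≥0∞} {B : ℝ≥0∞}
    (h : ∀ a ∈ I, ∀ b ∈ I, a ≤ b → ∫⁻ r in Icc a b, f r ≤ B) : ∫⁻ r in I, f r ≤ B := by
  conv_lhs => rw [ordConnected_eq_iUnion_Icc hI hc]
  rw [setLIntegral_iUnion_of_directed]
  · refine iSup_le fun q => ?_
    rcases le_or_gt (q.1.1 : ℝ) (q.1.2 : ℝ) with hq | hq
    · exact h _ q.2.1 _ q.2.2 hq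
    · rw [Icc_eq_empty hq.not_ge]
      simp
  · rintro ⟨q, hq1, hq2⟩ ⟨s, hs1, hs2⟩
    refine ⟨⟨(min q.1 s.1, max q.2 s.2), ?_, ?_⟩, ?_, ?_⟩
    · rcases min_choice q.1 s.1 with e | e <;> simp only [e] <;> assumption
    · rcases max_choice q.2 s.2 with e | e <;> simp only [e] <;> assumption
    · exact Icc_subset_Icc (by push_cast; exact min_le_left _ _)
        (by push_cast; exact le_max_left _ _)
    · exact Icc_subset_Icc (by push_cast; exact min_le_right _ _)
        (by push_cast; exact le_max_right _ _)

theorem lintegral_Icc_eq_ofReal {f : ℝ → ℝ} {a b : ℝ} (hab : a ≤ b) (hf : ContinuousOn f (Icc a b))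
    (h0 : ∀ r ∈ Icc a b, 0 ≤ f r) :
    ∫⁻ r in Icc a b, ENNReal.ofReal (f r) = ENNReal.ofReal (∫ r in a..b, f r) := by
  rw [intervalIntegral.integral_of_le hab, ← integral_Icc_eq_integral_Ioc,
    ofReal_integral_eq_lintegral_ofReal (hf.integrableOn_compact isCompact_Icc)]
  filter_upwards [ae_restrict_mem measurableSet_Icc] with r hr using h0 r hr

/-- The energy of the current `(p, w)` on a graph over `I`. -/
def graphEnergy (p w : ℝ → ℝ → ℝ) (I : Set ℝ) (h h' : ℝ → ℝ) : ℝ≥0∞ :=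
  ∫⁻ r in I, ENNReal.ofReal (graphFlux p w h h' r)

theorem ofReal_integral_le_graphEnergy {p w : ℝ → ℝ → ℝ} {h h' : ℝ → ℝ}
    (S : SpacelikeGraph ρ φ I h h') (E : EnergyLaw ρ φ p w) {a b : ℝ} (ha : a ∈ I) (hb : b ∈ I)
    (hab : a ≤ b) :
    ENNReal.ofReal (∫ r in a..b, graphFlux p w h h' r) ≤ graphEnergy p w I h h' := by
  have hI : Icc a b ⊆ I := S.ordConnected.out ha hb
  rw [← lintegral_Icc_eq_ofReal hab]
  · exact lintegral_mono_set hI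
  · exact continuousOn_graphFlux E.law.cont_density E.law.cont_flux (hI.trans S.subset)
      (S.continuousOn.mono hI) (S.cont.mono hI)
  · exact fun r hr => E.graphFlux_nonneg (S.subset (hI hr)) (S.spacelike r (hI hr)).le

theorem graphEnergy_le {p w : ℝ → ℝ → ℝ} (X : TortoiseChart ρ φ x)
    (S₁ : SpacelikeGraph ρ φ I h₁ h₁') (S₂ : SpacelikeGraph ρ φ I h₂ h₂')
    (hle : ∀ r ∈ I, h₁ r ≤ h₂ r) (hout : ∀ r ∈ I, ∃ s ∈ I, h₁ s - x s = h₂ r - x r)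
    (hin : ∀ r ∈ I, ∃ s ∈ I, h₁ s + x s = h₂ r + x r) (E : EnergyLaw ρ φ p w) :
    graphEnergy p w I h₂ h₂' ≤ graphEnergy p w I h₁ h₁' := by
  refine lintegral_le_of_forall_Icc S₁.isOpen S₁.ordConnected fun a' ha' b' hb' hab => ?_
  obtain ⟨a, ha, b, hb, haa, hbb, hl, hr⟩ := exists_endpoints X S₁ hle hout hin ha' hb'
  have hI : Icc a' b' ⊆ I := S₁.ordConnected.out ha' hb'
  rw [lintegral_Icc_eq_ofReal hab]
  · exact (ENNReal.ofReal_le_ofReal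
      (integral_graphFlux_le X S₁ S₂ E ha hb haa hab hbb hl hr)).trans
      (ofReal_integral_le_graphEnergy S₁ E ha hb (haa.trans (hab.trans hbb)))
  · exact continuousOn_graphFlux E.law.cont_density E.law.cont_flux (hI.trans S₁.subset)
      (S₂.continuousOn.mono hI) (S₂.cont.mono hI)
  · exact fun r hr => E.graphFlux_nonneg (S₁.subset (hI hr)) (S₂.spacelike r (hI hr)).le

/-- The reverse inequality is `graphEnergy_le` after t ↦ -t. The upper graph becomes the lower one,
and the hypotheses on outgoing and ingoing lines are interchanged. -/
theorem graphEnergy_eq {p w : ℝ → ℝ → ℝ} (X : TortoiseChart ρ φ x)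
    (S₁ : SpacelikeGraph ρ φ I h₁ h₁') (S₂ : SpacelikeGraph ρ φ I h₂ h₂')
    (hle : ∀ r ∈ I, h₁ r ≤ h₂ r) (hout : ∀ r ∈ I, ∃ s ∈ I, h₁ s - x s = h₂ r - x r)
    (hin : ∀ r ∈ I, ∃ s ∈ I, h₁ s + x s = h₂ r + x r)
    (hout' : ∀ r ∈ I, ∃ s ∈ I, h₂ s - x s = h₁ r - x r)
    (hin' : ∀ r ∈ I, ∃ s ∈ I, h₂ s + x s = h₁ r + x r) (E : EnergyLaw ρ φ p w) :
    graphEnergy p w I h₂ h₂' = graphEnergy p w I h₁ h₁' := by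
  refine le_antisymm (graphEnergy_le X S₁ S₂ hle hout hin E) ?_
  have := graphEnergy_le X S₂.neg S₁.neg (fun r hr => neg_le_neg (hle r hr))
    (fun r hr => by
      obtain ⟨s, hs, e⟩ := hin' r hr
      exact ⟨s, hs, by linarith⟩)
    (fun r hr => by
      obtain ⟨s, hs, e⟩ := hout' r hr
      exact ⟨s, hs, by linarith⟩) E.neg
  simpa only [graphEnergy, graphFlux, neg_neg, neg_mul_neg] using this

/-- The minorant `T` carries no regularity assumption: only the continuous source `κ` is integrated
exactly. -/
theorem lintegral_source_le {p w j v κ T : ℝ → ℝ → ℝ} {C : ℝ} (X : TortoiseChart ρ φ x)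
    (S₁ : SpacelikeGraph ρ φ I h₁ h₁') (S₂ : SpacelikeGraph ρ φ I h₂ h₂')
    (hle : ∀ r ∈ I, h₁ r ≤ h₂ r) (hout : ∀ r ∈ I, ∃ s ∈ I, h₁ s - x s = h₂ r - x r)
    (hin : ∀ r ∈ I, ∃ s ∈ I, h₁ s + x s = h₂ r + x r) (E : EnergyLaw ρ φ p w)
    (L : BalanceLaw ρ j v κ) (hκ : ∀ t r, ρ < r → 0 ≤ κ t r) (hT : ∀ t r, ρ < r → T t r ≤ κ t r)
    (hC : 0 ≤ C) (D : Dominated ρ φ C p w j v) :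
    ∫⁻ r in I, ∫⁻ t in Ioo (h₁ r) (h₂ r), ENNReal.ofReal (T t r)
      ≤ ENNReal.ofReal (2 * C) * graphEnergy p w I h₁ h₁' := by
  refine lintegral_le_of_forall_Icc S₁.isOpen S₁.ordConnected fun a' ha' b' hb' hab => ?_
  obtain ⟨a, ha, b, hb, haa, hbb, hl, hr⟩ := exists_endpoints X S₁ hle hout hin ha' hb'
  have hI : Icc a' b' ⊆ I := S₁.ordConnected.out ha' hb'
  have hinner : ∀ r ∈ Icc a' b', ∫⁻ t in Ioo (h₁ r) (h₂ r), ENNReal.ofReal (T t r)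
      ≤ ENNReal.ofReal (∫ τ in (h₁ r)..(h₂ r), κ τ r) := by
    intro r hr
    have hrρ := S₁.subset (hI hr)
    rw [← lintegral_Icc_eq_ofReal (hle r (hI hr))
      (continuous_slice L.cont_source hrρ).continuousOn (fun t _ => hκ t r hrρ)]
    exact (lintegral_mono_set Ioo_subset_Icc_self).trans
      (lintegral_mono fun t => ENNReal.ofReal_le_ofReal (hT t r hrρ))
  have hprim : ∀ h : ℝ → ℝ, ContinuousOn h (Icc a' b') →
      ContinuousOn (fun r => ∫ τ in (0)..h r, κ τ r) (Icc a' b') := fun h hh =>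
    (continuousOn_primitive L.cont_source).comp (hh.prodMk continuousOn_id)
      (fun r hr => ⟨trivial, S₁.subset (hI hr)⟩)
  have hcont : ContinuousOn (fun r => ∫ τ in (h₁ r)..(h₂ r), κ τ r) (Icc a' b') := by
    refine ((hprim h₂ (S₂.continuousOn.mono hI)).sub
      (hprim h₁ (S₁.continuousOn.mono hI))).congr fun r hr => ?_
    have hc := continuous_slice L.cont_source (S₁.subset (hI hr))
    exact (intervalIntegral.integral_interval_sub_left (hc.intervalIntegrable _ _)
      (hc.intervalIntegrable _ _)).symm
  calc ∫⁻ r in Icc a' b', ∫⁻ t in Ioo (h₁ r) (h₂ r), ENNReal.ofReal (T t r)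
      ≤ ∫⁻ r in Icc a' b', ENNReal.ofReal (∫ τ in (h₁ r)..(h₂ r), κ τ r) :=
        setLIntegral_mono' measurableSet_Icc hinner
    _ = ENNReal.ofReal (∫ r in a'..b', ∫ τ in (h₁ r)..(h₂ r), κ τ r) :=
        lintegral_Icc_eq_ofReal hab hcont fun r hr =>
          intervalIntegral.integral_nonneg (hle r (hI hr)) fun t _ => hκ t r (S₁.subset (hI hr))
    _ ≤ ENNReal.ofReal (2 * C * ∫ r in a..b, graphFlux p w h₁ h₁' r) :=
        ENNReal.ofReal_le_ofReal
          (integral_source_le X S₁ S₂ E L hκ D ha hb haa hab hbb hl hr)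
    _ = ENNReal.ofReal (2 * C) * ENNReal.ofReal (∫ r in a..b, graphFlux p w h₁ h₁' r) :=
        ENNReal.ofReal_mul (by linarith)
    _ ≤ _ := by
        gcongr
        exact ofReal_integral_le_graphEnergy S₁ E ha hb (haa.trans (hab.trans hbb))

end Comparison

/-! ### The area measure of the unit sphere in `ℝ³` -/

/-- The unit sphere in `ℝ³`. -/
def unitSphere : Set (Fin 3 → ℝ) := {y | y 0 ^ 2 + y 1 ^ 2 + y 2 ^ 2 = 1}

theorem norm_toLp_eq (y : Fin 3 → ℝ) :
    ‖WithLp.toLp 2 y‖ = SphericalHypersurface.spatialRadius y := by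
  simp [EuclideanSpace.norm_eq, Fin.sum_univ_three, SphericalHypersurface.spatialRadius]

theorem mem_unitSphere_iff_norm {y : Fin 3 → ℝ} : y ∈ unitSphere ↔ ‖WithLp.toLp 2 y‖ = 1 := by
  rw [norm_toLp_eq, SphericalHypersurface.spatialRadius, Real.sqrt_eq_one]
  rfl

theorem isCompact_unitSphere : IsCompact unitSphere := by
  have : unitSphere = (fun y : EuclideanSpace ℝ (Fin 3) => y.ofLp) '' Metric.sphere 0 1 := by
    ext y
    rw [mem_unitSphere_iff_norm]
    constructor
    · intro h
      exact ⟨WithLp.toLp 2 y, by simpa using h, rfl⟩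
    · rintro ⟨z, hz, rfl⟩
      simpa using hz
  rw [this]
  exact (isCompact_sphere _ _).image (by fun_prop)

/-- The surface measure of the unit sphere, as a measure on `ℝ³`. -/
def sphereMeasure : Measure (Fin 3 → ℝ) :=
  ((volume : Measure (EuclideanSpace ℝ (Fin 3))).toSphere).map fun θ => θ.1.ofLp

theorem measurable_sphere_ofLp :
    Measurable fun θ : Metric.sphere (0 : EuclideanSpace ℝ (Fin 3)) 1 => θ.1.ofLp := by
  have : Continuous fun θ : Metric.sphere (0 : EuclideanSpace ℝ (Fin 3)) 1 => θ.1.ofLp := by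
    fun_prop
  exact this.measurable

instance : IsFiniteMeasure sphereMeasure := by
  unfold sphereMeasure
  infer_instance

theorem sphereMeasure_restrict : sphereMeasure.restrict unitSphere = sphereMeasure := by
  refine Measure.restrict_eq_self_of_ae_mem ?_
  have hm : MeasurableSet {y : Fin 3 → ℝ | y ∈ unitSphere} := isCompact_unitSphere.measurableSet
  rw [sphereMeasure, ae_map_iff measurable_sphere_ofLp.aemeasurable hm]
  refine Eventually.of_forall fun θ => ?_
  rw [mem_unitSphere_iff_norm]
  simp

/-- Transported from `EuclideanSpace`, because the norm of `Fin 3 → ℝ` is the supremum norm. The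
weight r² is the density of `Measure.volumeIoiPow` with exponent one less than the dimension. -/
theorem lintegral_polar {f : (Fin 3 → ℝ) → ℝ≥0∞} (hf : Measurable f) :
    ∫⁻ y, f y = ∫⁻ r in Ioi (0 : ℝ),
      ENNReal.ofReal (r ^ 2) * ∫⁻ θ in unitSphere, f (r • θ) ∂sphereMeasure := by
  set e := homeomorphUnitSphereProd (EuclideanSpace ℝ (Fin 3))
  have hmp := Measure.measurePreserving_homeomorphUnitSphereProd
    (volume : Measure (EuclideanSpace ℝ (Fin 3)))
  have hdim : Module.finrank ℝ (EuclideanSpace ℝ (Fin 3)) - 1 = 2 := by simp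
  rw [hdim] at hmp
  have hg : Measurable fun z : Metric.sphere (0 : EuclideanSpace ℝ (Fin 3)) 1 × Ioi (0 : ℝ) =>
      f (z.2.1 • z.1.1.ofLp) := by
    refine hf.comp (Continuous.measurable ?_)
    fun_prop
  have hval : ∀ y : ({0}ᶜ : Set (EuclideanSpace ℝ (Fin 3))),
      f y.1.ofLp = f ((e y).2.1 • (e y).1.1.ofLp) := by
    intro y
    have : ((e.symm (e y) : ({0}ᶜ : Set (EuclideanSpace ℝ (Fin 3)))) :
        EuclideanSpace ℝ (Fin 3)) = (e y).2.1 • (e y).1.1 := rfl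
    rw [e.symm_apply_apply] at this
    rw [this]
    rfl
  calc ∫⁻ y, f y = ∫⁻ y : EuclideanSpace ℝ (Fin 3), f y.ofLp :=
        ((PiLp.volume_preserving_ofLp (Fin 3)).lintegral_comp hf).symm
    _ = ∫⁻ y in ({0}ᶜ : Set (EuclideanSpace ℝ (Fin 3))), f y.ofLp := by
        rw [restrict_compl_singleton]
    _ = ∫⁻ y : ({0}ᶜ : Set (EuclideanSpace ℝ (Fin 3))), f y.1.ofLp
          ∂(volume : Measure (EuclideanSpace ℝ (Fin 3))).comap Subtype.val :=
        (lintegral_subtype_comap (measurableSet_singleton _).compl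
          fun y : EuclideanSpace ℝ (Fin 3) => f y.ofLp).symm
    _ = ∫⁻ z, f (z.2.1 • z.1.1.ofLp)
          ∂((volume : Measure (EuclideanSpace ℝ (Fin 3))).toSphere.prod
            (Measure.volumeIoiPow 2)) := by
        rw [← hmp.lintegral_comp hg]
        exact lintegral_congr hval
    _ = ∫⁻ r : Ioi (0 : ℝ), ∫⁻ θ, f (r.1 • θ.1.ofLp)
          ∂(volume : Measure (EuclideanSpace ℝ (Fin 3))).toSphere ∂(Measure.volumeIoiPow 2) :=
        lintegral_prod_symm' _ hg
    _ = ∫⁻ r : Ioi (0 : ℝ), ∫⁻ θ in unitSphere, f (r.1 • θ) ∂sphereMeasure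
          ∂(Measure.volumeIoiPow 2) := by
        refine lintegral_congr fun r => ?_
        rw [sphereMeasure_restrict, sphereMeasure,
          lintegral_map (f := fun θ => f (r.1 • θ)) (hf.comp (by fun_prop)) measurable_sphere_ofLp]
    _ = ∫⁻ r : Ioi (0 : ℝ), ENNReal.ofReal (r.1 ^ 2) *
          ∫⁻ θ in unitSphere, f (r.1 • θ) ∂sphereMeasure ∂(Measure.comap Subtype.val volume) := by
        rw [Measure.volumeIoiPow, lintegral_withDensity_eq_lintegral_mul]
        · rfl
        · fun_prop
        · exact Measurable.lintegral_prod_right' (f := fun z : Ioi (0 : ℝ) × (Fin 3 → ℝ) =>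
            f (z.1.1 • z.2)) (hf.comp (by fun_prop))
    _ = _ := lintegral_subtype_comap measurableSet_Ioi fun r =>
        ENNReal.ofReal (r ^ 2) * ∫⁻ θ in unitSphere, f (r • θ) ∂sphereMeasure

/-! ### Rotations -/

/-- The rotation by the angle `s` about the `i`-th axis. -/
def rotation (i : Fin 3) (s : ℝ) (y : Fin 3 → ℝ) : Fin 3 → ℝ :=
  fun m => if m = i then y i else if m = i + 1 then Real.cos s * y (i + 1) - Real.sin s * y (i + 2)
    else Real.sin s * y (i + 1) + Real.cos s * y (i + 2)

/-- The rotation as a linear isometry of Euclidean space. -/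
def rotationIsometry (i : Fin 3) (s : ℝ) :
    EuclideanSpace ℝ (Fin 3) ≃ₗᵢ[ℝ] EuclideanSpace ℝ (Fin 3) :=
  LinearIsometry.toLinearIsometryEquiv
    { toFun := fun y => WithLp.toLp 2 (rotation i s y.ofLp)
      map_add' := fun y z => by
        ext m
        simp only [rotation, PiLp.add_apply]
        split_ifs <;> ring
      map_smul' := fun c y => by
        ext m
        simp only [rotation, PiLp.smul_apply, smul_eq_mul, RingHom.id_apply]
        split_ifs <;> ring
      norm_map' := fun y => by
        have h := Real.sin_sq_add_cos_sq s
        change ‖WithLp.toLp 2 (rotation i s y.ofLp)‖ = ‖WithLp.toLp 2 y.ofLp‖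
        rw [norm_toLp_eq, norm_toLp_eq, SphericalHypersurface.spatialRadius,
          SphericalHypersurface.spatialRadius]
        congr 1
        fin_cases i <;> simp [rotation] <;> grind }
    rfl

/-- The surface measure of a set is, up to a factor, the volume of the cone over it, and a linear
isometry preserves both cones and volumes. -/
theorem toSphere_map_linearIsometryEquiv {E : Type*} [NormedAddCommGroup E] [InnerProductSpace ℝ E]
    [FiniteDimensional ℝ E] [MeasurableSpace E] [BorelSpace E] (L : E ≃ₗᵢ[ℝ] E) :
    (volume : Measure E).toSphere.map
      (fun θ => (⟨L θ.1, by simp⟩ : Metric.sphere (0 : E) 1))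
      = (volume : Measure E).toSphere := by
  have hc : Continuous
      (fun θ : Metric.sphere (0 : E) 1 => (⟨L θ.1, by simp⟩ : Metric.sphere (0 : E) 1)) :=
    by fun_prop
  ext A hA
  rw [Measure.map_apply hc.measurable hA, Measure.toSphere_apply' _ hA,
    Measure.toSphere_apply' _ (hc.measurable hA)]
  congr 1
  rw [← L.measurePreserving.measure_preimage_equiv (f := L.toMeasurableEquiv)
    (Ioo (0 : ℝ) 1 • (Subtype.val '' A))]
  congr 1
  ext y
  rw [mem_preimage, Set.mem_smul, Set.mem_smul]
  constructor
  · rintro ⟨c, hc, _, ⟨z, hz, rfl⟩, rfl⟩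
    refine ⟨c, hc, _, ⟨⟨L z.1, by simp⟩, hz, rfl⟩, ?_⟩
    exact (map_smul L c z.1).symm
  · rintro ⟨c, hc, _, ⟨z, hzA, rfl⟩, h⟩
    refine ⟨c, hc, L.symm z.1, ⟨⟨L.symm z.1, by simp⟩, ?_, rfl⟩, ?_⟩
    · simpa using hzA
    · apply L.injective
      simpa using h

theorem continuous_rotation (i : Fin 3) (s : ℝ) : Continuous (rotation i s) := by
  refine continuous_pi fun m => ?_
  unfold rotation
  split_ifs <;> fun_prop

theorem sphereMeasure_map_rotation (i : Fin 3) (s : ℝ) :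
    sphereMeasure.map (rotation i s) = sphereMeasure := by
  have hc : Continuous (fun θ : Metric.sphere (0 : EuclideanSpace ℝ (Fin 3)) 1 =>
      (⟨rotationIsometry i s θ.1, by simp⟩ :
        Metric.sphere (0 : EuclideanSpace ℝ (Fin 3)) 1)) := by fun_prop
  conv_rhs => rw [sphereMeasure, ← toSphere_map_linearIsometryEquiv (rotationIsometry i s)]
  rw [sphereMeasure, Measure.map_map (continuous_rotation i s).measurable measurable_sphere_ofLp,
    Measure.map_map measurable_sphere_ofLp hc.measurable]
  rfl

theorem integral_comp_rotation (i : Fin 3) (s : ℝ) {u : (Fin 3 → ℝ) → ℝ}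
    (hu : ContinuousOn u unitSphere) :
    ∫ θ in unitSphere, u (rotation i s θ) ∂sphereMeasure
      = ∫ θ in unitSphere, u θ ∂sphereMeasure := by
  have hm : AEStronglyMeasurable u (sphereMeasure.map (rotation i s)) := by
    rw [sphereMeasure_map_rotation, ← sphereMeasure_restrict]
    exact hu.aestronglyMeasurable isCompact_unitSphere.measurableSet
  rw [sphereMeasure_restrict]
  conv_rhs => rw [← sphereMeasure_map_rotation i s]
  rw [integral_map (continuous_rotation i s).aemeasurable hm]

theorem rotation_mem_unitSphere (i : Fin 3) (s : ℝ) {θ : Fin 3 → ℝ} (hθ : θ ∈ unitSphere) :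
    rotation i s θ ∈ unitSphere := by
  rw [mem_unitSphere_iff_norm] at hθ ⊢
  rw [← hθ]
  exact (rotationIsometry i s).norm_map (WithLp.toLp 2 θ)

theorem hasDerivAt_rotation (i : Fin 3) (s : ℝ) (θ : Fin 3 → ℝ) :
    HasDerivAt (fun s => rotation i s θ)
      (fun m => if m = i then 0 else if m = i + 1 then -rotation i s θ (i + 2)
        else rotation i s θ (i + 1)) s := by
  rw [hasDerivAt_pi]
  intro m
  have h1 : i + 1 ≠ i := by fin_cases i <;> decide
  have h2 : i + 2 ≠ i := by fin_cases i <;> decide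
  have h3 : i + 2 ≠ i + 1 := by fin_cases i <;> decide
  simp only [rotation, if_neg h1, if_neg h2, if_neg h3, if_true]
  split_ifs with a b
  · exact hasDerivAt_const _ _
  · exact (((Real.hasDerivAt_cos s).mul_const _).sub
      ((Real.hasDerivAt_sin s).mul_const _)).congr_deriv (by ring)
  · exact (((Real.hasDerivAt_sin s).mul_const _).add
      ((Real.hasDerivAt_cos s).mul_const _)).congr_deriv (by ring)

/-! ### Calculus on the exterior -/

/-- Smooth functions on the exterior. -/
def Smooth (M : ℝ) (u : Pt → ℝ) : Prop := ContDiffOn ℝ ∞ u (exterior M)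

/-- `u` is differentiable at `x` with partial derivatives `g`. -/
def HasGrad (u : Pt → ℝ) (g : Fin 4 → ℝ) (x : Pt) : Prop :=
  DifferentiableAt ℝ u x ∧ ∀ a, pd a u x = g a

namespace HasGrad

variable {u v : Pt → ℝ} {g k : Fin 4 → ℝ} {x : Pt}

theorem pd_eq (h : HasGrad u g x) (a : Fin 4) : pd a u x = g a := h.2 a

theorem of_differentiableAt (h : DifferentiableAt ℝ u x) : HasGrad u (fun a => pd a u x) x :=
  ⟨h, fun _ => rfl⟩

theorem add (hu : HasGrad u g x) (hv : HasGrad v k x) :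
    HasGrad (fun z => u z + v z) (fun a => g a + k a) x :=
  ⟨hu.1.add hv.1, fun a => by
    dsimp only
    rw [← hu.2, ← hv.2, pd, fderiv_fun_add hu.1 hv.1]; rfl⟩

theorem sub (hu : HasGrad u g x) (hv : HasGrad v k x) :
    HasGrad (fun z => u z - v z) (fun a => g a - k a) x :=
  ⟨hu.1.sub hv.1, fun a => by
    dsimp only
    rw [← hu.2, ← hv.2, pd, fderiv_fun_sub hu.1 hv.1]; rfl⟩

theorem mul (hu : HasGrad u g x) (hv : HasGrad v k x) :
    HasGrad (fun z => u z * v z) (fun a => g a * v x + u x * k a) x :=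
  ⟨hu.1.mul hv.1, fun a => by
    dsimp only
    rw [← hu.2, ← hv.2, pd, fderiv_fun_mul hu.1 hv.1]
    simp only [add_apply, smul_apply, smul_eq_mul, pd]
    ring⟩

theorem const (c : ℝ) : HasGrad (fun _ => c) (fun _ => 0) x :=
  ⟨differentiableAt_const c, fun a => by simp [pd]⟩

theorem coord (b : Fin 4) : HasGrad (fun z => z b) (fun a => if a = b then 1 else 0) x :=
  ⟨differentiableAt_apply b x, fun a => by
    have : HasFDerivAt (fun z : Pt => z b) (ContinuousLinearMap.proj (R := ℝ) b) x :=
      hasFDerivAt_apply b x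
    rw [pd, this.fderiv]
    simp [Pi.single_apply, eq_comm]⟩

theorem comp {φ : ℝ → ℝ} {φ' : ℝ} (hφ : HasDerivAt φ φ' (u x)) (hu : HasGrad u g x) :
    HasGrad (fun z => φ (u z)) (fun a => φ' * g a) x := by
  have h := hφ.hasFDerivAt.comp x hu.1.hasFDerivAt
  refine ⟨h.differentiableAt, fun a => ?_⟩
  dsimp only
  rw [← hu.2, pd]
  have : fderiv ℝ (fun z => φ (u z)) x = _ := h.fderiv
  rw [this]
  simp [pd, mul_comm]

theorem sum {ι : Type*} {s : Finset ι} {u : ι → Pt → ℝ} {g : ι → Fin 4 → ℝ}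
    (h : ∀ i ∈ s, HasGrad (u i) (g i) x) :
    HasGrad (fun z => ∑ i ∈ s, u i z) (fun a => ∑ i ∈ s, g i a) x :=
  ⟨DifferentiableAt.fun_sum fun i hi => (h i hi).1, fun a => by
    rw [pd, fderiv_fun_sum fun i hi => (h i hi).1]
    simp only [sum_apply]
    exact Finset.sum_congr rfl fun i hi => (h i hi).2 a⟩

theorem congr_grad (h : HasGrad u g x) (hg : ∀ a, g a = k a) : HasGrad u k x :=
  ⟨h.1, fun a => (h.2 a).trans (hg a)⟩

theorem congr_of_eventuallyEq (h : HasGrad u g x) (he : v =ᶠ[𝓝 x] u) : HasGrad v g x :=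
  ⟨h.1.congr_of_eventuallyEq he, fun a => by rw [← h.2, pd, pd, he.fderiv_eq]⟩

end HasGrad

section Exterior

variable {M : ℝ} {x : Pt} {u v : Pt → ℝ}

theorem continuous_radius : Continuous radius := by
  unfold radius
  fun_prop

theorem isOpen_exterior : IsOpen (exterior M) := isOpen_lt continuous_const continuous_radius

theorem radius_pos (hM : 0 < M) (hx : x ∈ exterior M) : 0 < radius x :=
  lt_trans (by linarith) (show 2 * M < radius x from hx)

theorem radius_sq (x : Pt) : radius x ^ 2 = x 1 ^ 2 + x 2 ^ 2 + x 3 ^ 2 :=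
  Real.sq_sqrt (by positivity)

theorem lapse_pos (hM : 0 < M) {r : ℝ} (hr : 2 * M < r) : 0 < lapse M r := by
  have : 0 < r := by linarith
  rw [lapse, sub_pos, div_lt_one this]
  exact hr

theorem HasGrad.radius (hM : 0 < M) (hx : x ∈ exterior M) :
    HasGrad radius (dr x) x := by
  have h0 := (radius_pos hM hx)
  have hs : HasGrad (fun z : Pt => z 1 ^ 2 + z 2 ^ 2 + z 3 ^ 2) _ x :=
    ((HasGrad.comp (φ := fun s => s ^ 2) (hasDerivAt_pow 2 (x 1)) (HasGrad.coord 1)).add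
      (HasGrad.comp (φ := fun s => s ^ 2) (hasDerivAt_pow 2 (x 2)) (HasGrad.coord 2))).add
      (HasGrad.comp (φ := fun s => s ^ 2) (hasDerivAt_pow 2 (x 3)) (HasGrad.coord 3))
  have hne : x 1 ^ 2 + x 2 ^ 2 + x 3 ^ 2 ≠ 0 := by
    rw [← radius_sq]; positivity
  refine (HasGrad.comp (φ := Real.sqrt) (Real.hasDerivAt_sqrt hne) hs).congr_grad fun a => ?_
  have hr : Real.sqrt (x 1 ^ 2 + x 2 ^ 2 + x 3 ^ 2) = Schwarzschild.radius x := rfl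
  rw [hr]
  fin_cases a <;> simp [dr] <;> field_simp

namespace Smooth

theorem hasGrad (hu : Smooth M u) (hx : x ∈ exterior M) : HasGrad u (fun a => pd a u x) x :=
  HasGrad.of_differentiableAt
    (((hu x hx).contDiffAt (isOpen_exterior.mem_nhds hx)).differentiableAt (by simp))

theorem pd (hu : Smooth M u) (a : Fin 4) : Smooth M (pd a u) := by
  have h := hu.fderiv_of_isOpen isOpen_exterior (m := ∞) (by simp)
  exact h.clm_apply contDiffOn_const

theorem add (hu : Smooth M u) (hv : Smooth M v) : Smooth M (fun z => u z + v z) :=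
  ContDiffOn.add hu hv

theorem sub (hu : Smooth M u) (hv : Smooth M v) : Smooth M (fun z => u z - v z) :=
  ContDiffOn.sub hu hv

theorem neg (hu : Smooth M u) : Smooth M (fun z => -u z) := ContDiffOn.neg hu

theorem mul (hu : Smooth M u) (hv : Smooth M v) : Smooth M (fun z => u z * v z) :=
  ContDiffOn.mul hu hv

theorem const (c : ℝ) : Smooth M (fun _ => c) := contDiffOn_const

theorem coord (b : Fin 4) : Smooth M (fun z => z b) := (contDiff_apply ℝ ℝ b).contDiffOn

theorem sum {ι : Type*} {s : Finset ι} {u : ι → Pt → ℝ} (h : ∀ i ∈ s, Smooth M (u i)) :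
    Smooth M (fun z => ∑ i ∈ s, u i z) := ContDiffOn.sum h

theorem radius (hM : 0 < M) : Smooth M radius := by
  refine ContDiffOn.sqrt ?_ fun x hx => ?_
  · fun_prop
  · rw [← radius_sq]
    exact (pow_pos (radius_pos hM hx) 2).ne'

theorem inv (hu : Smooth M u) (h0 : ∀ x ∈ exterior M, u x ≠ 0) : Smooth M (fun z => (u z)⁻¹) :=
  ContDiffOn.inv hu h0

theorem div (hu : Smooth M u) (hv : Smooth M v) (h0 : ∀ x ∈ exterior M, v x ≠ 0) :
    Smooth M (fun z => u z / v z) := ContDiffOn.div hu hv h0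

theorem lapse (hM : 0 < M) : Smooth M (fun z => lapse M (Schwarzschild.radius z)) :=
  (const 1).sub ((const (2 * M)).div (radius hM) fun _ hx => (radius_pos hM hx).ne')

theorem congr (hu : Smooth M u) (h : ∀ x ∈ exterior M, v x = u x) : Smooth M v :=
  ContDiffOn.congr hu h

theorem continuousOn (hu : Smooth M u) : ContinuousOn u (exterior M) := ContDiffOn.continuousOn hu

end Smooth

theorem pd_congr (h : ∀ z ∈ exterior M, u z = v z) (hx : x ∈ exterior M) (a : Fin 4) :
    pd a u x = pd a v x := by
  have : u =ᶠ[𝓝 x] v := by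
    filter_upwards [isOpen_exterior.mem_nhds hx] with z hz using h z hz
  rw [pd, pd, this.fderiv_eq]

theorem pd_comm (hu : Smooth M u) (hx : x ∈ exterior M) (a b : Fin 4) :
    pd a (pd b u) x = pd b (pd a u) x := by
  have hc : ContDiffAt ℝ ∞ u x := (hu x hx).contDiffAt (isOpen_exterior.mem_nhds hx)
  have hsymm := (hc.of_le (m := 2) (by norm_cast)).isSymmSndFDerivAt (by simp)
  have hd : DifferentiableAt ℝ (fderiv ℝ u) x :=
    (hc.fderiv_right (m := ∞) (by simp)).differentiableAt (by simp)
  have key : ∀ a b : Fin 4,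
      pd a (pd b u) x = fderiv ℝ (fderiv ℝ u) x (Pi.single a 1) (Pi.single b 1) := by
    intro a b
    have := hd.hasFDerivAt.clm_apply (hasFDerivAt_const (Pi.single b (1 : ℝ) : Pt) x)
    have e : fderiv ℝ (pd b u) x = _ := this.fderiv
    rw [pd, e]
    simp
  rw [key, key]
  exact hsymm.eq _ _

/-! ### Radial derivative and rotation fields -/

/-- The derivative along `∂_r`. -/
def radialD (u : Pt → ℝ) (x : Pt) : ℝ := ∑ i : Fin 3, x i.succ / radius x * pd i.succ u x

/-- The rotation field `(y × ∂)_i`. -/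
def rot (i : Fin 3) (u : Pt → ℝ) (x : Pt) : ℝ :=
  x (i + 1).succ * pd (i + 2).succ u x - x (i + 2).succ * pd (i + 1).succ u x

theorem Smooth.radialD (hM : 0 < M) (hu : Smooth M u) : Smooth M (radialD u) :=
  Smooth.sum fun i _ => ((Smooth.coord i.succ).div (Smooth.radius hM)
    fun _ hx => (radius_pos hM hx).ne').mul (hu.pd _)

theorem Smooth.rot (hu : Smooth M u) (i : Fin 3) : Smooth M (rot i u) :=
  ((Smooth.coord _).mul (hu.pd _)).sub ((Smooth.coord _).mul (hu.pd _))

theorem radialD_congr (h : ∀ z ∈ exterior M, u z = v z) (hx : x ∈ exterior M) :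
    radialD u x = radialD v x := by
  simp only [radialD, pd_congr h hx]

theorem rot_congr (h : ∀ z ∈ exterior M, u z = v z) (hx : x ∈ exterior M) (i : Fin 3) :
    rot i u x = rot i v x := by
  simp only [rot, pd_congr h hx]

theorem pd_zero_rot (hu : Smooth M u) (hx : x ∈ exterior M) (i : Fin 3) :
    pd 0 (rot i u) x = rot i (pd 0 u) x := by
  have h := (((HasGrad.coord (x := x) (i + 1).succ).mul ((hu.pd (i + 2).succ).hasGrad hx)).sub
    ((HasGrad.coord (i + 2).succ).mul ((hu.pd (i + 1).succ).hasGrad hx))).pd_eq 0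
  have e : pd 0 (rot i u) x = _ := h
  rw [e, rot, pd_comm hu hx 0, pd_comm hu hx 0]
  have : ∀ j : Fin 3, (0 : Fin 4) ≠ j.succ := fun j => (Fin.succ_ne_zero j).symm
  simp [this]

theorem pd_zero_radialD (hM : 0 < M) (hu : Smooth M u) (hx : x ∈ exterior M) :
    pd 0 (radialD u) x = radialD (pd 0 u) x := by
  have h0 := (radius_pos hM hx).ne'
  have h := (HasGrad.sum (s := Finset.univ) fun (i : Fin 3) _ =>
    ((HasGrad.coord (x := x) i.succ).mul (HasGrad.comp (hasDerivAt_inv h0)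
      (HasGrad.radius hM hx))).mul ((hu.pd i.succ).hasGrad hx)).pd_eq 0
  have e : pd 0 (radialD u) x = _ := h
  rw [e, radialD]
  refine Finset.sum_congr rfl fun i _ => ?_
  have : ∀ j : Fin 3, (0 : Fin 4) ≠ j.succ := fun j => (Fin.succ_ne_zero j).symm
  rw [pd_comm hu hx 0]
  simp [this, dr, div_eq_mul_inv]

/-- Rotations preserve the radius and commute with dilations, hence their generators commute with
∂_r. -/
theorem radialD_rot (hM : 0 < M) (hu : Smooth M u) (hx : x ∈ exterior M) (i : Fin 3) :
    radialD (rot i u) x = rot i (radialD u) x := by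
  have h0 := (radius_pos hM hx).ne'
  have h1 : ∀ a, pd a (rot i u) x = _ := fun a =>
    (((HasGrad.coord (x := x) (i + 1).succ).mul ((hu.pd (i + 2).succ).hasGrad hx)).sub
    ((HasGrad.coord (i + 2).succ).mul ((hu.pd (i + 1).succ).hasGrad hx))).pd_eq a
  have h2 : ∀ a, pd a (radialD u) x = _ := fun a =>
    (HasGrad.sum (s := Finset.univ) fun (i : Fin 3) _ =>
    ((HasGrad.coord (x := x) i.succ).mul (HasGrad.comp (hasDerivAt_inv h0)
      (HasGrad.radius hM hx))).mul ((hu.pd i.succ).hasGrad hx)).pd_eq a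
  rw [rot, h2, h2, radialD]
  simp only [h1]
  simp only [Fin.sum_univ_three, dr]
  have c12 := pd_comm hu hx 1 2
  have c13 := pd_comm hu hx 1 3
  have c23 := pd_comm hu hx 2 3
  fin_cases i <;> simp [c12, c13, c23] <;> field_simp <;> ring

/-- The commutation relations of the rotation algebra. In `rotDiv_minors` they reduce the
antisymmetrised second derivatives to first order terms. -/
theorem rot_comm (hu : Smooth M u) (hx : x ∈ exterior M) (i : Fin 3) :
    rot i (rot (i + 1) u) x - rot (i + 1) (rot i u) x = -rot (i + 2) u x := by
  have h1 : ∀ j a, pd a (rot j u) x = _ := fun j a =>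
    (((HasGrad.coord (x := x) (j + 1).succ).mul ((hu.pd (j + 2).succ).hasGrad hx)).sub
    ((HasGrad.coord (j + 2).succ).mul ((hu.pd (j + 1).succ).hasGrad hx))).pd_eq a
  have c12 := pd_comm hu hx 1 2
  have c13 := pd_comm hu hx 1 3
  have c23 := pd_comm hu hx 2 3
  rw [rot, rot, h1, h1, h1, h1, rot]
  fin_cases i <;> simp [c12, c13, c23] <;> ring

end Exterior

/-! ### Averages over spheres -/

/-- The point with time coordinate `t`, radius `r` and direction `θ`. -/
def polarPoint (t r : ℝ) (θ : Fin 3 → ℝ) : Pt := Matrix.vecCons t (r • θ)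

@[simp] theorem polarPoint_zero (t r : ℝ) (θ : Fin 3 → ℝ) : polarPoint t r θ 0 = t := rfl

@[simp] theorem polarPoint_succ (t r : ℝ) (θ : Fin 3 → ℝ) (i : Fin 3) :
    polarPoint t r θ i.succ = r * θ i := rfl

theorem radius_polarPoint {t r : ℝ} {θ : Fin 3 → ℝ} (hr : 0 ≤ r) (hθ : θ ∈ unitSphere) :
    radius (polarPoint t r θ) = r := by
  have h : θ 0 ^ 2 + θ 1 ^ 2 + θ 2 ^ 2 = 1 := hθ
  have : (r * θ 0) ^ 2 + (r * θ 1) ^ 2 + (r * θ 2) ^ 2 = r ^ 2 := by linear_combination r ^ 2 * h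
  rw [radius]
  change Real.sqrt ((r * θ 0) ^ 2 + (r * θ 1) ^ 2 + (r * θ 2) ^ 2) = r
  rw [this, Real.sqrt_sq hr]

/-- The integral of `u` over the unit sphere of directions at `(t, r)`. -/
def sphereAvg (u : Pt → ℝ) (t r : ℝ) : ℝ := ∫ θ in unitSphere, u (polarPoint t r θ) ∂sphereMeasure

section Average

variable {M : ℝ} {u v : Pt → ℝ} {t r : ℝ}

theorem polarPoint_mem (hM : 0 < M) (hr : 2 * M < r) {θ : Fin 3 → ℝ} (hθ : θ ∈ unitSphere) :
    polarPoint t r θ ∈ exterior M := by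
  show 2 * M < radius _
  rwa [radius_polarPoint (by linarith) hθ]

theorem continuous_polarPoint :
    Continuous fun z : (ℝ × ℝ) × (Fin 3 → ℝ) => polarPoint z.1.1 z.1.2 z.2 := by
  refine continuous_pi fun a => ?_
  refine Fin.cases ?_ (fun i => ?_) a
  · simp only [polarPoint_zero]; fun_prop
  · simp only [polarPoint_succ]; fun_prop

theorem continuousOn_comp_polarPoint (hM : 0 < M) (hu : ContinuousOn u (exterior M)) :
    ContinuousOn (fun z : (ℝ × ℝ) × (Fin 3 → ℝ) => u (polarPoint z.1.1 z.1.2 z.2))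
      (halfPlane (2 * M) ×ˢ unitSphere) :=
  hu.comp continuous_polarPoint.continuousOn fun _ hz => polarPoint_mem hM hz.1.2 hz.2

theorem continuousOn_sphere (hM : 0 < M) (hu : ContinuousOn u (exterior M)) (hr : 2 * M < r) :
    ContinuousOn (fun θ => u (polarPoint t r θ)) unitSphere :=
  (continuousOn_comp_polarPoint hM hu).comp (f := fun θ => ((t, r), θ)) (by fun_prop)
    fun _ hθ => ⟨⟨trivial, hr⟩, hθ⟩

theorem integrableOn_sphere (hM : 0 < M) (hu : ContinuousOn u (exterior M)) (hr : 2 * M < r) :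
    IntegrableOn (fun θ => u (polarPoint t r θ)) unitSphere sphereMeasure :=
  (continuousOn_sphere hM hu hr).integrableOn_compact isCompact_unitSphere

theorem continuousOn_sphereAvg (hM : 0 < M) (hu : ContinuousOn u (exterior M)) :
    ContinuousOn (fun z : ℝ × ℝ => sphereAvg u z.1 z.2) (halfPlane (2 * M)) := by
  have : LocallyCompactSpace (halfPlane (2 * M)) :=
    (isOpen_halfPlane (2 * M)).locallyCompactSpace
  exact continuousOn_setIntegral_of_isCompact
    (f := fun (z : ℝ × ℝ) θ => u (polarPoint z.1 z.2 θ)) isCompact_unitSphere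
    (continuousOn_comp_polarPoint hM hu)

theorem Smooth.hasDerivAt_comp {x : Pt} (hu : Smooth M u) (hx : x ∈ exterior M) {c : ℝ → Pt}
    {c' : Pt} {s : ℝ} (hs : c s = x) (hc : HasDerivAt c c' s) :
    HasDerivAt (fun s => u (c s)) (∑ a, c' a * Schwarzschild.pd a u x) s := by
  subst hs
  have h := (hu.hasGrad hx).1.hasFDerivAt.comp_hasDerivAt s hc
  refine h.congr_deriv ?_
  conv_lhs => rw [show c' = ∑ a, c' a • (Pi.single a 1 : Pt) from by
    ext b; simp [Finset.sum_apply, Pi.single_apply]]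
  simp [Schwarzschild.pd]

theorem hasDerivAt_sphereAvg_time (hM : 0 < M) (hu : Smooth M u) (hr : 2 * M < r) :
    HasDerivAt (fun s => sphereAvg u s r) (sphereAvg (pd 0 u) t r) t := by
  refine hasDerivAt_setIntegral_of_isCompact (f := fun s θ => u (polarPoint s r θ))
    (f' := fun s θ => pd 0 u (polarPoint s r θ)) isCompact_unitSphere isOpen_univ ?_ ?_ ?_
    (mem_univ t)
  · exact fun s _ => continuousOn_sphere hM hu.continuousOn hr
  · exact (continuousOn_comp_polarPoint hM (hu.pd 0).continuousOn).comp
      (f := fun z : ℝ × (Fin 3 → ℝ) => ((z.1, r), z.2)) (by fun_prop)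
      fun z hz => ⟨⟨trivial, hr⟩, hz.2⟩
  · intro s _ θ hθ
    have hc : HasDerivAt (fun s => polarPoint s r θ) (Pi.single 0 1) s := by
      rw [hasDerivAt_pi]
      refine fun a => Fin.cases ?_ (fun i => ?_) a
      · simpa using hasDerivAt_id' s
      · simpa using hasDerivAt_const s (r * θ i)
    refine (hu.hasDerivAt_comp (polarPoint_mem hM hr hθ) rfl hc).congr_deriv ?_
    simp [Pi.single_apply]

theorem hasDerivAt_sphereAvg_radius (hM : 0 < M) (hu : Smooth M u) (hr : 2 * M < r) :
    HasDerivAt (sphereAvg u t) (sphereAvg (radialD u) t r) r := by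
  refine hasDerivAt_setIntegral_of_isCompact (f := fun s θ => u (polarPoint t s θ))
    (f' := fun s θ => radialD u (polarPoint t s θ)) isCompact_unitSphere (isOpen_Ioi (a := 2 * M))
    ?_ ?_ ?_ hr
  · exact fun s hs => continuousOn_sphere hM hu.continuousOn hs
  · exact (continuousOn_comp_polarPoint hM (hu.radialD hM).continuousOn).comp
      (f := fun z : ℝ × (Fin 3 → ℝ) => ((t, z.1), z.2)) (by fun_prop)
      fun z hz => ⟨⟨trivial, hz.1⟩, hz.2⟩
  · intro s hs θ hθ
    have hs' : 2 * M < s := hs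
    have hc : HasDerivAt (fun s => polarPoint t s θ) (Matrix.vecCons 0 θ) s := by
      rw [hasDerivAt_pi]
      refine fun a => Fin.cases ?_ (fun i => ?_) a
      · simpa using hasDerivAt_const s t
      · simpa using (hasDerivAt_id s).mul_const (θ i)
    refine (hu.hasDerivAt_comp (polarPoint_mem hM hs hθ) rfl hc).congr_deriv ?_
    have h0 : s ≠ 0 := by linarith
    rw [radialD, Fin.sum_univ_succ, radius_polarPoint (by linarith) hθ]
    simp [h0]

/-- Rotation invariance of the area makes the integral of the rotated function independent of the
angle, and the integral of `rot i u` is its derivative at angle 0. This is the integration by parts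
on the spheres. -/
theorem sphereAvg_rot (hM : 0 < M) (hu : Smooth M u) (hr : 2 * M < r) (i : Fin 3) :
    sphereAvg (rot i u) t r = 0 := by
  have key : HasDerivAt
      (fun s => ∫ θ in unitSphere, u (polarPoint t r (rotation i s θ)) ∂sphereMeasure)
      (∫ θ in unitSphere, rot i u (polarPoint t r (rotation i 0 θ)) ∂sphereMeasure) 0 := by
    have hrc : Continuous fun z : ℝ × (Fin 3 → ℝ) => rotation i z.1 z.2 := by
      refine continuous_pi fun m => ?_
      unfold rotation
      split_ifs <;> fun_prop
    refine hasDerivAt_setIntegral_of_isCompact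
      (f := fun s θ => u (polarPoint t r (rotation i s θ)))
      (f' := fun s θ => rot i u (polarPoint t r (rotation i s θ)))
      isCompact_unitSphere isOpen_univ ?_ ?_ ?_ (mem_univ 0)
    · exact fun s _ => (continuousOn_sphere hM hu.continuousOn hr).comp
        (continuous_rotation i s).continuousOn fun θ hθ => rotation_mem_unitSphere i s hθ
    · exact (continuousOn_comp_polarPoint hM (hu.rot i).continuousOn).comp
        (f := fun z : ℝ × (Fin 3 → ℝ) => ((t, r), rotation i z.1 z.2)) (by fun_prop)
        fun z hz => ⟨⟨trivial, hr⟩, rotation_mem_unitSphere i _ hz.2⟩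
    · intro s _ θ hθ
      have hd := hasDerivAt_rotation i s θ
      have hc : HasDerivAt (fun s => polarPoint t r (rotation i s θ)) (Matrix.vecCons 0
          (r • fun m => if m = i then 0 else if m = i + 1 then -rotation i s θ (i + 2)
            else rotation i s θ (i + 1))) s := by
        rw [hasDerivAt_pi] at hd ⊢
        refine fun a => Fin.cases ?_ (fun m => ?_) a
        · simpa using hasDerivAt_const s t
        · simpa using (hd m).const_mul r
      refine (hu.hasDerivAt_comp
        (polarPoint_mem hM hr (rotation_mem_unitSphere i s hθ)) rfl hc).congr_deriv ?_
      rw [rot, Fin.sum_univ_succ, polarPoint_succ, polarPoint_succ]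
      fin_cases i <;> simp [Fin.sum_univ_three] <;> ring
  have hconst : (fun s => ∫ θ in unitSphere, u (polarPoint t r (rotation i s θ)) ∂sphereMeasure)
      = fun _ => ∫ θ in unitSphere, u (polarPoint t r θ) ∂sphereMeasure := by
    ext s
    exact integral_comp_rotation i s (u := fun θ => u (polarPoint t r θ))
      (continuousOn_sphere hM hu.continuousOn hr)
  rw [hconst] at key
  have h0 := key.unique (hasDerivAt_const _ _)
  rw [← h0, sphereAvg]
  exact (integral_comp_rotation i 0 (u := fun θ => rot i u (polarPoint t r θ))
    (continuousOn_sphere hM (hu.rot i).continuousOn hr)).symm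

theorem sphereAvg_congr (hM : 0 < M) (hr : 2 * M < r) (h : ∀ x ∈ exterior M, u x = v x) :
    sphereAvg u t r = sphereAvg v t r :=
  setIntegral_congr_fun isCompact_unitSphere.measurableSet
    fun _ hθ => h _ (polarPoint_mem hM hr hθ)

theorem sphereAvg_add (hM : 0 < M) (hr : 2 * M < r) (hu : Smooth M u) (hv : Smooth M v) :
    sphereAvg (fun x => u x + v x) t r = sphereAvg u t r + sphereAvg v t r :=
  integral_add (integrableOn_sphere hM hu.continuousOn hr)
    (integrableOn_sphere hM hv.continuousOn hr)

theorem sphereAvg_sum {ι : Type*} {s : Finset ι} {u : ι → Pt → ℝ} (hM : 0 < M) (hr : 2 * M < r)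
    (hu : ∀ i ∈ s, Smooth M (u i)) :
    sphereAvg (fun x => ∑ i ∈ s, u i x) t r = ∑ i ∈ s, sphereAvg (u i) t r :=
  integral_finsetSum s fun i hi => integrableOn_sphere hM (hu i hi).continuousOn hr

theorem sphereAvg_const_mul (c : ℝ) (u : Pt → ℝ) :
    sphereAvg (fun x => c * u x) t r = c * sphereAvg u t r :=
  integral_const_mul c _

theorem sphereAvg_mono (hM : 0 < M) (hr : 2 * M < r) (hu : Smooth M u) (hv : Smooth M v)
    (h : ∀ x ∈ exterior M, u x ≤ v x) : sphereAvg u t r ≤ sphereAvg v t r :=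
  setIntegral_mono_on (integrableOn_sphere hM hu.continuousOn hr)
    (integrableOn_sphere hM hv.continuousOn hr) isCompact_unitSphere.measurableSet
    fun _ hθ => h _ (polarPoint_mem hM hr hθ)

theorem sphereAvg_nonneg (hM : 0 < M) (hr : 2 * M < r) (h : ∀ x ∈ exterior M, 0 ≤ u x) :
    0 ≤ sphereAvg u t r :=
  setIntegral_nonneg isCompact_unitSphere.measurableSet fun _ hθ => h _ (polarPoint_mem hM hr hθ)

theorem lintegral_sphere_eq_ofReal (hM : 0 < M) (hr : 2 * M < r)
    (hu : ContinuousOn u (exterior M)) (h : ∀ θ ∈ unitSphere, 0 ≤ u (polarPoint t r θ)) :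
    ∫⁻ θ in unitSphere, ENNReal.ofReal (u (polarPoint t r θ)) ∂sphereMeasure
      = ENNReal.ofReal (sphereAvg u t r) := by
  rw [sphereAvg, ofReal_integral_eq_lintegral_ofReal (integrableOn_sphere hM hu hr)]
  filter_upwards [ae_restrict_mem isCompact_unitSphere.measurableSet] with θ hθ
  exact h θ hθ

end Average

/-! ### Algebra of the Schwarzschild metric -/

section Metric

variable {M : ℝ} {x : Pt}

@[simp] theorem dr_zero (x : Pt) : dr x 0 = 0 := rfl

@[simp] theorem dr_one (x : Pt) : dr x 1 = x 1 / radius x := rfl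

@[simp] theorem dr_two (x : Pt) : dr x 2 = x 2 / radius x := rfl

@[simp] theorem dr_three (x : Pt) : dr x 3 = x 3 / radius x := rfl

theorem dr_sq_sum (hM : 0 < M) (hx : x ∈ exterior M) :
    dr x 1 ^ 2 + dr x 2 ^ 2 + dr x 3 ^ 2 = 1 := by
  have h0 := (radius_pos hM hx).ne'
  simp only [dr_one, dr_two, dr_three]
  field_simp
  linarith [radius_sq x]

/-- The inverse metric. -/
def metricInv (M : ℝ) : Tensor2 := fun x => Matrix.of fun a b =>
  (lapse M (radius x))⁻¹ * dt a * dt b - (if a = b ∧ a ≠ 0 then 1 else 0)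
    + (1 - lapse M (radius x)) * dr x a * dr x b

theorem metric_mul_metricInv (hM : 0 < M) (hx : x ∈ exterior M) :
    metric M x * metricInv M x = 1 := by
  have hφ := (lapse_pos hM hx).ne'
  have hn := dr_sq_sum hM hx
  have hi := mul_inv_cancel₀ hφ
  -- With the lapse, its inverse and the conormal replaced by variables, the entries become
  -- polynomial identities modulo p q = 1 and |m| = 1. The same device recurs in the tensor
  -- computations below.
  generalize hp : lapse M (radius x) = p at *
  generalize hq : p⁻¹ = q at *
  have h0 := dr_zero x
  generalize hm : dr x = m at *
  ext a b
  have : (metric M x * metricInv M x) a b = ∑ c, (p * dt a * dt c - q * m a * m c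
      - ((if a = c ∧ a ≠ 0 then 1 else 0) - m a * m c)) * (q * dt c * dt b
      - (if c = b ∧ c ≠ 0 then 1 else 0) + (1 - p) * m c * m b) := by
    simp only [Matrix.mul_apply, metric, metricInv, Matrix.of_apply, hp, hq, hm]
  rw [this]
  have h3 : m 3 ^ 2 = 1 - m 1 ^ 2 - m 2 ^ 2 := by linarith
  fin_cases a <;> fin_cases b <;>
    simp [Fin.sum_univ_four, dt, h0] <;> grind

theorem metric_inv (hM : 0 < M) (hx : x ∈ exterior M) : (metric M x)⁻¹ = metricInv M x :=
  Matrix.inv_eq_right_inv (metric_mul_metricInv hM hx)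

/-- The `t`, `r` block contributes p · (-p⁻¹) and the angular block (-1)². The chart is thus
unimodular: neither the Hodge dual nor the spacetime volume carries a density. -/
theorem det_metric (hM : 0 < M) (hx : x ∈ exterior M) : (metric M x).det = -1 := by
  have hφ := (lapse_pos hM hx).ne'
  have hn := dr_sq_sum hM hx
  have hi := mul_inv_cancel₀ hφ
  generalize hp : lapse M (radius x) = p at *
  generalize hq : p⁻¹ = q at *
  have h0 := dr_zero x
  generalize hm : dr x = m at *
  have h : metric M x = Matrix.of fun a b => p * dt a * dt b - q * m a * m b
      - ((if a = b ∧ a ≠ 0 then 1 else 0) - m a * m b) := by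
    simp only [metric, hp, hq, hm]
  rw [h]
  simp [Matrix.det_succ_row_zero, Fin.sum_univ_succ, dt, h0, Fin.succAbove]
  grind

theorem volDensity_metric (hM : 0 < M) (hx : x ∈ exterior M) : volDensity (metric M) x = 1 := by
  rw [volDensity, det_metric hM hx]
  simp

end Metric

/-! ### The Hodge dual -/

theorem leviCivita_expand (a b c d : Fin 4) {A B C D : Fin 4 → ℝ}
    (hA : ∀ j, (if a = j then (1 : ℝ) else 0) = A j)
    (hB : ∀ j, (if b = j then (1 : ℝ) else 0) = B j)
    (hC : ∀ j, (if c = j then (1 : ℝ) else 0) = C j)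
    (hD : ∀ j, (if d = j then (1 : ℝ) else 0) = D j) :
    leviCivita a b c d =
      (A 0 * B 1 - A 1 * B 0) * (C 2 * D 3 - C 3 * D 2)
      - (A 0 * B 2 - A 2 * B 0) * (C 1 * D 3 - C 3 * D 1)
      + (A 0 * B 3 - A 3 * B 0) * (C 1 * D 2 - C 2 * D 1)
      + (A 1 * B 2 - A 2 * B 1) * (C 0 * D 3 - C 3 * D 0)
      - (A 1 * B 3 - A 3 * B 1) * (C 0 * D 2 - C 2 * D 0)
      + (A 2 * B 3 - A 3 * B 2) * (C 0 * D 1 - C 1 * D 0) := by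
  have : (Matrix.of fun i j : Fin 4 => if ![a, b, c, d] i = j then (1 : ℝ) else 0) =
      Matrix.of ![A, B, C, D] := by
    ext i j
    fin_cases i
    exacts [hA j, hB j, hC j, hD j]
  rw [leviCivita, this]
  simp [Matrix.det_succ_row_zero, Fin.sum_univ_succ, Fin.succAbove]
  ring

/-- The antisymmetric matrix with electric part `E` and magnetic part `B`. -/
def ofEB (E B : Fin 3 → ℝ) : Matrix (Fin 4) (Fin 4) ℝ :=
  !![0, E 0, E 1, E 2; -E 0, 0, B 2, -B 1; -E 1, -B 2, 0, B 0; -E 2, B 1, -B 0, 0]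

theorem ofEB_antisymm (E B : Fin 3 → ℝ) (a b : Fin 4) : ofEB E B a b = -ofEB E B b a := by
  fin_cases a <;> fin_cases b <;> simp [ofEB]

theorem sum_leviCivita_ofEB (E B : Fin 3 → ℝ) (a b : Fin 4) :
    (1 / 2) * ∑ c, ∑ d, leviCivita a b c d * ofEB E B c d = ofEB B E a b := by
  have h := fun c d => leviCivita_expand a b c d (fun _ => rfl) (fun _ => rfl) (fun _ => rfl)
    (fun _ => rfl)
  simp only [h]
  fin_cases a <;> fin_cases b <;> simp [Fin.sum_univ_four, ofEB] <;> ring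

section Hodge

variable {M : ℝ} {x : Pt}

/-- The unit normal of the spheres, as a vector of `ℝ³`. -/
def unitNormal (x : Pt) (i : Fin 3) : ℝ := dr x i.succ

theorem unitNormal_sq_sum (hM : 0 < M) (hx : x ∈ exterior M) :
    unitNormal x 0 ^ 2 + unitNormal x 1 ^ 2 + unitNormal x 2 ^ 2 = 1 := dr_sq_sum hM hx

theorem dr_succ (x : Pt) (i : Fin 3) : dr x i.succ = unitNormal x i := rfl

/-- Euclidean inner product of vectors of `ℝ³`. -/
def dot3 (v w : Fin 3 → ℝ) : ℝ := v 0 * w 0 + v 1 * w 1 + v 2 * w 2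

theorem metricInv_zero_zero (M : ℝ) (x : Pt) : metricInv M x 0 0 = (lapse M (radius x))⁻¹ := by
  simp [metricInv, dt, dr]

theorem metricInv_zero_succ (M : ℝ) (x : Pt) (i : Fin 3) : metricInv M x 0 i.succ = 0 := by
  simp [metricInv, dt, dr, (Fin.succ_ne_zero i).symm]

theorem metricInv_succ_zero (M : ℝ) (x : Pt) (i : Fin 3) : metricInv M x i.succ 0 = 0 := by
  simp [metricInv, dt, dr]

theorem metricInv_succ_succ (M : ℝ) (x : Pt) (i j : Fin 3) : metricInv M x i.succ j.succ =
    -(if i = j then 1 else 0) + (1 - lapse M (radius x)) * unitNormal x i * unitNormal x j := by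
  simp [metricInv, dt, unitNormal]

/-- Index raising of an antisymmetric tensor. -/
theorem raise_ofEB (hM : 0 < M) (hx : x ∈ exterior M) (E B : Fin 3 → ℝ) (c d : Fin 4) :
    ∑ e, ∑ f, metricInv M x c e * metricInv M x d f * ofEB E B e f =
      ofEB (fun i => -((lapse M (radius x))⁻¹
          * (E i - (1 - lapse M (radius x)) * dot3 (unitNormal x) E * unitNormal x i)))
        (fun i => lapse M (radius x) * B i
          + (1 - lapse M (radius x)) * dot3 (unitNormal x) B * unitNormal x i) c d := by
  have hn := unitNormal_sq_sum hM hx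
  have hi := mul_inv_cancel₀ (lapse_pos hM hx).ne'
  have e00 := metricInv_zero_zero M x
  have e0s := metricInv_zero_succ M x
  have es0 := metricInv_succ_zero M x
  have ess := metricInv_succ_succ M x
  generalize lapse M (radius x) = p at *
  generalize p⁻¹ = q at *
  generalize unitNormal x = m at *
  generalize metricInv M x = g at *
  simp only [Fin.sum_univ_succ (n := 3), Fin.sum_univ_three]
  refine Fin.cases ?_ (fun i => ?_) c <;> refine Fin.cases ?_ (fun j => ?_) d
  · simp only [e0s]
    simp [ofEB]
  · simp only [e00, e0s, es0, ess, zero_mul, add_zero, dot3]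
    fin_cases j <;> simp [ofEB] <;> ring
  · simp only [e00, e0s, es0, ess, zero_mul, zero_add, dot3]
    fin_cases i <;> simp [ofEB] <;> ring
  · simp only [es0, ess, zero_mul, zero_add, mul_zero, dot3]
    fin_cases i <;> fin_cases j <;> simp [ofEB] <;> grind

/-- After the indices are raised, the flat dual `sum_leviCivita_ofEB` only exchanges the two
vectors. -/
theorem hodge_ofEB (hM : 0 < M) (hx : x ∈ exterior M) {T : Tensor2} {E B : Fin 3 → ℝ}
    (hT : T x = ofEB E B) :
    hodge (metric M) T x = ofEB
      (fun i => lapse M (radius x) * B i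
        + (1 - lapse M (radius x)) * dot3 (unitNormal x) B * unitNormal x i)
      (fun i => -((lapse M (radius x))⁻¹
        * (E i - (1 - lapse M (radius x)) * dot3 (unitNormal x) E * unitNormal x i))) := by
  ext a b
  rw [← sum_leviCivita_ofEB]
  simp only [hodge, Matrix.of_apply, volDensity_metric hM hx, metric_inv hM hx, hT,
    ← raise_ofEB hM hx, Finset.mul_sum]
  refine Finset.sum_congr rfl fun c _ => Finset.sum_congr rfl fun d _ =>
    Finset.sum_congr rfl fun e _ => Finset.sum_congr rfl fun f _ => ?_
  ring

/-- The spatial position vector. -/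
def position (x : Pt) (i : Fin 3) : ℝ := x i.succ

theorem killingYano_eq (x : Pt) : killingYano x = ofEB 0 (fun i => -position x i) := by
  ext a b
  have h := fun c => leviCivita_expand 0 a b c (fun _ => rfl) (fun _ => rfl) (fun _ => rfl)
    (fun _ => rfl)
  simp only [killingYano, Matrix.of_apply, h]
  fin_cases a <;> fin_cases b <;> simp [ofEB, position]

end Hodge

/-! ### Derivatives and Christoffel symbols of the metric -/

section Connection

variable {M : ℝ} {x : Pt}

theorem one_sub_lapse (M r : ℝ) : 1 - lapse M r = 2 * M / r := by
  rw [lapse]; ring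

theorem hasDerivAt_lapse {r : ℝ} (hr : r ≠ 0) : HasDerivAt (lapse M) (2 * M / r ^ 2) r := by
  have h := ((hasDerivAt_inv hr).const_mul (2 * M)).const_sub 1
  refine h.congr_deriv ?_
  field_simp

theorem hasGrad_dr (hM : 0 < M) (hx : x ∈ exterior M) (b : Fin 4) :
    HasGrad (fun z => dr z b)
      (fun c => ((if b = c ∧ b ≠ 0 then 1 else 0) - dr x b * dr x c) / radius x) x := by
  have h0 := (radius_pos hM hx).ne'
  refine Fin.cases ?_ (fun i => ?_) b
  · simpa using HasGrad.const (x := x) 0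
  · refine ((HasGrad.coord i.succ).mul (HasGrad.comp (hasDerivAt_inv h0)
      (HasGrad.radius hM hx))).congr_grad fun c => ?_
    have : dr x i.succ = x i.succ / radius x := by simp [dr]
    rw [this]
    by_cases hc : c = i.succ
    · subst hc; simp [this]; field_simp; ring
    · simp [hc, Ne.symm hc]; field_simp

/-- Partial derivatives of the metric. -/
theorem hasGrad_metric (hM : 0 < M) (hx : x ∈ exterior M) (a b : Fin 4) :
    HasGrad (fun z => metric M z a b)
      (fun c => 2 * M / radius x ^ 2 * (dr x c * dt a * dt b
        + ((lapse M (radius x))⁻¹) ^ 2 * dr x c * dr x a * dr x b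
        - (lapse M (radius x))⁻¹ * (((if a = c ∧ a ≠ 0 then 1 else 0) - dr x a * dr x c) * dr x b
          + dr x a * ((if b = c ∧ b ≠ 0 then 1 else 0) - dr x b * dr x c)))) x := by
  have h0 := (radius_pos hM hx).ne'
  have hl := (lapse_pos hM hx).ne'
  have hL := HasGrad.comp (hasDerivAt_lapse (M := M) h0) (HasGrad.radius hM hx)
  have hI := HasGrad.comp (hasDerivAt_inv hl) hL
  have ha := hasGrad_dr hM hx a
  have hb := hasGrad_dr hM hx b
  have h := (((hL.mul (HasGrad.const (dt a))).mul (HasGrad.const (dt b))).sub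
    ((hI.mul ha).mul hb)).sub ((HasGrad.const (if a = b ∧ a ≠ 0 then 1 else 0)).sub (ha.mul hb))
  refine h.congr_grad fun c => ?_
  have e1 : (lapse M (radius x))⁻¹ - 1 = (lapse M (radius x))⁻¹ * (2 * M / radius x) := by
    rw [← one_sub_lapse]; field_simp
  have hd : (lapse M (radius x) ^ 2)⁻¹ = ((lapse M (radius x))⁻¹) ^ 2 := (inv_pow _ _).symm
  simp only [hd]
  generalize (lapse M (radius x))⁻¹ = q at *
  generalize (if a = c ∧ a ≠ 0 then (1 : ℝ) else 0) = A
  generalize (if b = c ∧ b ≠ 0 then (1 : ℝ) else 0) = B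
  linear_combination (-(1 / radius x) * ((A - dr x a * dr x c) * dr x b
    + dr x a * (B - dr x b * dr x c))) * e1

/-- The Christoffel symbols of the Schwarzschild metric. -/
theorem christoffel_eq (hM : 0 < M) (hx : x ∈ exterior M) (a b c : Fin 4) :
    christoffel (metric M) x a b c = 2 * M / radius x ^ 2 *
      ((lapse M (radius x))⁻¹ / 2 * dt a * (dt b * dr x c + dr x b * dt c)
        + dr x a * (lapse M (radius x) / 2 * dt b * dt c
          - (lapse M (radius x))⁻¹ / 2 * dr x b * dr x c
          + (if b = c ∧ b ≠ 0 then 1 else 0) - dr x b * dr x c)) := by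
  simp only [christoffel, metric_inv hM hx, (hasGrad_metric hM hx _ _).pd_eq]
  have hn := dr_sq_sum hM hx
  have hi := mul_inv_cancel₀ (lapse_pos hM hx).ne'
  have h0 := dr_zero x
  simp only [metricInv, Matrix.of_apply]
  generalize lapse M (radius x) = p at *
  generalize p⁻¹ = q at *
  generalize dr x = m at *
  generalize 2 * M / radius x ^ 2 = k at *
  have h3 : m 3 ^ 2 = 1 - m 1 ^ 2 - m 2 ^ 2 := by linarith
  fin_cases a <;> fin_cases b <;> fin_cases c <;>
    simp [Fin.sum_univ_four, dt, h0] <;> grind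

end Connection

/-! ### Divergence of an antisymmetric tensor through its electric and magnetic vectors -/

section Divergence

variable {M : ℝ} {x : Pt}

theorem unitNormal_apply (x : Pt) (i : Fin 3) : unitNormal x i = x i.succ / radius x := by
  simp [unitNormal, dr]

theorem radialD_eq (u : Pt → ℝ) (x : Pt) :
    radialD u x = unitNormal x 0 * pd 1 u x + unitNormal x 1 * pd 2 u x
      + unitNormal x 2 * pd 3 u x := by
  simp [radialD, Fin.sum_univ_three, unitNormal_apply]

/-- The Euclidean divergence of a vector field on `ℝ³`. -/
def div3 (E : Fin 3 → Pt → ℝ) (x : Pt) : ℝ := pd 1 (E 0) x + pd 2 (E 1) x + pd 3 (E 2) x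

/-- The Euclidean curl of a vector field on `ℝ³`. -/
def curl3 (B : Fin 3 → Pt → ℝ) (x : Pt) : Fin 3 → ℝ :=
  ![pd 2 (B 2) x - pd 3 (B 1) x, pd 3 (B 0) x - pd 1 (B 2) x, pd 1 (B 1) x - pd 2 (B 0) x]

theorem sum_metricInv_christoffel (hM : 0 < M) (hx : x ∈ exterior M) (a b d : Fin 4) :
    ∑ c, metricInv M x b c * christoffel (metric M) x d c a = 2 * M / radius x ^ 2 *
      (((lapse M (radius x))⁻¹ ^ 2 / 2) * dt d * dt b * dr x a - 1 / 2 * dt d * dr x b * dt a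
        + 1 / 2 * dr x d * dt b * dt a + 3 / 2 * dr x d * dr x b * dr x a
        - dr x d * (if b = a ∧ b ≠ 0 then 1 else 0)) := by
  simp only [christoffel_eq hM hx]
  have hn := dr_sq_sum hM hx
  have hi := mul_inv_cancel₀ (lapse_pos hM hx).ne'
  have h0 := dr_zero x
  simp only [metricInv, Matrix.of_apply]
  generalize lapse M (radius x) = p at *
  generalize p⁻¹ = q at *
  generalize dr x = m at *
  generalize 2 * M / radius x ^ 2 = k at *
  have h3 : m 3 ^ 2 = 1 - m 1 ^ 2 - m 2 ^ 2 := by linarith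
  fin_cases a <;> fin_cases b <;> fin_cases d <;>
    simp [Fin.sum_univ_four, dt, h0] <;> grind

theorem sum_sum_metricInv_christoffel (hM : 0 < M) (hx : x ∈ exterior M) (d : Fin 4) :
    ∑ b, ∑ c, metricInv M x b c * christoffel (metric M) x d c b
      = -(2 * M / radius x ^ 2 * dr x d) := by
  simp only [sum_metricInv_christoffel hM hx]
  have hn := dr_sq_sum hM hx
  have h0 := dr_zero x
  generalize dr x = m at *
  simp only [Fin.sum_univ_four]
  simp [dt, h0]
  linear_combination (2 * M / radius x ^ 2 * m d * (3 / 2)) * hn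

theorem pd_ofEB {T : Tensor2} {E B : Fin 3 → Pt → ℝ}
    (hT : ∀ z ∈ exterior M, T z = ofEB (fun i => E i z) (fun i => B i z)) (hx : x ∈ exterior M)
    (c a b : Fin 4) : pd c (fun z => T z a b) x
      = ofEB (fun i => pd c (E i) x) (fun i => pd c (B i) x) a b := by
  rw [pd_congr (v := fun z => ofEB (fun i => E i z) (fun i => B i z) a b)
    (fun z hz => by rw [hT z hz]) hx]
  have hneg : ∀ u : Pt → ℝ, pd c (fun z => -u z) x = -pd c u x := fun u => by
    rw [pd, fderiv_fun_neg]; rfl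
  have h0 : pd c (fun _ => (0 : ℝ)) x = 0 := (HasGrad.const 0).pd_eq c
  fin_cases a <;> fin_cases b <;> simp [ofEB, hneg, h0]

theorem divergence_eq_sub (hM : 0 < M) (hx : x ∈ exterior M) {T : Tensor2} {E B : Fin 3 → Pt → ℝ}
    (hT : ∀ z ∈ exterior M, T z = ofEB (fun i => E i z) (fun i => B i z)) (a : Fin 4) :
    divergence (metric M) T x a =
      (∑ b, ∑ c, metricInv M x b c
          * ofEB (fun i => pd c (E i) x) (fun i => pd c (B i) x) a b)
      - (∑ d, ∑ b, (∑ c, metricInv M x b c * christoffel (metric M) x d c a) * T x d b)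
      - ∑ d, (∑ b, ∑ c, metricInv M x b c * christoffel (metric M) x d c b) * T x a d := by
  have e1 : ∑ d, ∑ b, (∑ c, metricInv M x b c * christoffel (metric M) x d c a) * T x d b
      = ∑ b, ∑ c, metricInv M x b c * ∑ d, christoffel (metric M) x d c a * T x d b := by
    rw [Finset.sum_comm]
    refine Finset.sum_congr rfl fun b _ => ?_
    simp only [Finset.sum_mul, Finset.mul_sum]
    rw [Finset.sum_comm]
    simp only [mul_assoc]
  have e2 : ∑ d, (∑ b, ∑ c, metricInv M x b c * christoffel (metric M) x d c b) * T x a d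
      = ∑ b, ∑ c, metricInv M x b c * ∑ d, christoffel (metric M) x d c b * T x a d := by
    simp only [Finset.sum_mul, Finset.mul_sum]
    rw [Finset.sum_comm]
    refine Finset.sum_congr rfl fun b _ => ?_
    rw [Finset.sum_comm]
    simp only [mul_assoc]
  rw [e1, e2]
  simp only [divergence, covDeriv, metric_inv hM hx, pd_ofEB hT hx, mul_sub,
    Finset.sum_sub_distrib]

theorem divergence_zero (hM : 0 < M) (hx : x ∈ exterior M) {T : Tensor2} {E B : Fin 3 → Pt → ℝ}
    (hT : ∀ z ∈ exterior M, T z = ofEB (fun i => E i z) (fun i => B i z)) :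
    divergence (metric M) T x 0 = -div3 E x
      + (1 - lapse M (radius x)) * dot3 (unitNormal x) (fun i => radialD (E i) x)
      + 4 * M / radius x ^ 2 * dot3 (unitNormal x) (fun i => E i x) := by
  rw [divergence_eq_sub hM hx hT, hT x hx]
  simp only [sum_sum_metricInv_christoffel hM hx]
  simp only [sum_metricInv_christoffel hM hx]
  have h0 : dt 0 = 1 := rfl
  have hs : ∀ i : Fin 3, dt i.succ = 0 := fun i => by simp [dt]
  simp only [Fin.sum_univ_succ (n := 3), Fin.sum_univ_three, dr_zero, dr_succ, h0, hs,
    metricInv_zero_zero, metricInv_zero_succ, metricInv_succ_zero, metricInv_succ_succ]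
  simp only [radialD_eq, dot3, div3]
  simp [ofEB]
  ring

theorem divergence_succ (hM : 0 < M) (hx : x ∈ exterior M) {T : Tensor2} {E B : Fin 3 → Pt → ℝ}
    (hT : ∀ z ∈ exterior M, T z = ofEB (fun i => E i z) (fun i => B i z)) (i : Fin 3) :
    divergence (metric M) T x i.succ = -((lapse M (radius x))⁻¹ * pd 0 (E i) x) - curl3 B x i
      + (1 - lapse M (radius x)) * (unitNormal x ⨯₃ fun j => radialD (B j) x) i := by
  rw [divergence_eq_sub hM hx hT, hT x hx]
  simp only [sum_sum_metricInv_christoffel hM hx]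
  simp only [sum_metricInv_christoffel hM hx]
  have h0 : dt 0 = 1 := rfl
  have hs : ∀ i : Fin 3, dt i.succ = 0 := fun i => by simp [dt]
  simp only [Fin.sum_univ_succ (n := 3), Fin.sum_univ_three, dr_zero, dr_succ, h0, hs,
    metricInv_zero_zero, metricInv_zero_succ, metricInv_succ_zero, metricInv_succ_succ]
  simp only [radialD_eq, cross_apply, curl3]
  fin_cases i <;> simp [ofEB] <;> ring

end Divergence

/-! ### Maxwell's equations for the electric and magnetic vectors -/

/-- The electric covector `F_{0i}`. -/
def elec (F : Tensor2) (i : Fin 3) (x : Pt) : ℝ := F x 0 i.succ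

/-- The magnetic vector, `F_{ij} = ε_{ijk} B_k`. -/
def magn (F : Tensor2) (i : Fin 3) (x : Pt) : ℝ := F x (i + 1).succ (i + 2).succ

theorem eq_ofEB_of_antisymm {F : Tensor2} {x : Pt} (h : ∀ a b, F x a b = -F x b a) :
    F x = ofEB (fun i => elec F i x) (fun i => magn F i x) := by
  have h00 := h 0 0
  have h11 := h 1 1
  have h22 := h 2 2
  have h33 := h 3 3
  have h10 := h 1 0
  have h20 := h 2 0
  have h30 := h 3 0
  have h21 := h 2 1
  have h13 := h 1 3
  have h32 := h 3 2
  ext a b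
  fin_cases a <;> fin_cases b <;> simp [ofEB, elec, magn] <;> linarith

/-- Maxwell's equations on the Schwarzschild exterior in Cartesian coordinates. -/
structure MaxwellEB (M : ℝ) (E B : Fin 3 → Pt → ℝ) : Prop where
  smooth_E : ∀ i, Smooth M (E i)
  smooth_B : ∀ i, Smooth M (B i)
  gauss : ∀ x ∈ exterior M, div3 E x =
    (1 - lapse M (radius x)) * dot3 (unitNormal x) (fun i => radialD (E i) x)
      + 4 * M / radius x ^ 2 * dot3 (unitNormal x) (fun i => E i x)
  ampere : ∀ x ∈ exterior M, ∀ i, pd 0 (E i) x = -(lapse M (radius x) * (curl3 B x i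
    - (1 - lapse M (radius x)) * (unitNormal x ⨯₃ fun j => radialD (B j) x) i))
  div_magn : ∀ x ∈ exterior M, div3 B x = 0
  faraday : ∀ x ∈ exterior M, ∀ i, pd 0 (B i) x = curl3 E x i

section Maxwell

variable {M : ℝ} {x : Pt}

theorem christoffel_symm (hM : 0 < M) (hx : x ∈ exterior M) (a b c : Fin 4) :
    christoffel (metric M) x a b c = christoffel (metric M) x a c b := by
  rw [christoffel_eq hM hx, christoffel_eq hM hx]
  by_cases h : b = c
  · subst h; ring
  · simp only [h, Ne.symm h, false_and, if_false]
    ring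

theorem covDeriv_antisymm {T : Tensor2} (hT : ∀ z ∈ exterior M, ∀ a b, T z a b = -T z b a)
    (hx : x ∈ exterior M) (g : Tensor2) (c a b : Fin 4) :
    covDeriv g T x c a b = -covDeriv g T x c b a := by
  have e : pd c (fun z => T z a b) x = -pd c (fun z => T z b a) x := by
    rw [pd_congr (v := fun z => -T z b a) (fun z hz => hT z hz a b) hx, pd, fderiv_fun_neg]
    rfl
  have e1 : ∑ d, christoffel g x d c b * T x a d = -∑ d, christoffel g x d c b * T x d a := by
    rw [← Finset.sum_neg_distrib]
    exact Finset.sum_congr rfl fun d _ => by rw [hT x hx a d]; ring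
  have e2 : ∑ d, christoffel g x d c a * T x b d = -∑ d, christoffel g x d c a * T x d b := by
    rw [← Finset.sum_neg_distrib]
    exact Finset.sum_congr rfl fun d _ => by rw [hT x hx b d]; ring
  rw [covDeriv, covDeriv, e, e1, e2]
  ring

theorem sum_metricInv_covDeriv_eq (hx : x ∈ exterior M) {T : Tensor2}
    (hT : ∀ z ∈ exterior M, ∀ a b, T z a b = -T z b a) (b : Fin 4) :
    ∑ a, ∑ c, (metric M x)⁻¹ a c * covDeriv (metric M) T x c a b
      = -divergence (metric M) T x b := by
  rw [divergence, ← Finset.sum_neg_distrib]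
  refine Finset.sum_congr rfl fun a _ => ?_
  rw [← Finset.sum_neg_distrib]
  refine Finset.sum_congr rfl fun c _ => ?_
  rw [covDeriv_antisymm hT hx]
  ring

/-- The connection terms cancel in pairs, because the Christoffel symbols are symmetric and the
tensor is not; closedness is therefore a statement about partial derivatives. -/
theorem covDeriv_cyclic (hM : 0 < M) (hx : x ∈ exterior M) {T : Tensor2}
    (hT : ∀ a b, T x a b = -T x b a) (a b c : Fin 4) :
    covDeriv (metric M) T x a b c + covDeriv (metric M) T x b c a
      + covDeriv (metric M) T x c a b
    = pd a (fun z => T z b c) x + pd b (fun z => T z c a) x + pd c (fun z => T z a b) x := by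
  have h : ∀ a b c, ∑ d, christoffel (metric M) x d a b * T x c d
      = -∑ d, christoffel (metric M) x d b a * T x d c := by
    intro a b c
    rw [← Finset.sum_neg_distrib]
    refine Finset.sum_congr rfl fun d _ => ?_
    rw [hT c d, christoffel_symm hM hx]
    ring
  simp only [covDeriv, h]
  ring

theorem IsMaxwellField.maxwellEB (hM : 0 < M) {F : Tensor2} (hF : IsMaxwellField M F) :
    MaxwellEB M (elec F) (magn F) := by
  have hEB : ∀ z ∈ exterior M, F z = ofEB (fun i => elec F i z) (fun i => magn F i z) :=
    fun z hz => eq_ofEB_of_antisymm (hF.antisymm z hz)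
  have hdiv : ∀ x ∈ exterior M, ∀ b, divergence (metric M) F x b = 0 := fun x hx b => by
    have := hF.div_eq_zero x hx b
    rw [sum_metricInv_covDeriv_eq hx hF.antisymm] at this
    linarith
  have hcl : ∀ x ∈ exterior M, ∀ a b c, pd a (fun z => F z b c) x + pd b (fun z => F z c a) x
      + pd c (fun z => F z a b) x = 0 := fun x hx a b c => by
    rw [← covDeriv_cyclic hM hx (hF.antisymm x hx)]
    exact hF.closed x hx a b c
  refine ⟨fun i => hF.smooth _ _, fun i => hF.smooth _ _, ?_, ?_, ?_, ?_⟩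
  · intro x hx
    have := hdiv x hx 0
    rw [divergence_zero hM hx hEB] at this
    linarith
  · intro x hx i
    have := hdiv x hx i.succ
    have hl := (lapse_pos hM hx).ne'
    rw [divergence_succ hM hx hEB] at this
    have h2 : (lapse M (radius x))⁻¹ * pd 0 (elec F i) x = -(curl3 (magn F) x i
      - (1 - lapse M (radius x)) * (unitNormal x ⨯₃ fun j => radialD (magn F j) x) i) := by
      linarith
    rw [inv_mul_eq_iff_eq_mul₀ hl] at h2
    rw [h2]; ring
  · intro x hx
    have := hcl x hx 1 2 3
    rw [pd_ofEB hEB hx, pd_ofEB hEB hx, pd_ofEB hEB hx] at this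
    simpa [ofEB, div3] using this
  · intro x hx i
    have h1 := hcl x hx 0 (i + 1).succ (i + 2).succ
    rw [pd_ofEB hEB hx, pd_ofEB hEB hx, pd_ofEB hEB hx] at h1
    fin_cases i <;> simp [ofEB, curl3] at h1 ⊢ <;> linarith

theorem MaxwellEB.isMaxwellField (hM : 0 < M) {F : Tensor2} {E B : Fin 3 → Pt → ℝ}
    (h : MaxwellEB M E B)
    (hEB : ∀ z ∈ exterior M, F z = ofEB (fun i => E i z) (fun i => B i z)) :
    IsMaxwellField M F := by
  have hanti : ∀ z ∈ exterior M, ∀ a b, F z a b = -F z b a := fun z hz a b => by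
    rw [hEB z hz, ofEB_antisymm]
  refine ⟨?_, hanti, ?_, ?_⟩
  · intro a b
    refine Smooth.congr (M := M) (u := fun z => ofEB (fun i => E i z) (fun i => B i z) a b) ?_
      fun z hz => by rw [hEB z hz]
    have h0 : Smooth M fun _ => (0 : ℝ) := Smooth.const 0
    have hE := h.smooth_E
    have hB := h.smooth_B
    fin_cases a <;> fin_cases b <;>
      first
        | exact h0
        | exact hE _
        | exact (hE _).neg
        | exact hB _
        | exact (hB _).neg
  · intro x hx b
    rw [sum_metricInv_covDeriv_eq hx hanti, neg_eq_zero]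
    refine Fin.cases ?_ (fun i => ?_) b
    · rw [divergence_zero hM hx hEB, h.gauss x hx]
      ring
    · rw [divergence_succ hM hx hEB, h.ampere x hx i]
      have hl := (lapse_pos hM hx).ne'
      field_simp
      ring
  · intro x hx a b c
    rw [covDeriv_cyclic hM hx (hanti x hx), pd_ofEB hEB hx, pd_ofEB hEB hx, pd_ofEB hEB hx]
    have h1 := h.div_magn x hx
    have h2 := h.faraday x hx 0
    have h3 := h.faraday x hx 1
    have h4 := h.faraday x hx 2
    simp only [div3] at h1
    simp [curl3] at h2 h3 h4
    fin_cases a <;> fin_cases b <;> fin_cases c <;> simp [ofEB] <;> linarith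

/-- The tensor `Z` in terms of the electric and magnetic vectors. -/
theorem Z_ofEB (hM : 0 < M) (hx : x ∈ exterior M) {F : Tensor2} {E B : Fin 3 → ℝ}
    (hF : F x = ofEB E B) :
    Z M F x = ofEB (fun i => 2 / 3 * lapse M (radius x) * (position x ⨯₃ B) i)
      (fun i => -(2 / 3 * (lapse M (radius x))⁻¹ * (position x ⨯₃ E) i)) := by
  have hr := (radius_pos hM hx).ne'
  have hy : ∀ i, position x i = radius x * unitNormal x i := fun i => by
    rw [unitNormal_apply, position]; field_simp
  ext a b
  simp only [Z, Matrix.of_apply, hodge_ofEB hM hx hF, killingYano_eq, metric_inv hM hx]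
  have e00 := metricInv_zero_zero M x
  have e0s := metricInv_zero_succ M x
  have es0 := metricInv_succ_zero M x
  have ess := metricInv_succ_succ M x
  simp only [dot3, cross_apply, hy, Fin.sum_univ_succ (n := 3), Fin.sum_univ_three, e00, e0s, es0,
    ess]
  generalize lapse M (radius x) = p at *
  generalize p⁻¹ = q at *
  generalize unitNormal x = m at *
  fin_cases a <;> fin_cases b <;> simp [ofEB] <;> ring

theorem hodge_Z_ofEB (hM : 0 < M) (hx : x ∈ exterior M) {F : Tensor2} {E B : Fin 3 → ℝ}
    (hF : F x = ofEB E B) :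
    hodge (metric M) (Z M F) x = ofEB (fun i => -(2 / 3 * (position x ⨯₃ E) i))
      (fun i => -(2 / 3 * (position x ⨯₃ B) i)) := by
  rw [hodge_ofEB hM hx (Z_ofEB hM hx hF)]
  have hl := (lapse_pos hM hx).ne'
  have hr := (radius_pos hM hx).ne'
  have hy : ∀ i, position x i = radius x * unitNormal x i := fun i => by
    rw [unitNormal_apply, position]; field_simp
  congr 1 <;> ext i <;> simp only [dot3, cross_apply, hy] <;> fin_cases i <;> simp <;>
    field_simp <;> ring

theorem Uup_zero (hM : 0 < M) (hx : x ∈ exterior M) : Uup M x 0 = 0 := by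
  simp only [Uup, U, metric_inv hM hx, (HasGrad.radius hM hx).pd_eq, Fin.sum_univ_succ (n := 3),
    metricInv_zero_succ, dr_zero]
  simp

theorem Uup_succ (hM : 0 < M) (hx : x ∈ exterior M) (i : Fin 3) :
    Uup M x i.succ = lapse M (radius x) / radius x * unitNormal x i := by
  simp only [Uup, U, metric_inv hM hx, (HasGrad.radius hM hx).pd_eq, Fin.sum_univ_succ (n := 3),
    Fin.sum_univ_three, metricInv_succ_zero, metricInv_succ_succ, dr_succ]
  have hn := unitNormal_sq_sum hM hx
  generalize unitNormal x = m at *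
  have h : m i * (m 0 ^ 2 + m 1 ^ 2 + m 2 ^ 2) = m i := by rw [hn, mul_one]
  fin_cases i <;> simp [dr_zero] at h ⊢ <;>
    linear_combination (-(1 - lapse M (radius x)) / radius x) * h

end Maxwell

/-! ### The one-form `β` -/

/-- The scalar `r (y · X)` of a vector field. -/
def radialScalar (X : Fin 3 → Pt → ℝ) (x : Pt) : ℝ :=
  radius x * dot3 (position x) (fun i => X i x)

section Beta

variable {M : ℝ} {x : Pt} {E B : Fin 3 → Pt → ℝ}

theorem position_eq (hM : 0 < M) (hx : x ∈ exterior M) (i : Fin 3) :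
    position x i = radius x * unitNormal x i := by
  have hr := (radius_pos hM hx).ne'
  rw [unitNormal_apply, position]; field_simp

theorem hasGrad_position (x : Pt) (i : Fin 3) :
    HasGrad (fun z => position z i) (fun a => if a = i.succ then 1 else 0) x := HasGrad.coord _

theorem hasGrad_cross_position {X : Fin 3 → Pt → ℝ} (hX : ∀ i, Smooth M (X i))
    (hx : x ∈ exterior M) (i : Fin 3) :
    HasGrad (fun z => (position z ⨯₃ fun j => X j z) i)
      (fun a => (position x ⨯₃ fun j => pd a (X j) x) i
        + ((fun j : Fin 3 => if a = j.succ then 1 else 0) ⨯₃ fun j => X j x) i) x := by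
  have h : ∀ j k : Fin 3, HasGrad (fun z => position z j * X k z) _ x :=
    fun j k => (hasGrad_position x j).mul ((hX k).hasGrad hx)
  fin_cases i
  · refine HasGrad.congr_grad (((h 1 2).sub (h 2 1)).congr_of_eventuallyEq
      (Eventually.of_forall fun z => ?_)) fun a => ?_
    · simp [cross_apply]
    · simp [cross_apply]; ring
  · refine HasGrad.congr_grad (((h 2 0).sub (h 0 2)).congr_of_eventuallyEq
      (Eventually.of_forall fun z => ?_)) fun a => ?_
    · simp [cross_apply]
    · simp [cross_apply]; ring
  · refine HasGrad.congr_grad (((h 0 1).sub (h 1 0)).congr_of_eventuallyEq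
      (Eventually.of_forall fun z => ?_)) fun a => ?_
    · simp [cross_apply]
    · simp [cross_apply]; ring

theorem hasGrad_lapse (hM : 0 < M) (hx : x ∈ exterior M) :
    HasGrad (fun z => lapse M (radius z)) (fun a => 2 * M / radius x ^ 2 * dr x a) x :=
  HasGrad.comp (hasDerivAt_lapse (radius_pos hM hx).ne') (HasGrad.radius hM hx)

theorem hasGrad_radialScalar (hM : 0 < M) {X : Fin 3 → Pt → ℝ} (hX : ∀ i, Smooth M (X i))
    (hx : x ∈ exterior M) :
    HasGrad (radialScalar X) (fun a => dr x a * dot3 (position x) (fun i => X i x)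
      + radius x * (dot3 (position x) (fun i => pd a (X i) x)
        + dot3 (fun j : Fin 3 => if a = j.succ then 1 else 0) (fun i => X i x))) x := by
  have h : ∀ j : Fin 3, HasGrad (fun z => position z j * X j z) _ x :=
    fun j => (hasGrad_position x j).mul ((hX j).hasGrad hx)
  refine ((HasGrad.radius hM hx).mul (((h 0).add (h 1)).add (h 2))).congr_grad fun a => ?_
  simp only [dot3]; ring

theorem radialScalar_smooth (hM : 0 < M) {X : Fin 3 → Pt → ℝ} (hX : ∀ i, Smooth M (X i)) :
    Smooth M (radialScalar X) :=
  (Smooth.radius hM).mul ((((Smooth.coord _).mul (hX 0)).add ((Smooth.coord _).mul (hX 1))).add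
    ((Smooth.coord _).mul (hX 2)))

/-- Divergence of a tensor whose electric and magnetic parts are `φ(r) y × X` and `ψ(r) y × Y`. -/
theorem divergence_cross_position (hM : 0 < M) (hx : x ∈ exterior M) {T : Tensor2}
    {X Y : Fin 3 → Pt → ℝ} (hX : ∀ i, Smooth M (X i)) (hY : ∀ i, Smooth M (Y i))
    {φ ψ : ℝ → ℝ} {φ' ψ' : ℝ} (hφ : HasDerivAt φ φ' (radius x)) (hψ : HasDerivAt ψ ψ' (radius x))
    (hT : ∀ z ∈ exterior M, T z = ofEB (fun i => φ (radius z) * (position z ⨯₃ fun j => X j z) i)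
      (fun i => ψ (radius z) * (position z ⨯₃ fun j => Y j z) i)) :
    divergence (metric M) T x 0 = φ (radius x) * dot3 (position x) (curl3 X x) ∧
    ∀ i, divergence (metric M) T x i.succ
      = -((lapse M (radius x))⁻¹ * (φ (radius x) * (position x ⨯₃ fun j => pd 0 (X j) x) i))
        - lapse M (radius x) * ψ' * (radius x * (dot3 (unitNormal x) (fun j => Y j x)
          * unitNormal x i - Y i x))
        - ψ (radius x) * (position x i * div3 Y x - 2 * Y i x - radius x * radialD (Y i) x)
        + (1 - lapse M (radius x)) * (ψ (radius x) * (radius x * (dot3 (unitNormal x)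
          (fun j => radialD (Y j) x) * unitNormal x i - radialD (Y i) x)
          + dot3 (unitNormal x) (fun j => Y j x) * unitNormal x i - Y i x)) := by
  have gX := fun i : Fin 3 => ((HasGrad.comp hφ (HasGrad.radius hM hx)).mul
    (hasGrad_cross_position hX hx i)).pd_eq
  have gY := fun i : Fin 3 => ((HasGrad.comp hψ (HasGrad.radius hM hx)).mul
    (hasGrad_cross_position hY hx i)).pd_eq
  have hT' : ∀ z ∈ exterior M, T z = ofEB
      (fun i => (fun i z => φ (radius z) * (position z ⨯₃ fun j => X j z) i) i z)
      (fun i => (fun i z => ψ (radius z) * (position z ⨯₃ fun j => Y j z) i) i z) := hT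
  have hn := unitNormal_sq_sum hM hx
  have hy := position_eq hM hx
  have d1 : dr x 1 = unitNormal x 0 := rfl
  have d2 : dr x 2 = unitNormal x 1 := rfl
  have d3 : dr x 3 = unitNormal x 2 := rfl
  have h3 : unitNormal x 2 ^ 2 = 1 - unitNormal x 0 ^ 2 - unitNormal x 1 ^ 2 := by linarith
  have s1 : (1 : Fin 4) = (0 : Fin 3).succ := rfl
  constructor
  · rw [divergence_zero hM hx hT']
    simp only [radialD_eq, div3, curl3, dot3, gX]
    simp only [cross_apply, hy, d1, d2, d3]
    generalize unitNormal x = m at *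
    simp [Fin.ext_iff]
    ring
  · intro i
    rw [divergence_succ hM hx hT']
    simp only [radialD_eq, div3, curl3, dot3, gX, gY]
    simp only [cross_apply, hy, d1, d2, d3, dr_zero]
    generalize unitNormal x = m at *
    generalize lapse M (radius x) = p at *
    generalize p⁻¹ = q at *
    fin_cases i <;> simp [Fin.ext_iff] <;> grind

theorem sum_Uup_mul_ofEB (hM : 0 < M) (hx : x ∈ exterior M) (X Y : Fin 3 → ℝ) :
    (∑ b, Uup M x b * ofEB X Y 0 b = lapse M (radius x) / radius x * dot3 (unitNormal x) X) ∧
    ∀ i : Fin 3, ∑ b, Uup M x b * ofEB X Y i.succ b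
      = lapse M (radius x) / radius x * (unitNormal x ⨯₃ Y) i := by
  simp only [Fin.sum_univ_succ (n := 3), Fin.sum_univ_three, Uup_zero hM hx, Uup_succ hM hx]
  refine ⟨by simp [ofEB, dot3]; ring, fun i => ?_⟩
  fin_cases i <;> simp [ofEB, cross_apply] <;> ring

/-- This produces the real part of `β`. The time component is Ampère's law for the radial component
of `E`; the spatial ones combine Gauss' law with Faraday's. -/
theorem sum_Uup_Z_add_divergence (hM : 0 < M) (hx : x ∈ exterior M) {F : Tensor2}
    (h : MaxwellEB M E B)
    (hF : ∀ z ∈ exterior M, F z = ofEB (fun i => E i z) (fun i => B i z)) (a : Fin 4) :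
    (∑ b, Uup M x b * Z M F x a b) + divergence (metric M) (Z M F) x a
      = -(2 / (3 * radius x) * pd a (radialScalar E) x) := by
  have hr := (radius_pos hM hx).ne'
  have hl := (lapse_pos hM hx).ne'
  have hL := hasDerivAt_lapse (M := M) hr
  obtain ⟨d0, ds⟩ := divergence_cross_position hM hx h.smooth_B h.smooth_E
    (hL.const_mul (2 / 3)) ((hL.inv hl).const_mul (-(2 / 3))) (T := Z M F) fun z hz => by
      rw [Z_ofEB hM hz (hF z hz)]
      congr 1
      ext i
      rw [Pi.inv_apply]
      ring
  obtain ⟨u0, us⟩ := sum_Uup_mul_ofEB hM hx (fun i => 2 / 3 * lapse M (radius x) *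
    (position x ⨯₃ fun j => B j x) i) (fun i => -(2 / 3 * (lapse M (radius x))⁻¹ *
      (position x ⨯₃ fun j => E j x) i))
  rw [Z_ofEB hM hx (hF x hx), (hasGrad_radialScalar hM h.smooth_E hx).pd_eq]
  have gauss := h.gauss x hx
  have amp := h.ampere x hx
  have far := h.faraday x hx
  have hn := unitNormal_sq_sum hM hx
  have hy := position_eq hM hx
  have h1 : 2 * M / radius x = 1 - lapse M (radius x) := (one_sub_lapse _ _).symm
  have h4 : 4 * M / radius x ^ 2 = 2 * (1 - lapse M (radius x)) / radius x := by
    rw [← h1]; field_simp; ring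
  have h2 : 2 * M / radius x ^ 2 = (1 - lapse M (radius x)) / radius x := by
    rw [← h1]; field_simp
  have h3 : unitNormal x 2 ^ 2 = 1 - unitNormal x 0 ^ 2 - unitNormal x 1 ^ 2 := by linarith
  have hi := mul_inv_cancel₀ hl
  have hj := mul_inv_cancel₀ hr
  refine Fin.cases ?_ (fun i => ?_) a
  · rw [u0, d0]
    simp only [amp, dot3, cross_apply, hy, dr_zero, radialD_eq]
    generalize lapse M (radius x) = p at *
    generalize unitNormal x = m at *
    simp
    field_simp
    ring
  · rw [us, ds]
    rw [gauss, h4, h2]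
    simp only [far, curl3, dot3, cross_apply, hy, dr_succ, radialD_eq, Pi.inv_apply]
    generalize lapse M (radius x) = p at *
    generalize unitNormal x = m at *
    fin_cases i <;> simp [Fin.ext_iff] <;> field_simp <;> grind

/-- The dual computation, for the imaginary part of `β`: Faraday's law in the time component, div B
= 0 and Ampère's law in the spatial ones. -/
theorem sum_Uup_hodge_Z_add_divergence (hM : 0 < M) (hx : x ∈ exterior M) {F : Tensor2}
    (h : MaxwellEB M E B)
    (hF : ∀ z ∈ exterior M, F z = ofEB (fun i => E i z) (fun i => B i z)) (a : Fin 4) :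
    (∑ b, Uup M x b * hodge (metric M) (Z M F) x a b)
        + divergence (metric M) (hodge (metric M) (Z M F)) x a
      = -(2 / (3 * radius x) * pd a (radialScalar B) x) := by
  have hr := (radius_pos hM hx).ne'
  have hl := (lapse_pos hM hx).ne'
  obtain ⟨d0, ds⟩ := divergence_cross_position hM hx h.smooth_E h.smooth_B
    (hasDerivAt_const (radius x) (-(2 / 3))) (hasDerivAt_const (radius x) (-(2 / 3)))
    (T := hodge (metric M) (Z M F)) fun z hz => by
      rw [hodge_Z_ofEB hM hz (hF z hz)]
      simp only [neg_mul]
  obtain ⟨u0, us⟩ := sum_Uup_mul_ofEB hM hx (fun i => -(2 / 3 * (position x ⨯₃ fun j => E j x) i))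
    (fun i => -(2 / 3 * (position x ⨯₃ fun j => B j x) i))
  rw [hodge_Z_ofEB hM hx (hF x hx), (hasGrad_radialScalar hM h.smooth_B hx).pd_eq]
  have gauss := h.div_magn x hx
  have amp := h.ampere x hx
  have far := h.faraday x hx
  have hn := unitNormal_sq_sum hM hx
  have hy := position_eq hM hx
  have h3 : unitNormal x 2 ^ 2 = 1 - unitNormal x 0 ^ 2 - unitNormal x 1 ^ 2 := by linarith
  have hi := mul_inv_cancel₀ hl
  have hj := mul_inv_cancel₀ hr
  refine Fin.cases ?_ (fun i => ?_) a
  · rw [u0, d0]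
    simp only [far, dot3, cross_apply, hy, dr_zero]
    generalize lapse M (radius x) = p at *
    generalize unitNormal x = m at *
    simp
    field_simp
    ring
  · rw [us, ds]
    rw [gauss]
    simp only [amp, curl3, dot3, cross_apply, hy, dr_succ, radialD_eq]
    generalize lapse M (radius x) = p at *
    generalize unitNormal x = m at *
    fin_cases i <;> simp [Fin.ext_iff] <;> field_simp <;> grind

/-- `β` is the gradient of the complex radial scalar, up to a factor. -/
theorem beta_eq (hM : 0 < M) (hx : x ∈ exterior M) {F : Tensor2} (h : MaxwellEB M E B)
    (hF : ∀ z ∈ exterior M, F z = ofEB (fun i => E i z) (fun i => B i z)) (a : Fin 4) :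
    beta M F x a = ((1 / (3 * radius x) * pd a (radialScalar E) x : ℝ) : ℂ)
      + Complex.I * ((1 / (3 * radius x) * pd a (radialScalar B) x : ℝ) : ℂ) := by
  have e1 := sum_Uup_Z_add_divergence hM hx h hF a
  have e2 := sum_Uup_hodge_Z_add_divergence hM hx h hF a
  have c1 : 1 / (3 * radius x) * pd a (radialScalar E) x = -(1 / 2) *
      ((∑ b, Uup M x b * Z M F x a b) + divergence (metric M) (Z M F) x a) := by
    rw [e1]; ring
  have c2 : 1 / (3 * radius x) * pd a (radialScalar B) x = -(1 / 2) *
      ((∑ b, Uup M x b * hodge (metric M) (Z M F) x a b)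
        + divergence (metric M) (hodge (metric M) (Z M F)) x a) := by
    rw [e2]; ring
  rw [c1, c2, beta]
  push_cast
  ring

end Beta

/-! ### Superenergies in terms of the radial scalars -/

/-- Squared norm of the angular gradient on the unit sphere. -/
def rotNormSq (u : Pt → ℝ) (x : Pt) : ℝ := rot 0 u x ^ 2 + rot 1 u x ^ 2 + rot 2 u x ^ 2

section Superenergy

variable {M : ℝ} {x : Pt} {E B : Fin 3 → Pt → ℝ} {F : Tensor2}

/-- Lagrange's identity for |y × ∇u|². -/
theorem rotNormSq_eq (hM : 0 < M) (hx : x ∈ exterior M) (u : Pt → ℝ) :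
    rotNormSq u x = radius x ^ 2 * (pd 1 u x ^ 2 + pd 2 u x ^ 2 + pd 3 u x ^ 2
      - radialD u x ^ 2) := by
  have hn := unitNormal_sq_sum hM hx
  have hy := position_eq hM hx
  have e : ∀ i : Fin 3, x i.succ = position x i := fun _ => rfl
  simp only [rotNormSq, rot, radialD_eq, e, hy]
  generalize unitNormal x = m at *
  have h3 : m 2 ^ 2 = 1 - m 0 ^ 2 - m 1 ^ 2 := by linarith
  simp
  grind

/-- Both vectors of `Z` are orthogonal to `y`, so the radial corrections in raising indices vanish
(`n3`, `n4`) and a sum of squares is left. The prefactor of the norm cancels the inverse lapse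
coming from the normalisation of `frameT`. -/
theorem ZNormSq_eq (hM : 0 < M) (hx : x ∈ exterior M)
    (hF : F x = ofEB (fun i => E i x) (fun i => B i x)) :
    ZNormSq M F x = 1 / 9 * (lapse M (radius x) ^ 2
        * dot3 (position x ⨯₃ fun i => B i x) (position x ⨯₃ fun i => B i x)
      + dot3 (position x ⨯₃ fun i => E i x) (position x ⨯₃ fun i => E i x)) := by
  have hl := lapse_pos hM hx
  have hr := radius_pos hM hx
  have hf : (radius x - 2 * M) / radius x = lapse M (radius x) := by
    rw [lapse]; field_simp
  have hn := unitNormal_sq_sum hM hx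
  have hs : (Real.sqrt (lapse M (radius x)))⁻¹ * (Real.sqrt (lapse M (radius x)))⁻¹
      = (lapse M (radius x))⁻¹ := by
    rw [← mul_inv, Real.mul_self_sqrt hl.le]
  have hT : superenergyWTT M F x = (lapse M (radius x))⁻¹ * superenergyW M F x 0 0 := by
    rw [← hs, superenergyWTT]
    simp [frameT]
    ring
  have hg : metric M x 0 0 = lapse M (radius x) := by simp [metric, dt, dr]
  rw [ZNormSq, hf, hT, mul_inv_cancel_left₀ hl.ne']
  simp only [superenergyW, Matrix.of_apply, hg, metric_inv hM hx]
  have hZ := Z_ofEB hM hx hF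
  generalize Z M F x = W at hZ
  have e1 : ∑ c, ∑ d, ∑ e, ∑ f, metricInv M x c e * metricInv M x d f * W c d * W e f
      = ∑ c, ∑ d, W c d * ∑ e, ∑ f, metricInv M x c e * metricInv M x d f * W e f := by
    simp only [Finset.mul_sum]
    exact Finset.sum_congr rfl fun c _ => Finset.sum_congr rfl fun d _ =>
      Finset.sum_congr rfl fun e _ => Finset.sum_congr rfl fun f _ => by ring
  rw [e1]
  subst hZ
  simp only [raise_ofEB hM hx]
  have e00 := metricInv_zero_zero M x
  have e0s := metricInv_zero_succ M x
  have es0 := metricInv_succ_zero M x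
  have ess := metricInv_succ_succ M x
  have hy := position_eq hM hx
  have hi := mul_inv_cancel₀ hl.ne'
  have n1 : dot3 (unitNormal x) (position x ⨯₃ fun i => B i x) = 0 := by
    simp [dot3, cross_apply, hy]; ring
  have n2 : dot3 (unitNormal x) (position x ⨯₃ fun i => E i x) = 0 := by
    simp [dot3, cross_apply, hy]; ring
  generalize position x ⨯₃ (fun i => B i x) = v at *
  generalize position x ⨯₃ (fun i => E i x) = w at *
  generalize lapse M (radius x) = p at *
  generalize p⁻¹ = q at *
  generalize unitNormal x = m at *
  generalize metricInv M x = g at *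
  have n3 : dot3 m (fun i => 2 / 3 * p * v i) = 0 := by
    rw [← mul_zero (2 / 3 * p), ← n1]; simp only [dot3]; ring
  have n4 : dot3 m (fun i => -(2 / 3 * q * w i)) = 0 := by
    rw [← mul_zero (-(2 / 3 * q)), ← n2]; simp only [dot3]; ring
  rw [n3, n4]
  simp only [dot3, Fin.sum_univ_succ (n := 3), Fin.sum_univ_three, e00, e0s, es0, ess] at n1 n2 ⊢
  simp [ofEB]
  grind

theorem re_beta_mul_star (hM : 0 < M) (hx : x ∈ exterior M) (h : MaxwellEB M E B)
    (hF : ∀ z ∈ exterior M, F z = ofEB (fun i => E i z) (fun i => B i z)) (a b : Fin 4) :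
    (beta M F x a * star (beta M F x b)).re = 1 / (9 * radius x ^ 2) *
      (pd a (radialScalar E) x * pd b (radialScalar E) x
        + pd a (radialScalar B) x * pd b (radialScalar B) x) := by
  rw [beta_eq hM hx h hF, beta_eq hM hx h hF]
  simp
  ring

theorem superenergyH_zero_zero (hM : 0 < M) (hx : x ∈ exterior M) (h : MaxwellEB M E B)
    (hF : ∀ z ∈ exterior M, F z = ofEB (fun i => E i z) (fun i => B i z)) :
    superenergyH M F x 0 0 = 1 / (18 * radius x ^ 2) *
      (pd 0 (radialScalar E) x ^ 2 + pd 0 (radialScalar B) x ^ 2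
        + lapse M (radius x) ^ 2 * (radialD (radialScalar E) x ^ 2 + radialD (radialScalar B) x ^ 2)
        + lapse M (radius x) / radius x ^ 2
          * (rotNormSq (radialScalar E) x + rotNormSq (radialScalar B) x)) := by
  have hl := (lapse_pos hM hx).ne'
  have hr := (radius_pos hM hx).ne'
  have hg : metric M x 0 0 = lapse M (radius x) := by simp [metric, dt, dr]
  simp only [superenergyH, Matrix.of_apply, hg, metric_inv hM hx, re_beta_mul_star hM hx h hF,
    rotNormSq_eq hM hx, radialD_eq]
  simp only [Fin.sum_univ_succ (n := 3), Fin.sum_univ_three, metricInv_zero_zero,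
    metricInv_zero_succ, metricInv_succ_zero, metricInv_succ_succ]
  simp
  field_simp
  ring

theorem superenergyH_succ_zero (hM : 0 < M) (hx : x ∈ exterior M) (h : MaxwellEB M E B)
    (hF : ∀ z ∈ exterior M, F z = ofEB (fun i => E i z) (fun i => B i z)) (i : Fin 3) :
    superenergyH M F x i.succ 0 = 1 / (9 * radius x ^ 2) *
      (pd i.succ (radialScalar E) x * pd 0 (radialScalar E) x
        + pd i.succ (radialScalar B) x * pd 0 (radialScalar B) x) := by
  have hg : metric M x i.succ 0 = 0 := by simp [metric, dt, dr]
  simp only [superenergyH, Matrix.of_apply, hg, re_beta_mul_star hM hx h hF]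
  ring

theorem normSq_beta_combination (hM : 0 < M) (hx : x ∈ exterior M) (h : MaxwellEB M E B)
    (hF : ∀ z ∈ exterior M, F z = ofEB (fun i => E i z) (fun i => B i z)) (v : Fin 4 → ℝ) :
    ‖contract (beta M F x) v‖ ^ 2 = 1 / (9 * radius x ^ 2) *
      ((∑ a, pd a (radialScalar E) x * v a) ^ 2 + (∑ a, pd a (radialScalar B) x * v a) ^ 2) := by
  have : contract (beta M F x) v
      = ((1 / (3 * radius x) * ∑ a, pd a (radialScalar E) x * v a : ℝ) : ℂ)
      + ((1 / (3 * radius x) * ∑ a, pd a (radialScalar B) x * v a : ℝ) : ℂ) * Complex.I := by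
    simp only [contract, beta_eq hM hx h hF, Fin.sum_univ_four]
    push_cast
    ring
  rw [this, ← Complex.normSq_eq_norm_sq, Complex.normSq_add_mul_I]
  ring

theorem angularNormSq_beta (hM : 0 < M) (hx : x ∈ exterior M) (h : MaxwellEB M E B)
    (hF : ∀ z ∈ exterior M, F z = ofEB (fun i => E i z) (fun i => B i z)) :
    angularNormSq x (beta M F x) = 1 / (9 * radius x ^ 4) *
      (rotNormSq (radialScalar E) x + rotNormSq (radialScalar B) x) := by
  have hr := (radius_pos hM hx).ne'
  have key : ∀ i : Fin 3, ‖angularPart x (beta M F x) i.succ‖ ^ 2 = 1 / (9 * radius x ^ 2) *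
      ((pd i.succ (radialScalar E) x - radialD (radialScalar E) x * unitNormal x i) ^ 2
      + (pd i.succ (radialScalar B) x - radialD (radialScalar B) x * unitNormal x i) ^ 2) := by
    intro i
    have : angularPart x (beta M F x) i.succ = ((1 / (3 * radius x) * (pd i.succ (radialScalar E) x
        - radialD (radialScalar E) x * unitNormal x i) : ℝ) : ℂ)
      + ((1 / (3 * radius x) * (pd i.succ (radialScalar B) x
        - radialD (radialScalar B) x * unitNormal x i) : ℝ) : ℂ) * Complex.I := by
      simp only [angularPart, contract, beta_eq hM hx h hF, Fin.sum_univ_succ (n := 3),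
        Fin.sum_univ_three, dr_zero, dr_succ, radialD_eq, Fin.succ_ne_zero, if_false]
      push_cast
      simp
      ring
    rw [this, ← Complex.normSq_eq_norm_sq, Complex.normSq_add_mul_I]
    ring
  have h0 : angularPart x (beta M F x) 0 = 0 := rfl
  rw [angularNormSq, Fin.sum_univ_succ, Fin.sum_univ_three, key, key, key, h0,
    rotNormSq_eq hM hx, rotNormSq_eq hM hx]
  simp only [radialD_eq]
  have hn := unitNormal_sq_sum hM hx
  generalize unitNormal x = m at *
  have h3 : m 2 ^ 2 = 1 - m 0 ^ 2 - m 1 ^ 2 := by linarith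
  simp
  field_simp
  grind

theorem betaDegNormSq_eq (hM : 0 < M) (hx : x ∈ exterior M) (h : MaxwellEB M E B)
    (hF : ∀ z ∈ exterior M, F z = ofEB (fun i => E i z) (fun i => B i z)) :
    betaDegNormSq M F x = 1 / (9 * radius x ^ 2) *
      ((1 - 3 * M / radius x) ^ 2 / radius x ^ 3
        * (rotNormSq (radialScalar E) x + rotNormSq (radialScalar B) x)
      + M / radius x ^ 2 * (lapse M (radius x) ^ 2
        * (radialD (radialScalar E) x ^ 2 + radialD (radialScalar B) x ^ 2))
      + M * (1 - 3 * M / radius x) ^ 2 / radius x ^ 2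
        * (pd 0 (radialScalar E) x ^ 2 + pd 0 (radialScalar B) x ^ 2)) := by
  have hl := lapse_pos hM hx
  have hr := (radius_pos hM hx).ne'
  have hf : radius x - 2 * M = lapse M (radius x) * radius x := by
    rw [lapse]; field_simp
  have hs := Real.sq_sqrt hl.le
  have hs0 := (Real.sqrt_pos.2 hl).ne'
  have e1 : ∀ u : Pt → ℝ, ∑ a, pd a u x * frameZ M x a
      = Real.sqrt (lapse M (radius x)) * radialD u x := fun u => by
    rw [radialD_eq]
    simp [frameZ, Fin.sum_univ_four, unitNormal]
    ring
  have e2 : ∀ u : Pt → ℝ, ∑ a, pd a u x * frameT M x a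
      = (Real.sqrt (lapse M (radius x)))⁻¹ * pd 0 u x := fun u => by
    simp [frameT]
    ring
  rw [betaDegNormSq, normSq_beta_combination hM hx h hF, normSq_beta_combination hM hx h hF,
    angularNormSq_beta hM hx h hF]
  simp only [e1, e2, mul_pow, inv_pow, hs, hf]
  field_simp

end Superenergy

/-! ### The flux through a hypersurface -/

namespace SphericalHypersurface

variable {M : ℝ} {E B : Fin 3 → Pt → ℝ} {F : Tensor2} (S : SphericalHypersurface M)
  {y : Fin 3 → ℝ}

theorem radius_embed (y : Fin 3 → ℝ) : radius (S.embed y) = spatialRadius y := rfl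

theorem embed_mem (hy : y ∈ S.domain) : S.embed y ∈ exterior M := S.subset hy

theorem hasDerivAt {r : ℝ} (hr : r ∈ S.I) : HasDerivAt S.h (deriv S.h r) r :=
  ((S.smooth.contDiffAt (S.isOpen.mem_nhds hr)).differentiableAt (by simp)).hasDerivAt

theorem conormal_eq (hM : 0 < M) {x : Pt} (hx : radius x ∈ S.I) (a : Fin 4) :
    S.conormal x a = dt a - deriv S.h (radius x) * dr x a :=
  ((HasGrad.coord 0).sub (HasGrad.comp (S.hasDerivAt hx)
    (HasGrad.radius hM (S.subset hx)))).pd_eq a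

theorem tangent_eq (hM : 0 < M) (hy : y ∈ S.domain) (i : Fin 3) :
    S.tangent y i = Matrix.vecCons (deriv S.h (spatialRadius y) * unitNormal (S.embed y) i)
      (Pi.single i 1) := by
  have hx := S.embed_mem hy
  let L : (Fin 3 → ℝ) →L[ℝ] Pt := ContinuousLinearMap.pi fun a =>
    Fin.cases (motive := fun _ => (Fin 3 → ℝ) →L[ℝ] ℝ) 0 (fun j => ContinuousLinearMap.proj j) a
  have hL0 : L y 0 = 0 := rfl
  have hLs : ∀ z (j : Fin 3), L z j.succ = z j := fun z j => rfl
  have hLi : L (Pi.single i 1) = Pi.single i.succ 1 := by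
    ext a
    refine Fin.cases ?_ (fun j => ?_) a
    · simp [L, (Fin.succ_ne_zero i).symm]
    · rw [hLs]
      simp [Pi.single_apply]
  have hxL : L y ∈ exterior M := hx
  have hr : HasFDerivAt spatialRadius ((fderiv ℝ radius (L y)).comp L) y :=
    ((HasGrad.radius hM hxL).1.hasFDerivAt).comp y L.hasFDerivAt
  obtain ⟨h', hh, hval⟩ : ∃ h' : (Fin 3 → ℝ) →L[ℝ] ℝ,
      HasFDerivAt (fun z => S.h (spatialRadius z)) h' y ∧
        h' (Pi.single i 1) = deriv S.h (spatialRadius y) * unitNormal (S.embed y) i := by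
    refine ⟨_, (S.hasDerivAt hy).hasFDerivAt.comp y hr, ?_⟩
    have e := (HasGrad.radius hM hxL).pd_eq i.succ
    rw [pd, ← hLi] at e
    simp only [ContinuousLinearMap.comp_apply, e]
    have en : dr (L y) i.succ = unitNormal (S.embed y) i := rfl
    simp [en, mul_comm]
  have he : HasFDerivAt S.embed (ContinuousLinearMap.pi fun a =>
      Fin.cases (motive := fun _ => (Fin 3 → ℝ) →L[ℝ] ℝ) h'
        (fun j => ContinuousLinearMap.proj j) a) y := by
    refine hasFDerivAt_pi.2 fun a => ?_
    exact Fin.cases hh (fun j => hasFDerivAt_apply j y) a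
  rw [tangent, he.fderiv]
  ext a
  exact Fin.cases hval (fun j => rfl) a

/-- The induced metric is minus the identity plus a multiple of n ⊗ n, so its eigenvalues are -1
twice and the square of the radial tangent vector. -/
theorem inducedMetric_det (hM : 0 < M) (hy : y ∈ S.domain) : (S.inducedMetric y).det
    = lapse M (spatialRadius y) * deriv S.h (spatialRadius y) ^ 2
      - (lapse M (spatialRadius y))⁻¹ := by
  have hx := S.embed_mem hy
  have hn := unitNormal_sq_sum hM hx
  have e : ∀ i j, S.inducedMetric y i j = (lapse M (spatialRadius y)
      * deriv S.h (spatialRadius y) ^ 2 - (lapse M (spatialRadius y))⁻¹ + 1)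
        * unitNormal (S.embed y) i * unitNormal (S.embed y) j - if i = j then 1 else 0 := by
    intro i j
    simp only [inducedMetric, Matrix.of_apply, tangent_eq S hM hy, metric, radius_embed,
      Fin.sum_univ_succ (n := 3), Matrix.cons_val_zero, Matrix.cons_val_succ, dr_zero, dr_succ]
    have h0 : dt 0 = 1 := rfl
    have hs : ∀ i : Fin 3, dt i.succ = 0 := fun i => by simp [dt]
    simp only [h0, hs, Fin.sum_univ_three]
    fin_cases i <;> fin_cases j <;> simp <;> ring
  rw [Matrix.det_fin_three]
  simp only [e]
  generalize unitNormal (S.embed y) = m at *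
  have h3 : m 2 ^ 2 = 1 - m 0 ^ 2 - m 1 ^ 2 := by linarith
  simp
  grind

/-- The normalisation of the unit normal and the induced volume density are the same square root. It
cancels, and the flux is rational in the lapse and the slope. -/
theorem flux_eq (hM : 0 < M) (hy : y ∈ S.domain) :
    S.fluxIntegrand F xi (S.embed y) * S.inducedVolDensity y
      = (lapse M (spatialRadius y))⁻¹ * superenergyH M F (S.embed y) 0 0
        + lapse M (spatialRadius y) * deriv S.h (spatialRadius y) *
          ∑ i, unitNormal (S.embed y) i * superenergyH M F (S.embed y) i.succ 0 := by
  have hx := S.embed_mem hy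
  have hn := unitNormal_sq_sum hM hx
  have hl := lapse_pos hM hx
  rw [radius_embed] at hl
  have hneg := S.spacelike _ hy
  have hc := S.conormal_eq hM (x := S.embed y) hy
  have hup0 : ∑ b, metricInv M (S.embed y) 0 b * S.conormal (S.embed y) b
      = (lapse M (spatialRadius y))⁻¹ := by
    simp only [hc, Fin.sum_univ_succ (n := 3), metricInv_zero_zero, metricInv_zero_succ,
      radius_embed, dr_zero]
    simp [dt]
  have hups : ∀ i : Fin 3, ∑ b, metricInv M (S.embed y) i.succ b * S.conormal (S.embed y) b
      = lapse M (spatialRadius y) * deriv S.h (spatialRadius y) * unitNormal (S.embed y) i := by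
    intro i
    simp only [hc, Fin.sum_univ_succ (n := 3), metricInv_succ_zero, metricInv_succ_succ,
      radius_embed, dr_zero, dr_succ, Fin.sum_univ_three]
    generalize unitNormal (S.embed y) = m at *
    have h3 : m 2 ^ 2 = 1 - m 0 ^ 2 - m 1 ^ 2 := by linarith
    have hs : ∀ i : Fin 3, dt i.succ = 0 := fun i => by simp [dt]
    simp only [hs]
    fin_cases i <;> simp <;> grind
  have hq : ∑ c, ∑ d, metricInv M (S.embed y) c d * S.conormal (S.embed y) c
      * S.conormal (S.embed y) d = (lapse M (spatialRadius y))⁻¹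
        - lapse M (spatialRadius y) * deriv S.h (spatialRadius y) ^ 2 := by
    have : ∀ c, ∑ d, metricInv M (S.embed y) c d * S.conormal (S.embed y) c
      * S.conormal (S.embed y) d = S.conormal (S.embed y) c *
        ∑ d, metricInv M (S.embed y) c d * S.conormal (S.embed y) d := fun c => by
      rw [Finset.mul_sum]
      exact Finset.sum_congr rfl fun d _ => by ring
    simp only [this]
    rw [Fin.sum_univ_succ, hup0]
    simp only [hups]
    simp only [hc, Fin.sum_univ_three, dr_zero, dr_succ, radius_embed]
    have h0 : dt 0 = 1 := rfl
    have hs : ∀ i : Fin 3, dt i.succ = 0 := fun i => by simp [dt]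
    simp only [h0, hs]
    linear_combination (-(lapse M (spatialRadius y) * deriv S.h (spatialRadius y) ^ 2)) * hn
  have hvol : S.inducedVolDensity y = Real.sqrt ((lapse M (spatialRadius y))⁻¹
        - lapse M (spatialRadius y) * deriv S.h (spatialRadius y) ^ 2) := by
    rw [inducedVolDensity, inducedMetric_det S hM hy, abs_of_neg hneg, neg_sub]
  have hv0 : S.inducedVolDensity y ≠ 0 := by
    rw [hvol]
    exact (Real.sqrt_pos.2 (by linarith)).ne'
  have hN : ∀ a, S.normal (S.embed y) a = (∑ b, metricInv M (S.embed y) a b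
      * S.conormal (S.embed y) b) / S.inducedVolDensity y := by
    intro a
    rw [normal, metric_inv hM hx, hq, hvol]
  simp only [fluxIntegrand, hN, Finset.sum_mul]
  rw [Fin.sum_univ_succ]
  simp only [hup0, hups]
  simp [xi, Fin.sum_univ_three]
  field_simp

theorem flux_eq_radialScalar (hM : 0 < M) (hy : y ∈ S.domain) (h : MaxwellEB M E B)
    (hF : ∀ z ∈ exterior M, F z = ofEB (fun i => E i z) (fun i => B i z)) {r f : ℝ} {x : Pt}
    (hr : spatialRadius y = r) (hf : lapse M r = f) (hx : S.embed y = x) :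
    S.fluxIntegrand F xi x * S.inducedVolDensity y
      = 1 / (9 * r ^ 2) * (1 / (2 * f) * (pd 0 (radialScalar E) x ^ 2 + pd 0 (radialScalar B) x ^ 2
        + f ^ 2 * (radialD (radialScalar E) x ^ 2 + radialD (radialScalar B) x ^ 2)
        + f / r ^ 2 * (rotNormSq (radialScalar E) x + rotNormSq (radialScalar B) x))
        + deriv S.h r * (f * (pd 0 (radialScalar E) x * radialD (radialScalar E) x
          + pd 0 (radialScalar B) x * radialD (radialScalar B) x))) := by
  subst hr hf hx
  have hx := S.embed_mem hy
  have hl := lapse_pos hM hx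
  have hr := radius_pos hM hx
  rw [radius_embed] at hl hr
  rw [S.flux_eq hM hy, superenergyH_zero_zero hM hx h hF]
  simp only [superenergyH_succ_zero hM hx h hF, Fin.sum_univ_three, radius_embed]
  simp only [radialD_eq]
  simp
  field_simp
  ring

end SphericalHypersurface

/-! ### Reduction to a transport system on the spheres -/

/-- The rotation by a right angle of the tangential part of a vector field. -/
def crossN (X : Fin 3 → Pt → ℝ) (i : Fin 3) (x : Pt) : ℝ :=
  (unitNormal x ⨯₃ fun j => X j x) i

/-- The sum of the rotation derivatives of the components of a vector field. -/
def rotDiv (X : Fin 3 → Pt → ℝ) (x : Pt) : ℝ := rot 0 (X 0) x + rot 1 (X 1) x + rot 2 (X 2) x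

/-- Pointwise form of the equations for the radial scalars `D`, `K` and the tangential fields
`e`, `b`. -/
structure ReducedSystem (M : ℝ) (D K : Pt → ℝ) (e b : Fin 3 → Pt → ℝ) : Prop where
  smooth_D : Smooth M D
  smooth_K : Smooth M K
  smooth_e : ∀ i, Smooth M (e i)
  smooth_b : ∀ i, Smooth M (b i)
  normal_e : ∀ x ∈ exterior M, dot3 (unitNormal x) (fun i => e i x) = 0
  normal_b : ∀ x ∈ exterior M, dot3 (unitNormal x) (fun i => b i x) = 0
  time_D : ∀ x ∈ exterior M, pd 0 D x = rotDiv (crossN b) x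
  radial_D : ∀ x ∈ exterior M, lapse M (radius x) * radialD D x = -rotDiv (crossN e) x
  time_K : ∀ x ∈ exterior M, pd 0 K x = rotDiv e x
  radial_K : ∀ x ∈ exterior M, lapse M (radius x) * radialD K x = -rotDiv b x
  time_e : ∀ x ∈ exterior M, ∀ i, pd 0 (e i) x = -(lapse M (radius x) * radialD (b i) x)
    + lapse M (radius x) / radius x ^ 2 * rot i K x
  time_b : ∀ x ∈ exterior M, ∀ i, pd 0 (b i) x = -(lapse M (radius x) * radialD (e i) x)
    - lapse M (radius x) / radius x ^ 2 * (unitNormal x ⨯₃ fun j => rot j D x) i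

/-- The tangential part of the electric vector, scaled by `r`. -/
def tangentialE (E : Fin 3 → Pt → ℝ) (i : Fin 3) (x : Pt) : ℝ :=
  radius x * (E i x - dot3 (unitNormal x) (fun j => E j x) * unitNormal x i)

/-- The rotated tangential part of the magnetic vector, scaled by `r` and the lapse. -/
def tangentialB (M : ℝ) (B : Fin 3 → Pt → ℝ) (i : Fin 3) (x : Pt) : ℝ :=
  lapse M (radius x) * (position x ⨯₃ fun j => B j x) i

section Reduction

variable {M : ℝ} {x : Pt} {E B : Fin 3 → Pt → ℝ}

theorem Smooth.unitNormal (hM : 0 < M) (i : Fin 3) : Smooth M (fun z => unitNormal z i) :=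
  ((Smooth.coord i.succ).div (Smooth.radius hM) fun _ hx => (radius_pos hM hx).ne').congr
    fun _ _ => unitNormal_apply _ _

theorem hasGrad_unitNormal (hM : 0 < M) (hx : x ∈ exterior M) (i : Fin 3) :
    HasGrad (fun z => unitNormal z i)
      (fun c => ((if c = i.succ then 1 else 0) - unitNormal x i * dr x c) / radius x) x :=
  (hasGrad_dr hM hx i.succ).congr_grad fun c => by simp [eq_comm, dr_succ]

theorem hasGrad_dot3 {X : Fin 3 → Pt → ℝ} {Y : Fin 3 → Pt → ℝ} {g k : Fin 3 → Fin 4 → ℝ}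
    (hX : ∀ i, HasGrad (X i) (g i) x) (hY : ∀ i, HasGrad (Y i) (k i) x) :
    HasGrad (fun z => dot3 (fun i => X i z) (fun i => Y i z))
      (fun a => dot3 (fun i => g i a) (fun i => Y i x) + dot3 (fun i => X i x) (fun i => k i a))
      x := by
  refine ((((hX 0).mul (hY 0)).add ((hX 1).mul (hY 1))).add ((hX 2).mul (hY 2))).congr_grad
    fun a => ?_
  simp only [dot3]; ring

theorem hasGrad_tangentialE (hM : 0 < M) {X : Fin 3 → Pt → ℝ} (hX : ∀ i, Smooth M (X i))
    (hx : x ∈ exterior M) (i : Fin 3) :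
    HasGrad (tangentialE X i)
      (fun a => dr x a * (X i x - dot3 (unitNormal x) (fun j => X j x) * unitNormal x i)
        + radius x * (pd a (X i) x
          - (dot3 (fun j => ((if a = j.succ then 1 else 0) - unitNormal x j * dr x a) / radius x)
              (fun j => X j x) + dot3 (unitNormal x) (fun j => pd a (X j) x)) * unitNormal x i
          - dot3 (unitNormal x) (fun j => X j x)
            * (((if a = i.succ then 1 else 0) - unitNormal x i * dr x a) / radius x))) x := by
  refine ((HasGrad.radius hM hx).mul (((hX i).hasGrad hx).sub
    ((hasGrad_dot3 (hasGrad_unitNormal hM hx) fun j => (hX j).hasGrad hx).mul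
      (hasGrad_unitNormal hM hx i)))).congr_grad fun a => ?_
  ring

theorem hasGrad_tangentialB (hM : 0 < M) {X : Fin 3 → Pt → ℝ} (hX : ∀ i, Smooth M (X i))
    (hx : x ∈ exterior M) (i : Fin 3) :
    HasGrad (tangentialB M X i) (fun a => (1 - lapse M (radius x)) / radius x * dr x a
        * (position x ⨯₃ fun j => X j x) i
      + lapse M (radius x) * ((position x ⨯₃ fun j => pd a (X j) x) i
        + ((fun j : Fin 3 => if a = j.succ then 1 else 0) ⨯₃ fun j => X j x) i)) x := by
  refine ((hasGrad_lapse hM hx).mul (hasGrad_cross_position hX hx i)).congr_grad fun a => ?_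
  rw [one_sub_lapse]
  ring

theorem crossN_tangentialE (hM : 0 < M) (hx : x ∈ exterior M) (X : Fin 3 → Pt → ℝ) (i : Fin 3) :
    crossN (tangentialE X) i x = (position x ⨯₃ fun j => X j x) i := by
  simp only [crossN, tangentialE, cross_apply, position_eq hM hx]
  fin_cases i <;> simp <;> ring

theorem crossN_tangentialB (hM : 0 < M) (hx : x ∈ exterior M) (X : Fin 3 → Pt → ℝ) (i : Fin 3) :
    crossN (tangentialB M X) i x = -(lapse M (radius x) * tangentialE X i x) := by
  have hn := unitNormal_sq_sum hM hx
  simp only [crossN, tangentialE, tangentialB, cross_apply, position_eq hM hx, dot3]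
  generalize unitNormal x = m at *
  have h3 : m 2 ^ 2 = 1 - m 0 ^ 2 - m 1 ^ 2 := by linarith
  fin_cases i <;> simp <;> grind

theorem rot_radial_mul (hM : 0 < M) (hx : x ∈ exterior M) {φ : ℝ → ℝ} {φ' : ℝ} {u : Pt → ℝ}
    (hφ : HasDerivAt φ φ' (radius x)) (hu : Smooth M u) (i : Fin 3) :
    rot i (fun z => φ (radius z) * u z) x = φ (radius x) * rot i u x := by
  have g := ((HasGrad.comp hφ (HasGrad.radius hM hx)).mul (hu.hasGrad hx)).pd_eq
  simp only [rot, g, dr_succ, unitNormal_apply]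
  ring

theorem rotDiv_tangentialE (hM : 0 < M) (hx : x ∈ exterior M) {X : Fin 3 → Pt → ℝ}
    (hX : ∀ i, Smooth M (X i)) :
    rotDiv (tangentialE X) x = radius x * dot3 (position x) (curl3 X x) := by
  have g := fun i => (hasGrad_tangentialE hM hX hx i).pd_eq
  have ey : ∀ i : Fin 3, x i.succ = radius x * unitNormal x i := position_eq hM hx
  have hr := (radius_pos hM hx).ne'
  simp only [rotDiv, rot, g, curl3, dot3, ey, position_eq hM hx, dr_succ]
  simp [Fin.ext_iff]
  field_simp
  ring

theorem rotDiv_cross_position (hM : 0 < M) (hx : x ∈ exterior M) {X : Fin 3 → Pt → ℝ}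
    (hX : ∀ i, Smooth M (X i)) :
    rotDiv (fun i z => (position z ⨯₃ fun j => X j z) i) x
      = radius x ^ 2 * div3 X x - 2 * dot3 (position x) (fun j => X j x)
        - radius x * dot3 (position x) (fun j => radialD (X j) x) := by
  have g := fun i => (hasGrad_cross_position hX hx i).pd_eq
  have ey : ∀ i : Fin 3, x i.succ = radius x * unitNormal x i := position_eq hM hx
  have hn := unitNormal_sq_sum hM hx
  simp only [rotDiv, rot, g, div3, dot3, radialD_eq]
  simp only [ey, cross_apply, position_eq hM hx]
  generalize unitNormal x = m at *
  have h3 : m 2 ^ 2 = 1 - m 0 ^ 2 - m 1 ^ 2 := by linarith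
  simp [Fin.ext_iff]
  grind

theorem radialD_radialScalar (hM : 0 < M) (hx : x ∈ exterior M) {X : Fin 3 → Pt → ℝ}
    (hX : ∀ i, Smooth M (X i)) :
    radialD (radialScalar X) x = 2 * dot3 (position x) (fun j => X j x)
        + radius x * dot3 (position x) (fun j => radialD (X j) x) := by
  have hn := unitNormal_sq_sum hM hx
  have d1 : dr x 1 = unitNormal x 0 := rfl
  have d2 : dr x 2 = unitNormal x 1 := rfl
  have d3 : dr x 3 = unitNormal x 2 := rfl
  rw [radialD_eq]
  simp only [(hasGrad_radialScalar hM hX hx).pd_eq, radialD_eq, dot3, d1, d2, d3,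
    position_eq hM hx]
  generalize unitNormal x = m at *
  have h3 : m 2 ^ 2 = 1 - m 0 ^ 2 - m 1 ^ 2 := by linarith
  simp [Fin.ext_iff]
  grind

theorem pd_zero_radialScalar (hM : 0 < M) (hx : x ∈ exterior M) {X : Fin 3 → Pt → ℝ}
    (hX : ∀ i, Smooth M (X i)) :
    pd 0 (radialScalar X) x = radius x * dot3 (position x) (fun j => pd 0 (X j) x) := by
  rw [(hasGrad_radialScalar hM hX hx).pd_eq]
  simp [dot3]

theorem smooth_tangentialE (hM : 0 < M) {X : Fin 3 → Pt → ℝ} (hX : ∀ i, Smooth M (X i))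
    (i : Fin 3) : Smooth M (tangentialE X i) := by
  have hn := Smooth.unitNormal hM
  exact (Smooth.radius hM).mul ((hX i).sub ((((((hn 0).mul (hX 0)).add ((hn 1).mul (hX 1))).add
    ((hn 2).mul (hX 2)))).mul (hn i)))

theorem smooth_cross_position {X : Fin 3 → Pt → ℝ} (hX : ∀ i, Smooth M (X i)) (i : Fin 3) :
    Smooth M fun z => (position z ⨯₃ fun j => X j z) i := by
  have hy : ∀ i : Fin 3, Smooth M (fun z => position z i) := fun i => Smooth.coord _
  fin_cases i
  · exact ((hy 1).mul (hX 2)).sub ((hy 2).mul (hX 1))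
  · exact ((hy 2).mul (hX 0)).sub ((hy 0).mul (hX 2))
  · exact ((hy 0).mul (hX 1)).sub ((hy 1).mul (hX 0))

theorem rotDiv_congr {X Y : Fin 3 → Pt → ℝ} (h : ∀ i, ∀ z ∈ exterior M, X i z = Y i z)
    (hx : x ∈ exterior M) : rotDiv X x = rotDiv Y x := by
  simp only [rotDiv, rot_congr (h _) hx]

theorem rotDiv_radial_mul (hM : 0 < M) (hx : x ∈ exterior M) {φ : ℝ → ℝ} {φ' : ℝ}
    {X : Fin 3 → Pt → ℝ} (hφ : HasDerivAt φ φ' (radius x)) (hX : ∀ i, Smooth M (X i)) :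
    rotDiv (fun i z => φ (radius z) * X i z) x = φ (radius x) * rotDiv X x := by
  simp only [rotDiv, rot_radial_mul hM hx hφ (hX _)]
  ring

theorem MaxwellEB.time_tangentialE (hM : 0 < M) (h : MaxwellEB M E B) (hx : x ∈ exterior M)
    (i : Fin 3) : pd 0 (tangentialE E i) x
      = -(lapse M (radius x) * radialD (tangentialB M B i) x)
        + lapse M (radius x) / radius x ^ 2 * rot i (radialScalar B) x := by
  have gB := fun i => (hasGrad_tangentialB hM h.smooth_B hx i).pd_eq
  have ey : ∀ i : Fin 3, x i.succ = radius x * unitNormal x i := position_eq hM hx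
  have hn := unitNormal_sq_sum hM hx
  have hr := (radius_pos hM hx).ne'
  have hj := mul_inv_cancel₀ hr
  have d1 : dr x 1 = unitNormal x 0 := rfl
  have d2 : dr x 2 = unitNormal x 1 := rfl
  have d3 : dr x 3 = unitNormal x 2 := rfl
  rw [(hasGrad_tangentialE hM h.smooth_E hx i).pd_eq, radialD_eq]
  simp only [rot, gB, (hasGrad_radialScalar hM h.smooth_B hx).pd_eq, h.ampere x hx, curl3,
    radialD_eq]
  simp only [dot3, cross_apply, position_eq hM hx, ey, dr_zero, d1, d2, d3, dr_succ]
  generalize unitNormal x = m at *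
  generalize lapse M (radius x) = p at *
  have h3 : m 2 ^ 2 = 1 - m 0 ^ 2 - m 1 ^ 2 := by linarith
  fin_cases i <;> simp [Fin.ext_iff] <;> field_simp <;> grind

theorem MaxwellEB.time_tangentialB (hM : 0 < M) (h : MaxwellEB M E B) (hx : x ∈ exterior M)
    (i : Fin 3) : pd 0 (tangentialB M B i) x
      = -(lapse M (radius x) * radialD (tangentialE E i) x)
        - lapse M (radius x) / radius x ^ 2
          * (unitNormal x ⨯₃ fun j => rot j (radialScalar E) x) i := by
  have gE := fun i => (hasGrad_tangentialE hM h.smooth_E hx i).pd_eq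
  have ey : ∀ i : Fin 3, x i.succ = radius x * unitNormal x i := position_eq hM hx
  have hn := unitNormal_sq_sum hM hx
  have hr := (radius_pos hM hx).ne'
  have hj := mul_inv_cancel₀ hr
  have d1 : dr x 1 = unitNormal x 0 := rfl
  have d2 : dr x 2 = unitNormal x 1 := rfl
  have d3 : dr x 3 = unitNormal x 2 := rfl
  rw [(hasGrad_tangentialB hM h.smooth_B hx i).pd_eq, radialD_eq]
  simp only [rot, gE, (hasGrad_radialScalar hM h.smooth_E hx).pd_eq, h.faraday x hx, curl3]
  simp only [dot3, cross_apply, position_eq hM hx, ey, dr_zero, d1, d2, d3, dr_succ]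
  generalize unitNormal x = m at *
  generalize lapse M (radius x) = p at *
  have h3 : m 2 ^ 2 = 1 - m 0 ^ 2 - m 1 ^ 2 := by linarith
  fin_cases i <;> simp [Fin.ext_iff] <;> field_simp <;> grind

/-- The two divergence equations give the radial derivatives of the scalars, the radial parts of
Ampère's and Faraday's laws their time derivatives, and the tangential parts the evolution of `e`
and `b`. -/
theorem MaxwellEB.reducedSystem (hM : 0 < M) (h : MaxwellEB M E B) :
    ReducedSystem M (radialScalar E) (radialScalar B) (tangentialE E) (tangentialB M B) where
  smooth_D := radialScalar_smooth hM h.smooth_E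
  smooth_K := radialScalar_smooth hM h.smooth_B
  smooth_e := smooth_tangentialE hM h.smooth_E
  smooth_b i := (Smooth.lapse hM).mul (smooth_cross_position h.smooth_B i)
  normal_e x hx := by
    have hn := unitNormal_sq_sum hM hx
    simp only [tangentialE, dot3]
    linear_combination (-(radius x) * (unitNormal x 0 * E 0 x + unitNormal x 1 * E 1 x
      + unitNormal x 2 * E 2 x)) * hn
  normal_b x hx := by
    simp only [tangentialB, dot3, cross_apply, position_eq hM hx]
    simp
    ring
  time_D x hx := by
    have hL := hasDerivAt_lapse (M := M) (radius_pos hM hx).ne'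
    rw [pd_zero_radialScalar hM hx h.smooth_E, rotDiv_congr (M := M) (fun i z hz =>
      (crossN_tangentialB hM hz B i).trans (neg_mul _ _).symm) hx,
      rotDiv_radial_mul (φ := fun r => -lapse M r) hM hx hL.neg (smooth_tangentialE hM h.smooth_B),
      rotDiv_tangentialE hM hx h.smooth_B]
    simp only [h.ampere x hx, dot3, cross_apply, position_eq hM hx]
    simp
    ring
  radial_D x hx := by
    have hr := (radius_pos hM hx).ne'
    have h1 : 2 * M / radius x = 1 - lapse M (radius x) := (one_sub_lapse _ _).symm
    have h4 : 4 * M / radius x ^ 2 = 2 * (1 - lapse M (radius x)) / radius x := by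
      rw [← h1]; field_simp; ring
    rw [rotDiv_congr (M := M) (fun i z hz => crossN_tangentialE hM hz E i) hx,
      rotDiv_cross_position hM hx h.smooth_E, radialD_radialScalar hM hx h.smooth_E,
      h.gauss x hx, h4]
    simp only [dot3, position_eq hM hx]
    field_simp
    ring
  time_K x hx := by
    rw [pd_zero_radialScalar hM hx h.smooth_B, rotDiv_tangentialE hM hx h.smooth_E]
    simp only [h.faraday x hx]
  radial_K x hx := by
    have hL := hasDerivAt_lapse (M := M) (radius_pos hM hx).ne'
    have e : rotDiv (tangentialB M B) x = _ :=
      rotDiv_radial_mul hM hx hL (smooth_cross_position h.smooth_B)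
    rw [e, rotDiv_cross_position hM hx h.smooth_B, radialD_radialScalar hM hx h.smooth_B,
      h.div_magn x hx]
    ring
  time_e x hx i := h.time_tangentialE hM hx i
  time_b x hx i := h.time_tangentialB hM hx i

end Reduction

/-! ### Local balance laws -/

section Leibniz

variable {M : ℝ} {x : Pt} {u v : Pt → ℝ}

theorem pd_mul (hu : Smooth M u) (hv : Smooth M v) (hx : x ∈ exterior M) (a : Fin 4) :
    pd a (fun z => u z * v z) x = pd a u x * v x + u x * pd a v x :=
  ((hu.hasGrad hx).mul (hv.hasGrad hx)).pd_eq a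

theorem pd_add (hu : Smooth M u) (hv : Smooth M v) (hx : x ∈ exterior M) (a : Fin 4) :
    pd a (fun z => u z + v z) x = pd a u x + pd a v x :=
  ((hu.hasGrad hx).add (hv.hasGrad hx)).pd_eq a

theorem pd_sub (hu : Smooth M u) (hv : Smooth M v) (hx : x ∈ exterior M) (a : Fin 4) :
    pd a (fun z => u z - v z) x = pd a u x - pd a v x :=
  ((hu.hasGrad hx).sub (hv.hasGrad hx)).pd_eq a

theorem radialD_mul (hu : Smooth M u) (hv : Smooth M v) (hx : x ∈ exterior M) :
    radialD (fun z => u z * v z) x = radialD u x * v x + u x * radialD v x := by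
  simp only [radialD_eq, pd_mul hu hv hx]; ring

theorem radialD_add (hu : Smooth M u) (hv : Smooth M v) (hx : x ∈ exterior M) :
    radialD (fun z => u z + v z) x = radialD u x + radialD v x := by
  simp only [radialD_eq, pd_add hu hv hx]; ring

theorem radialD_sub (hu : Smooth M u) (hv : Smooth M v) (hx : x ∈ exterior M) :
    radialD (fun z => u z - v z) x = radialD u x - radialD v x := by
  simp only [radialD_eq, pd_sub hu hv hx]; ring

theorem rot_mul (hu : Smooth M u) (hv : Smooth M v) (hx : x ∈ exterior M) (i : Fin 3) :
    rot i (fun z => u z * v z) x = rot i u x * v x + u x * rot i v x := by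
  simp only [rot, pd_mul hu hv hx]; ring

theorem rot_add (hu : Smooth M u) (hv : Smooth M v) (hx : x ∈ exterior M) (i : Fin 3) :
    rot i (fun z => u z + v z) x = rot i u x + rot i v x := by
  simp only [rot, pd_add hu hv hx]; ring

theorem rot_sub (hu : Smooth M u) (hv : Smooth M v) (hx : x ∈ exterior M) (i : Fin 3) :
    rot i (fun z => u z - v z) x = rot i u x - rot i v x := by
  simp only [rot, pd_sub hu hv hx]; ring

theorem radialD_neg (u : Pt → ℝ) (x : Pt) : radialD (fun z => -u z) x = -radialD u x := by
  have : ∀ a, pd a (fun z => -u z) x = -pd a u x := fun a => by rw [pd, fderiv_fun_neg]; rfl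
  simp only [radialD_eq, this]; ring

/-- A smooth function of the radius with derivative `φ'`. -/
structure RadialWeight (M : ℝ) (φ φ' : ℝ → ℝ) : Prop where
  smooth : Smooth M fun z => φ (radius z)
  smooth_deriv : Smooth M fun z => φ' (radius z)
  deriv : ∀ r, 2 * M < r → HasDerivAt φ (φ' r) r

namespace RadialWeight

variable {φ φ' ψ ψ' : ℝ → ℝ}

theorem pd_zero (h : RadialWeight M φ φ') (hM : 0 < M) (hx : x ∈ exterior M) :
    pd 0 (fun z => φ (radius z)) x = 0 := by
  rw [(HasGrad.comp (h.deriv _ hx) (HasGrad.radius hM hx)).pd_eq, dr_zero, mul_zero]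

theorem rot (h : RadialWeight M φ φ') (hM : 0 < M) (hx : x ∈ exterior M) (i : Fin 3) :
    rot i (fun z => φ (radius z)) x = 0 := by
  simp only [Schwarzschild.rot, (HasGrad.comp (h.deriv _ hx) (HasGrad.radius hM hx)).pd_eq, dr_succ,
    unitNormal_apply]
  ring

theorem radialD (h : RadialWeight M φ φ') (hM : 0 < M) (hx : x ∈ exterior M) :
    radialD (fun z => φ (radius z)) x = φ' (radius x) := by
  have hn := unitNormal_sq_sum hM hx
  have d1 : dr x 1 = unitNormal x 0 := rfl
  have d2 : dr x 2 = unitNormal x 1 := rfl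
  have d3 : dr x 3 = unitNormal x 2 := rfl
  simp only [radialD_eq, (HasGrad.comp (h.deriv _ hx) (HasGrad.radius hM hx)).pd_eq, d1, d2, d3]
  linear_combination (φ' (radius x)) * hn

theorem mul (h : RadialWeight M φ φ') (k : RadialWeight M ψ ψ') :
    RadialWeight M (fun r => φ r * ψ r) (fun r => φ' r * ψ r + φ r * ψ' r) where
  smooth := h.smooth.mul k.smooth
  smooth_deriv := (h.smooth_deriv.mul k.smooth).add (h.smooth.mul k.smooth_deriv)
  deriv r hr := (h.deriv r hr).mul (k.deriv r hr)

theorem add (h : RadialWeight M φ φ') (k : RadialWeight M ψ ψ') :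
    RadialWeight M (fun r => φ r + ψ r) (fun r => φ' r + ψ' r) where
  smooth := h.smooth.add k.smooth
  smooth_deriv := h.smooth_deriv.add k.smooth_deriv
  deriv r hr := (h.deriv r hr).add (k.deriv r hr)

theorem const (c : ℝ) : RadialWeight M (fun _ => c) (fun _ => 0) where
  smooth := Smooth.const c
  smooth_deriv := Smooth.const 0
  deriv r _ := hasDerivAt_const r c

theorem inv_radius (hM : 0 < M) : RadialWeight M (fun r => r⁻¹) (fun r => -(r⁻¹ * r⁻¹)) where
  smooth := (Smooth.radius hM).inv fun _ hx => (radius_pos hM hx).ne'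
  smooth_deriv := by
    have := (Smooth.radius hM).inv fun _ hx => (radius_pos hM hx).ne'
    exact (this.mul this).neg
  deriv r hr := by
    have h0 : r ≠ 0 := by linarith
    refine (hasDerivAt_inv h0).congr_deriv ?_
    field_simp

theorem congr (h : RadialWeight M φ φ') (h1 : ∀ r, 2 * M < r → ψ r = φ r)
    (h2 : ∀ r, 2 * M < r → ψ' r = φ' r) : RadialWeight M ψ ψ' where
  smooth := h.smooth.congr fun _ hx => h1 _ hx
  smooth_deriv := h.smooth_deriv.congr fun _ hx => h2 _ hx
  deriv r hr := by
    rw [h2 r hr]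
    refine (h.deriv r hr).congr_of_eventuallyEq ?_
    filter_upwards [isOpen_Ioi.mem_nhds hr] with s hs using h1 s hs

theorem lapse (hM : 0 < M) : RadialWeight M (lapse M) (fun r => 2 * M / r ^ 2) :=
  ((RadialWeight.const 1).add ((RadialWeight.const (-(2 * M))).mul (inv_radius hM))).congr
    (fun r hr => by rw [Schwarzschild.lapse]; ring) fun r hr => by
      have h0 : r ≠ 0 := by linarith
      field_simp
      ring

end RadialWeight

end Leibniz

/-- A balance law `∂_t p = ∂_r w + s` up to rotation derivatives. -/
structure LocalLaw (M : ℝ) (p w s : Pt → ℝ) : Prop where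
  smooth_density : Smooth M p
  smooth_flux : Smooth M w
  smooth_source : Smooth M s
  exists_angular : ∃ z : Fin 3 → Pt → ℝ, (∀ i, Smooth M (z i)) ∧
    ∀ x ∈ exterior M, pd 0 p x = radialD w x + s x + rotDiv z x

namespace LocalLaw

variable {M : ℝ} {p w s p' w' s' : Pt → ℝ}

theorem add (h : LocalLaw M p w s) (k : LocalLaw M p' w' s') :
    LocalLaw M (fun x => p x + p' x) (fun x => w x + w' x) (fun x => s x + s' x) := by
  obtain ⟨z, hz, hl⟩ := h.exists_angular
  obtain ⟨y, hy, kl⟩ := k.exists_angular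
  refine ⟨h.1.add k.1, h.2.add k.2, h.3.add k.3, fun i x => z i x + y i x,
    fun i => (hz i).add (hy i), fun x hx => ?_⟩
  rw [pd_add h.1 k.1 hx, radialD_add h.2 k.2 hx, hl x hx, kl x hx]
  simp only [rotDiv, rot_add (hz _) (hy _) hx]
  ring

theorem congr (h : LocalLaw M p w s) (hp : ∀ x ∈ exterior M, p' x = p x)
    (hw : ∀ x ∈ exterior M, w' x = w x) (hs : ∀ x ∈ exterior M, s' x = s x) :
    LocalLaw M p' w' s' := by
  obtain ⟨z, hz, hl⟩ := h.exists_angular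
  refine ⟨h.1.congr hp, h.2.congr hw, h.3.congr hs, z, hz, fun x hx => ?_⟩
  rw [pd_congr hp hx, radialD_congr hw hx, hs x hx, hl x hx]

/-- A radial weight commutes with time and rotation derivatives; only ∂_r sees it, which creates the
source -φ' w. -/
theorem radial_mul (hM : 0 < M) {φ φ' : ℝ → ℝ} (hφ : RadialWeight M φ φ') (h : LocalLaw M p w s) :
    LocalLaw M (fun x => φ (radius x) * p x) (fun x => φ (radius x) * w x)
      (fun x => φ (radius x) * s x - φ' (radius x) * w x) := by
  obtain ⟨z, hz, hl⟩ := h.exists_angular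
  refine ⟨hφ.smooth.mul h.1, hφ.smooth.mul h.2, (hφ.smooth.mul h.3).sub (hφ.smooth_deriv.mul h.2),
    fun i x => φ (radius x) * z i x, fun i => hφ.smooth.mul (hz i), fun x hx => ?_⟩
  simp only [rotDiv]
  rw [pd_mul hφ.smooth h.1 hx, hφ.pd_zero hM hx, radialD_mul hφ.smooth h.2 hx, hφ.radialD hM hx,
    rot_mul hφ.smooth (hz 0) hx, rot_mul hφ.smooth (hz 1) hx, rot_mul hφ.smooth (hz 2) hx,
    hφ.rot hM hx, hφ.rot hM hx, hφ.rot hM hx, hl x hx, rotDiv]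
  ring

/-- The trivial law with vanishing density. -/
theorem of_flux (hM : 0 < M) (hw : Smooth M w) :
    LocalLaw M (fun _ => 0) w (fun x => -radialD w x) := by
  have h0 : Smooth M fun _ => (0 : ℝ) := Smooth.const 0
  refine ⟨h0, hw, (hw.radialD hM).neg, fun _ _ => 0, fun _ => h0, fun x _ => ?_⟩
  have : ∀ a, pd a (fun _ => (0 : ℝ)) x = 0 := fun a => (HasGrad.const 0).pd_eq a
  simp [rotDiv, rot, this]

theorem sphereAvg_rotDiv (hM : 0 < M) {z : Fin 3 → Pt → ℝ} (hz : ∀ i, Smooth M (z i)) {t r : ℝ}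
    (hr : 2 * M < r) : sphereAvg (rotDiv z) t r = 0 := by
  have e : sphereAvg (rotDiv z) t r = _ :=
    sphereAvg_add hM hr (((hz 0).rot 0).add ((hz 1).rot 1)) ((hz 2).rot 2)
  rw [e, sphereAvg_add hM hr ((hz 0).rot 0) ((hz 1).rot 1), sphereAvg_rot hM (hz 0) hr,
    sphereAvg_rot hM (hz 1) hr, sphereAvg_rot hM (hz 2) hr]
  ring

/-- The angular terms are rotation derivatives and vanish after integration over the sphere. -/
theorem balanceLaw (hM : 0 < M) (h : LocalLaw M p w s) :
    BalanceLaw (2 * M) (sphereAvg p) (sphereAvg w) (sphereAvg s) := by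
  refine ⟨continuousOn_sphereAvg hM h.1.continuousOn, continuousOn_sphereAvg hM h.2.continuousOn,
    continuousOn_sphereAvg hM h.3.continuousOn, sphereAvg (radialD w),
    continuousOn_sphereAvg hM (h.2.radialD hM).continuousOn,
    fun t r hr => hasDerivAt_sphereAvg_radius hM h.2 hr, fun t r hr => ?_⟩
  obtain ⟨z, hz, hl⟩ := h.exists_angular
  refine (hasDerivAt_sphereAvg_time hM h.1 hr).congr_deriv ?_
  have hzs : Smooth M (rotDiv z) := (((hz 0).rot 0).add ((hz 1).rot 1)).add ((hz 2).rot 2)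
  rw [sphereAvg_congr hM hr hl, sphereAvg_add hM hr ((h.2.radialD hM).add h.3) hzs,
    sphereAvg_add hM hr (h.2.radialD hM) h.3, sphereAvg_rotDiv hM hz hr, add_zero]

end LocalLaw

/-! ### Transport pairs -/

/-- A scalar `u` with vector potentials `X`, `Y` for its time and radial derivatives. -/
structure TransportPair (M : ℝ) (u : Pt → ℝ) (X Y : Fin 3 → Pt → ℝ) : Prop where
  smooth : Smooth M u
  smooth_X : ∀ i, Smooth M (X i)
  smooth_Y : ∀ i, Smooth M (Y i)
  time : ∀ x ∈ exterior M, pd 0 u x = rotDiv X x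
  radial : ∀ x ∈ exterior M, lapse M (radius x) * radialD u x = -rotDiv Y x
  time_X : ∀ x ∈ exterior M, ∀ i, pd 0 (X i) x = -(lapse M (radius x) * radialD (Y i) x)
    + lapse M (radius x) / radius x ^ 2 * rot i u x

section Transport

variable {M : ℝ} {x : Pt} {u D K : Pt → ℝ} {X Y e b : Fin 3 → Pt → ℝ}

theorem dot3_unitNormal_rot (hM : 0 < M) (hx : x ∈ exterior M) (u : Pt → ℝ) :
    dot3 (unitNormal x) (fun i => rot i u x) = 0 := by
  have ey : ∀ i : Fin 3, x i.succ = radius x * unitNormal x i := position_eq hM hx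
  simp only [dot3, rot, ey]
  simp
  ring

theorem Smooth.crossN (hM : 0 < M) (hX : ∀ i, Smooth M (X i)) (i : Fin 3) :
    Smooth M (crossN X i) := by
  have hn := Smooth.unitNormal hM
  fin_cases i
  · exact ((hn 1).mul (hX 2)).sub ((hn 2).mul (hX 1))
  · exact ((hn 2).mul (hX 0)).sub ((hn 0).mul (hX 2))
  · exact ((hn 0).mul (hX 1)).sub ((hn 1).mul (hX 0))

theorem pd_zero_unitNormal (hM : 0 < M) (hx : x ∈ exterior M) (i : Fin 3) :
    pd 0 (fun z => unitNormal z i) x = 0 := by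
  rw [(hasGrad_unitNormal hM hx i).pd_eq]
  simp [(Fin.succ_ne_zero i).symm]

theorem radialD_unitNormal (hM : 0 < M) (hx : x ∈ exterior M) (i : Fin 3) :
    radialD (fun z => unitNormal z i) x = 0 := by
  have hn := unitNormal_sq_sum hM hx
  have d1 : dr x 1 = unitNormal x 0 := rfl
  have d2 : dr x 2 = unitNormal x 1 := rfl
  have d3 : dr x 3 = unitNormal x 2 := rfl
  rw [radialD_eq]
  simp only [(hasGrad_unitNormal hM hx i).pd_eq, d1, d2, d3]
  have h3 : unitNormal x 2 ^ 2 = 1 - unitNormal x 0 ^ 2 - unitNormal x 1 ^ 2 := by linarith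
  fin_cases i <;> simp [Fin.ext_iff] <;> grind

theorem pd_zero_crossN (hM : 0 < M) (hX : ∀ i, Smooth M (X i)) (hx : x ∈ exterior M)
    (i : Fin 3) : pd 0 (crossN X i) x = (unitNormal x ⨯₃ fun j => pd 0 (X j) x) i := by
  have hn := Smooth.unitNormal hM
  have h : ∀ j k : Fin 3, pd 0 (fun z => unitNormal z j * X k z) x
      = unitNormal x j * pd 0 (X k) x := fun j k => by
    rw [pd_mul (hn j) (hX k) hx, pd_zero_unitNormal hM hx]; ring
  have hs : ∀ j k l m : Fin 3, pd 0 (fun z => unitNormal z j * X k z - unitNormal z l * X m z) x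
      = unitNormal x j * pd 0 (X k) x - unitNormal x l * pd 0 (X m) x := fun j k l m => by
    rw [pd_sub ((hn j).mul (hX k)) ((hn l).mul (hX m)) hx, h, h]
  fin_cases i
  · exact hs 1 2 2 1
  · exact hs 2 0 0 2
  · exact hs 0 1 1 0

theorem radialD_crossN (hM : 0 < M) (hX : ∀ i, Smooth M (X i)) (hx : x ∈ exterior M)
    (i : Fin 3) : radialD (crossN X i) x = (unitNormal x ⨯₃ fun j => radialD (X j) x) i := by
  have hn := Smooth.unitNormal hM
  have h : ∀ j k : Fin 3, radialD (fun z => unitNormal z j * X k z) x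
      = unitNormal x j * radialD (X k) x := fun j k => by
    rw [radialD_mul (hn j) (hX k) hx, radialD_unitNormal hM hx]; ring
  have hs : ∀ j k l m : Fin 3, radialD (fun z => unitNormal z j * X k z - unitNormal z l * X m z) x
      = unitNormal x j * radialD (X k) x - unitNormal x l * radialD (X m) x := fun j k l m => by
    rw [radialD_sub ((hn j).mul (hX k)) ((hn l).mul (hX m)) hx, h, h]
  fin_cases i
  · exact hs 1 2 2 1
  · exact hs 2 0 0 2
  · exact hs 0 1 1 0

theorem ReducedSystem.pair_K (h : ReducedSystem M D K e b) : TransportPair M K e b :=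
  ⟨h.smooth_K, h.smooth_e, h.smooth_b, h.time_K, h.radial_K, h.time_e⟩

/-- Electromagnetic duality: the right-angle rotation `crossN` exchanges the roles of the two
fields. Its square is -1 on tangential vectors, and the rotation derivatives of `D` form such a
vector. -/
theorem ReducedSystem.pair_D (hM : 0 < M) (h : ReducedSystem M D K e b) :
    TransportPair M D (crossN b) (crossN e) := by
  refine ⟨h.smooth_D, Smooth.crossN hM h.smooth_b, Smooth.crossN hM h.smooth_e, h.time_D,
    h.radial_D, fun x hx i => ?_⟩
  rw [pd_zero_crossN hM h.smooth_b hx, radialD_crossN hM h.smooth_e hx]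
  simp only [h.time_b x hx]
  have h0 := dot3_unitNormal_rot hM hx D
  have hn := unitNormal_sq_sum hM hx
  simp only [dot3, cross_apply] at h0 ⊢
  generalize unitNormal x = m at *
  have h3 : m 2 ^ 2 = 1 - m 0 ^ 2 - m 1 ^ 2 := by linarith
  generalize lapse M (radius x) / radius x ^ 2 = V at *
  fin_cases i <;> simp <;> grind

namespace TransportPair

/-- The wave equation satisfied by the scalar of a transport pair. -/
theorem wave (hM : 0 < M) (h : TransportPair M u X Y) (hx : x ∈ exterior M) :
    pd 0 (pd 0 u) x
      = lapse M (radius x) * radialD (fun z => lapse M (radius z) * radialD u z) x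
        + lapse M (radius x) / radius x ^ 2 * (rot 0 (rot 0 u) x + rot 1 (rot 1 u) x
          + rot 2 (rot 2 u) x) := by
  have hX := h.smooth_X
  have hY := h.smooth_Y
  have hL := RadialWeight.lapse hM
  have hV : RadialWeight M (fun r => lapse M r * (r⁻¹ * r⁻¹)) _ :=
    hL.mul ((RadialWeight.inv_radius hM).mul (RadialWeight.inv_radius hM))
  have e1 : pd 0 (pd 0 u) x = pd 0 (rotDiv X) x := pd_congr h.time hx 0
  have e2 : pd 0 (rotDiv X) x = rot 0 (pd 0 (X 0)) x + rot 1 (pd 0 (X 1)) x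
      + rot 2 (pd 0 (X 2)) x := by
    have : pd 0 (rotDiv X) x = _ :=
      pd_add (((hX 0).rot 0).add ((hX 1).rot 1)) ((hX 2).rot 2) hx 0
    rw [this, pd_add ((hX 0).rot 0) ((hX 1).rot 1) hx, pd_zero_rot (hX 0) hx,
      pd_zero_rot (hX 1) hx, pd_zero_rot (hX 2) hx]
  have e3 : ∀ i, rot i (pd 0 (X i)) x = -(lapse M (radius x) * rot i (radialD (Y i)) x)
      + lapse M (radius x) / radius x ^ 2 * rot i (rot i u) x := by
    intro i
    have hs1 := hL.smooth.mul ((hY i).radialD hM)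
    have hs2 := hV.smooth.mul (h.smooth.rot i)
    rw [rot_congr (v := fun z => lapse M (radius z) * ((radius z)⁻¹ * (radius z)⁻¹) * rot i u z
      - lapse M (radius z) * radialD (Y i) z) (fun z hz => ?_) hx i, rot_sub hs2 hs1 hx,
      rot_mul hV.smooth (h.smooth.rot i) hx, rot_mul hL.smooth ((hY i).radialD hM) hx,
      hV.rot hM hx, hL.rot hM hx]
    · field_simp; ring
    · rw [h.time_X z hz i]; field_simp; ring
  have e4 : radialD (fun z => lapse M (radius z) * radialD u z) x
      = -(rot 0 (radialD (Y 0)) x + rot 1 (radialD (Y 1)) x + rot 2 (radialD (Y 2)) x) := by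
    rw [radialD_congr h.radial hx, radialD_neg]
    have : radialD (rotDiv Y) x = _ :=
      radialD_add (((hY 0).rot 0).add ((hY 1).rot 1)) ((hY 2).rot 2) hx
    rw [this, radialD_add ((hY 0).rot 0) ((hY 1).rot 1) hx, radialD_rot hM (hY 0) hx,
      radialD_rot hM (hY 1) hx, radialD_rot hM (hY 2) hx]
  rw [e1, e2, e3, e3, e3, e4]
  ring

end TransportPair

end Transport

/-! ### Energy, momentum, potential and product identities -/

section LocalLaws

variable {M : ℝ} {x : Pt} {p w s u D K : Pt → ℝ} {X Y e b : Fin 3 → Pt → ℝ}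

theorem radialWeight_inv_lapse (hM : 0 < M) :
    RadialWeight M (fun r => (lapse M r)⁻¹) (fun r => -(2 * M / r ^ 2) / lapse M r ^ 2) where
  smooth := (RadialWeight.lapse hM).smooth.inv fun _ hx => (lapse_pos hM hx).ne'
  smooth_deriv := by
    have h := (RadialWeight.lapse hM)
    refine ((h.smooth_deriv.neg).div (h.smooth.mul h.smooth) fun _ hx =>
      (mul_pos (lapse_pos hM hx) (lapse_pos hM hx)).ne').congr fun _ _ => by ring
  deriv r hr := ((RadialWeight.lapse hM).deriv r hr).inv (lapse_pos hM hr).ne'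

/-- The coefficient `f / r²` of the angular operator. -/
theorem radialWeight_angular (hM : 0 < M) : RadialWeight M (fun r => lapse M r / r ^ 2)
    (fun r => 2 * M / r ^ 2 * (r⁻¹ * r⁻¹)
      + lapse M r * (-(r⁻¹ * r⁻¹) * r⁻¹ + r⁻¹ * -(r⁻¹ * r⁻¹))) :=
  ((RadialWeight.lapse hM).mul
    ((RadialWeight.inv_radius hM).mul (RadialWeight.inv_radius hM))).congr
    (fun r hr => by field_simp) fun r hr => rfl

/-- The identities close in the tortoise derivative f ∂_r. Division by f, which depends on the
radius alone, brings them to the form of `LocalLaw`. -/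
theorem LocalLaw.of_lapse_mul (hM : 0 < M) (hp : Smooth M p) (hw : Smooth M w) (hs : Smooth M s)
    {z : Fin 3 → Pt → ℝ} (hz : ∀ i, Smooth M (z i))
    (h : ∀ x ∈ exterior M, pd 0 p x = lapse M (radius x) * radialD w x + s x + rotDiv z x) :
    LocalLaw M (fun x => (lapse M (radius x))⁻¹ * p x) w
      (fun x => (lapse M (radius x))⁻¹ * s x) := by
  have hI := radialWeight_inv_lapse hM
  refine ⟨hI.smooth.mul hp, hw, hI.smooth.mul hs, fun i x => (lapse M (radius x))⁻¹ * z i x,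
    fun i => hI.smooth.mul (hz i), fun x hx => ?_⟩
  have hl := (lapse_pos hM hx).ne'
  simp only [rotDiv]
  rw [pd_mul hI.smooth hp hx, hI.pd_zero hM hx, rot_mul hI.smooth (hz 0) hx,
    rot_mul hI.smooth (hz 1) hx, rot_mul hI.smooth (hz 2) hx, hI.rot hM hx, hI.rot hM hx,
    hI.rot hM hx, h x hx, rotDiv]
  field_simp
  ring

theorem rotNormSq_eq_sum (u : Pt → ℝ) : rotNormSq u = fun x => rot 0 u x * rot 0 u x
    + rot 1 u x * rot 1 u x + rot 2 u x * rot 2 u x := by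
  funext x
  simp only [rotNormSq]
  ring

theorem Smooth.rotNormSq (hu : Smooth M u) : Smooth M (rotNormSq u) := by
  rw [rotNormSq_eq_sum]
  exact (((hu.rot 0).mul (hu.rot 0)).add ((hu.rot 1).mul (hu.rot 1))).add
    ((hu.rot 2).mul (hu.rot 2))

/-- The derivative along `∂_{r_*}`. -/
def tortoiseD (M : ℝ) (u : Pt → ℝ) (x : Pt) : ℝ := lapse M (radius x) * radialD u x

theorem Smooth.tortoiseD (hM : 0 < M) (hu : Smooth M u) : Smooth M (tortoiseD M u) :=
  (Smooth.lapse hM).mul (hu.radialD hM)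

theorem pd_zero_tortoiseD (hM : 0 < M) (hu : Smooth M u) (hx : x ∈ exterior M) :
    pd 0 (tortoiseD M u) x = lapse M (radius x) * radialD (pd 0 u) x := by
  have e : pd 0 (tortoiseD M u) x = _ := pd_mul (Smooth.lapse hM) (hu.radialD hM) hx 0
  rw [e, (RadialWeight.lapse hM).pd_zero hM hx, pd_zero_radialD hM hu hx]
  ring

theorem lapse_mul_radialD_rot (hM : 0 < M) (hu : Smooth M u) (hx : x ∈ exterior M) (i : Fin 3) :
    lapse M (radius x) * radialD (rot i u) x = rot i (tortoiseD M u) x := by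
  have e : rot i (tortoiseD M u) x = _ := rot_mul (Smooth.lapse hM) (hu.radialD hM) hx i
  rw [e, (RadialWeight.lapse hM).rot hM hx, radialD_rot hM hu hx]
  ring

theorem smooth_dot3 (hX : ∀ i, Smooth M (X i)) (hY : ∀ i, Smooth M (Y i)) :
    Smooth M fun z => dot3 (fun i => X i z) (fun i => Y i z) :=
  (((hX 0).mul (hY 0)).add ((hX 1).mul (hY 1))).add ((hX 2).mul (hY 2))

theorem pd_dot3 (hX : ∀ i, Smooth M (X i)) (hY : ∀ i, Smooth M (Y i)) (hx : x ∈ exterior M)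
    (a : Fin 4) : pd a (fun z => dot3 (fun i => X i z) (fun i => Y i z)) x
      = dot3 (fun i => pd a (X i) x) (fun i => Y i x)
        + dot3 (fun i => X i x) (fun i => pd a (Y i) x) :=
  (hasGrad_dot3 (fun i => (hX i).hasGrad hx) fun i => (hY i).hasGrad hx).pd_eq a

theorem radialD_dot3 (hX : ∀ i, Smooth M (X i)) (hY : ∀ i, Smooth M (Y i)) (hx : x ∈ exterior M) :
    radialD (fun z => dot3 (fun i => X i z) (fun i => Y i z)) x
      = dot3 (fun i => radialD (X i) x) (fun i => Y i x)
        + dot3 (fun i => X i x) (fun i => radialD (Y i) x) := by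
  simp only [radialD_eq, pd_dot3 hX hY hx]
  simp only [dot3]
  ring

theorem rotNormSq_eq_dot3 (u : Pt → ℝ) :
    rotNormSq u = fun z => dot3 (fun i => rot i u z) (fun i => rot i u z) := by
  funext x
  simp only [rotNormSq, dot3]
  ring

namespace TransportPair

theorem pd_zero_pd_zero (hM : 0 < M) (h : TransportPair M u X Y) (hx : x ∈ exterior M) :
    pd 0 (pd 0 u) x = lapse M (radius x) * radialD (tortoiseD M u) x
        + lapse M (radius x) / radius x ^ 2 * (rot 0 (rot 0 u) x + rot 1 (rot 1 u) x
          + rot 2 (rot 2 u) x) := h.wave hM hx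

/-- The wave equation multiplied by ∂_t u. -/
theorem energy_law (hM : 0 < M) (h : TransportPair M u X Y) :
    LocalLaw M (fun x => (lapse M (radius x))⁻¹ * (1 / 2 * (pd 0 u x * pd 0 u x
        + tortoiseD M u x * tortoiseD M u x + lapse M (radius x) / radius x ^ 2 * rotNormSq u x)))
      (fun x => pd 0 u x * tortoiseD M u x) (fun _ => 0) := by
  have hu := h.smooth
  have hv := hu.pd 0
  have hq := hu.tortoiseD hM
  have hV := radialWeight_angular hM
  have ho := fun i => hu.rot i
  have c := Smooth.const (M := M) (1 / 2)
  refine (LocalLaw.of_lapse_mul hM (c.mul (((hv.mul hv).add (hq.mul hq)).add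
    (hV.smooth.mul hu.rotNormSq))) (hv.mul hq) (Smooth.const 0)
    (z := fun i x => lapse M (radius x) / radius x ^ 2 * (pd 0 u x * rot i u x))
    (fun i => hV.smooth.mul (hv.mul (ho i))) fun x hx => ?_).congr (fun _ _ => rfl)
      (fun _ _ => rfl) fun _ _ => by ring
  have ec : pd 0 (fun _ => (1 / 2 : ℝ)) x = 0 := (HasGrad.const _).pd_eq 0
  rw [pd_mul c (((hv.mul hv).add (hq.mul hq)).add (hV.smooth.mul hu.rotNormSq)) hx, ec,
    pd_add ((hv.mul hv).add (hq.mul hq)) (hV.smooth.mul hu.rotNormSq) hx,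
    pd_add (hv.mul hv) (hq.mul hq) hx, pd_mul hv hv hx, pd_mul hq hq hx,
    pd_mul hV.smooth hu.rotNormSq hx, hV.pd_zero hM hx, radialD_mul hv hq hx,
    h.pd_zero_pd_zero hM hx, pd_zero_tortoiseD hM hu hx, rotNormSq_eq_dot3, pd_dot3 ho ho hx]
  simp only [rotDiv, rot_mul hV.smooth (hv.mul (ho _)) hx, hV.rot hM hx, rot_mul hv (ho _) hx,
    pd_zero_rot hu hx, dot3]
  ring

/-- The wave equation multiplied by ∂_{r*} u. The radial derivative of the angular gradient stays in
the source; `LocalLaw.of_flux` removes it once a weight has been chosen. -/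
theorem momentum_law (hM : 0 < M) (h : TransportPair M u X Y) :
    LocalLaw M (fun x => (lapse M (radius x))⁻¹ * (pd 0 u x * tortoiseD M u x))
      (fun x => 1 / 2 * (pd 0 u x * pd 0 u x + tortoiseD M u x * tortoiseD M u x))
      (fun x => -(1 / 2 * (lapse M (radius x) / radius x ^ 2) * radialD (rotNormSq u) x)) := by
  have hu := h.smooth
  have hv := hu.pd 0
  have hq := hu.tortoiseD hM
  have hV := radialWeight_angular hM
  have hL := RadialWeight.lapse hM
  have ho := fun i => hu.rot i
  have c := Smooth.const (M := M) (1 / 2)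
  refine (LocalLaw.of_lapse_mul hM (hv.mul hq) (c.mul ((hv.mul hv).add (hq.mul hq)))
    ((hL.smooth.mul ((c.mul hV.smooth).mul (hu.rotNormSq.radialD hM))).neg)
    (z := fun i x => lapse M (radius x) / radius x ^ 2 * (tortoiseD M u x * rot i u x))
    (fun i => hV.smooth.mul (hq.mul (ho i))) fun x hx => ?_).congr (fun _ _ => rfl)
      (fun _ _ => rfl) fun x hx => ?_
  · have ec : radialD (fun _ => (1 / 2 : ℝ)) x = 0 := by
      have : ∀ a, pd a (fun _ => (1 / 2 : ℝ)) x = 0 := fun a => (HasGrad.const _).pd_eq a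
      simp only [radialD_eq, this]
      ring
    rw [pd_mul hv hq hx, h.pd_zero_pd_zero hM hx, pd_zero_tortoiseD hM hu hx,
      radialD_mul c ((hv.mul hv).add (hq.mul hq)) hx, ec, radialD_add (hv.mul hv) (hq.mul hq) hx,
      radialD_mul hv hv hx, radialD_mul hq hq hx, rotNormSq_eq_dot3, radialD_dot3 ho ho hx]
    simp only [rotDiv, rot_mul hV.smooth (hq.mul (ho _)) hx, hV.rot hM hx, rot_mul hq (ho _) hx,
      dot3, ← lapse_mul_radialD_rot hM hu hx]
    ring
  · have hl := (lapse_pos hM hx).ne'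
    field_simp

/-- The source is minus the Lagrangian, divided by f. The usual density u u_t is replaced by the
pairing of the angular gradient with `X`. This is possible because u_t and u_{r*} are, up to sign,
angular divergences of `X` and `Y`, and it keeps the undifferentiated u out of all currents. -/
theorem potential_law (hM : 0 < M) (h : TransportPair M u X Y) :
    LocalLaw M (fun x => (lapse M (radius x))⁻¹ * dot3 (fun i => rot i u x) (fun i => X i x))
      (fun x => -dot3 (fun i => rot i u x) (fun i => Y i x))
      (fun x => -((lapse M (radius x))⁻¹ * (pd 0 u x * pd 0 u x - tortoiseD M u x * tortoiseD M u x
        - lapse M (radius x) / radius x ^ 2 * rotNormSq u x))) := by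
  have hu := h.smooth
  have hv := hu.pd 0
  have hq := hu.tortoiseD hM
  have hV := radialWeight_angular hM
  have hL := RadialWeight.lapse hM
  have ho := fun i => hu.rot i
  have hX := h.smooth_X
  have hY := h.smooth_Y
  refine (LocalLaw.of_lapse_mul hM (smooth_dot3 ho hX) (smooth_dot3 ho hY).neg
    (((hv.mul hv).sub (hq.mul hq)).sub (hV.smooth.mul hu.rotNormSq)).neg
    (z := fun i x => pd 0 u x * X i x + tortoiseD M u x * Y i x)
    (fun i => (hv.mul (hX i)).add (hq.mul (hY i))) fun x hx => ?_).congr (fun _ _ => rfl)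
      (fun _ _ => rfl) fun x hx => by ring
  have et := h.time x hx
  have er : tortoiseD M u x = -rotDiv Y x := h.radial x hx
  rw [pd_dot3 ho hX hx, radialD_neg, radialD_dot3 ho hY hx, rotNormSq_eq_dot3]
  simp only [rotDiv, rot_add (hv.mul (hX _)) (hq.mul (hY _)) hx, rot_mul hv (hX _) hx,
    rot_mul hq (hY _) hx, pd_zero_rot hu hx, dot3, h.time_X x hx,
    ← lapse_mul_radialD_rot hM hu hx] at et er ⊢
  linear_combination (pd 0 u x) * et - tortoiseD M u x * er

end TransportPair

/-- Its source is the radial pairing, the term that a weighted `potential_law` produces. A matching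
weight cancels it and leaves only squares of the fields. -/
theorem ReducedSystem.product_law (hM : 0 < M) (h : ReducedSystem M D K e b) :
    LocalLaw M (fun x => (lapse M (radius x))⁻¹ * dot3 (fun i => e i x) (fun i => b i x))
      (fun x => -(1 / 2 * (dot3 (fun i => e i x) (fun i => e i x)
        + dot3 (fun i => b i x) (fun i => b i x))))
      (fun x => (radius x)⁻¹ * (radius x)⁻¹ * (dot3 (fun i => rot i D x) (fun i => crossN e i x)
        + dot3 (fun i => rot i K x) (fun i => b i x))) := by
  have hV := radialWeight_angular hM
  have he := h.smooth_e
  have hb := h.smooth_b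
  have hoD := fun i => h.smooth_D.rot i
  have hoK := fun i => h.smooth_K.rot i
  have hec := Smooth.crossN hM he
  have c := Smooth.const (M := M) (1 / 2)
  have h0 : Smooth M fun _ => (0 : ℝ) := Smooth.const 0
  refine (LocalLaw.of_lapse_mul hM (smooth_dot3 he hb)
    (c.mul ((smooth_dot3 he he).add (smooth_dot3 hb hb))).neg
    (hV.smooth.mul ((smooth_dot3 hoD hec).add (smooth_dot3 hoK hb)))
    (z := fun _ _ => 0) (fun i => h0) fun x hx => ?_).congr (fun _ _ => rfl)
      (fun _ _ => rfl) fun x hx => ?_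
  · have ec : radialD (fun _ => (1 / 2 : ℝ)) x = 0 := by
      have : ∀ a, pd a (fun _ => (1 / 2 : ℝ)) x = 0 := fun a => (HasGrad.const _).pd_eq a
      simp only [radialD_eq, this]
      ring
    have ez : rotDiv (fun _ _ => (0 : ℝ)) x = 0 := by
      have : ∀ a, pd a (fun _ => (0 : ℝ)) x = 0 := fun a => (HasGrad.const 0).pd_eq a
      simp [rotDiv, rot, this]
    rw [pd_dot3 he hb hx, radialD_neg,
      radialD_mul c ((smooth_dot3 he he).add (smooth_dot3 hb hb)) hx,
      ec, radialD_add (smooth_dot3 he he) (smooth_dot3 hb hb) hx, radialD_dot3 he he hx,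
      radialD_dot3 hb hb hx, ez]
    simp only [h.time_e x hx, h.time_b x hx, dot3, crossN, cross_apply]
    simp
    ring
  · have hl := (lapse_pos hM hx).ne'
    field_simp

end LocalLaws

/-! ### The elliptic estimate on the spheres -/

/-- For a matrix tangential to the plane orthogonal to the unit vector `m`, twice the second
elementary symmetric function is at most the sum of the squares of the trace and of the twist. -/
theorem two_mul_minors_le {m : Fin 3 → ℝ} {P : Fin 3 → Fin 3 → ℝ}
    (hm : m 0 ^ 2 + m 1 ^ 2 + m 2 ^ 2 = 1)
    (hl : ∀ j, m 0 * P 0 j + m 1 * P 1 j + m 2 * P 2 j = 0)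
    (hr : ∀ i, P i 0 * m 0 + P i 1 * m 1 + P i 2 * m 2 = 0) :
    2 * ((P 0 0 + P 1 1 + P 2 2) ^ 2 - (P 0 0 ^ 2 + P 1 1 ^ 2 + P 2 2 ^ 2
        + 2 * (P 0 1 * P 1 0 + P 0 2 * P 2 0 + P 1 2 * P 2 1)))
      ≤ (P 0 0 + P 1 1 + P 2 2) ^ 2
        + (m 0 * (P 2 1 - P 1 2) + m 1 * (P 0 2 - P 2 0) + m 2 * (P 1 0 - P 0 1)) ^ 2 := by
  have hl0 := hl 0
  have hl1 := hl 1
  have hl2 := hl 2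
  have hr0 := hr 0
  have hr1 := hr 1
  have hr2 := hr 2
  generalize ea : P 2 1 - P 1 2 = a
  generalize eb : P 0 2 - P 2 0 = b
  generalize ec : P 1 0 - P 0 1 = c
  have k0 : b * m 2 - c * m 1 = 0 := by subst ea eb ec; linarith
  have k1 : c * m 0 - a * m 2 = 0 := by subst ea eb ec; linarith
  have k2 : a * m 1 - b * m 0 = 0 := by subst ea eb ec; linarith
  -- The antisymmetric part of a matrix annihilating `m` on both sides has a twist vector parallel
  -- to `m` (`k0`, `k1`, `k2`), so that its normal component has its full length.
  have hd : (m 0 * a + m 1 * b + m 2 * c) ^ 2 = a ^ 2 + b ^ 2 + c ^ 2 := by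
    linear_combination (a ^ 2 + b ^ 2 + c ^ 2) * hm - (b * m 2 - c * m 1) * k0
      - (c * m 0 - a * m 2) * k1 - (a * m 1 - b * m 0) * k2
  rw [hd]
  -- The summands are twice the entries of the trace-free symmetric part of `P` in the plane
  -- orthogonal to `m`.
  have key : 0 ≤ ∑ i, ∑ j, (P i j + P j i - (P 0 0 + P 1 1 + P 2 2)
      * ((if i = j then 1 else 0) - m i * m j)) ^ 2 :=
    Finset.sum_nonneg fun i _ => Finset.sum_nonneg fun j _ => sq_nonneg _
  generalize et : P 0 0 + P 1 1 + P 2 2 = τ at key ⊢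
  have e : ∑ i, ∑ j, (P i j + P j i - τ * ((if i = j then 1 else 0) - m i * m j)) ^ 2
      = 4 * (P 0 0 ^ 2 + P 1 1 ^ 2 + P 2 2 ^ 2) + 2 * ((P 0 1 + P 1 0) ^ 2 + (P 0 2 + P 2 0) ^ 2
        + (P 1 2 + P 2 1) ^ 2) - 2 * τ ^ 2 := by
    simp only [Fin.sum_univ_three]
    simp
    linear_combination 4 * τ * (m 0 * hr0 + m 1 * hr1 + m 2 * hr2) - 4 * τ * et
      + τ ^ 2 * (m 0 ^ 2 + m 1 ^ 2 + m 2 ^ 2 - 1) * hm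
  rw [e] at key
  subst ea eb ec
  linarith

/-- The pointwise inequality behind the elliptic estimate; `N i j` stands for the derivative of the
`j`-th component of the tangential vector `X` along the `i`-th rotation. -/
theorem normSq_add_minors_le {m X : Fin 3 → ℝ} {N : Fin 3 → Fin 3 → ℝ}
    (hm : m 0 ^ 2 + m 1 ^ 2 + m 2 ^ 2 = 1) (h0 : dot3 m X = 0)
    (hl : ∀ j, dot3 m (fun i => N i j) = 0)
    (h1 : dot3 m (N 0) = m 2 * X 1 - m 1 * X 2) (h2 : dot3 m (N 1) = m 0 * X 2 - m 2 * X 0)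
    (h3 : dot3 m (N 2) = m 1 * X 0 - m 0 * X 1) :
    2 * dot3 X X + 2 * ((N 0 0 + N 1 1 + N 2 2) ^ 2 - (N 0 0 ^ 2 + N 1 1 ^ 2 + N 2 2 ^ 2
        + 2 * (N 0 1 * N 1 0 + N 0 2 * N 2 0 + N 1 2 * N 2 1))
        - (X 0 * N 2 1 - X 1 * N 2 0 + X 1 * N 0 2 - X 2 * N 0 1 + X 2 * N 1 0 - X 0 * N 1 2))
      ≤ (N 0 0 + N 1 1 + N 2 2) * (N 0 0 + N 1 1 + N 2 2)
        + (m 0 * (N 2 1 - N 1 2) + m 1 * (N 0 2 - N 2 0) + m 2 * (N 1 0 - N 0 1))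
          * (m 0 * (N 2 1 - N 1 2) + m 1 * (N 0 2 - N 2 0) + m 2 * (N 1 0 - N 0 1)) := by
  have hl0 := hl 0
  have hl1 := hl 1
  have hl2 := hl 2
  simp only [dot3] at h0 h1 h2 h3 hl0 hl1 hl2 ⊢
  -- The twist vector of `N` minus `X` is parallel to `m`, hence orthogonal to `X`.
  have hX : X 0 * N 2 1 - X 1 * N 2 0 + X 1 * N 0 2 - X 2 * N 0 1 + X 2 * N 1 0 - X 0 * N 1 2
      = X 0 * X 0 + X 1 * X 1 + X 2 * X 2 := by
    generalize ea : N 2 1 - N 1 2 - X 0 = a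
    generalize eb : N 0 2 - N 2 0 - X 1 = b
    generalize ec : N 1 0 - N 0 1 - X 2 = c
    have k0 : b * m 2 - c * m 1 = 0 := by subst ea eb ec; linarith
    have k1 : c * m 0 - a * m 2 = 0 := by subst ea eb ec; linarith
    have k2 : a * m 1 - b * m 0 = 0 := by subst ea eb ec; linarith
    have : X 0 * a + X 1 * b + X 2 * c = 0 := by
      linear_combination (-(X 0 * a + X 1 * b + X 2 * c)) * hm
        + (m 0 * a + m 1 * b + m 2 * c) * h0
        + (X 1 * m 2 - X 2 * m 1) * k0 + (X 2 * m 0 - X 0 * m 2) * k1 + (X 0 * m 1 - X 1 * m 0) * k2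
    subst ea eb ec
    linarith
  generalize hc0 : m 2 * X 1 - m 1 * X 2 = c0 at *
  generalize hc1 : m 0 * X 2 - m 2 * X 0 = c1 at *
  generalize hc2 : m 1 * X 0 - m 0 * X 1 = c2 at *
  have hc : c0 * m 0 + c1 * m 1 + c2 * m 2 = 0 := by subst hc0 hc1 hc2; ring
  -- `N` annihilates `m` from one side only. From the other side it produces c, fixed by
  -- differentiating the tangency of `X`. Subtracting c ⊗ m changes neither the trace (`t1`), nor
  -- the trace of the square (`e`), nor the normal twist (`d`).
  have key := two_mul_minors_le (P := fun i j => N i j - ![c0, c1, c2] i * m j) hm ?_ ?_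
  · simp at key
    have t1 : N 0 0 - c0 * m 0 + (N 1 1 - c1 * m 1) + (N 2 2 - c2 * m 2)
        = N 0 0 + N 1 1 + N 2 2 := by linarith
    rw [t1] at key
    rw [hX]
    have e : (N 0 0 - c0 * m 0) ^ 2 + (N 1 1 - c1 * m 1) ^ 2 + (N 2 2 - c2 * m 2) ^ 2
        + 2 * ((N 0 1 - c0 * m 1) * (N 1 0 - c1 * m 0) + (N 0 2 - c0 * m 2) * (N 2 0 - c2 * m 0)
          + (N 1 2 - c1 * m 2) * (N 2 1 - c2 * m 1))
        = N 0 0 ^ 2 + N 1 1 ^ 2 + N 2 2 ^ 2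
          + 2 * (N 0 1 * N 1 0 + N 0 2 * N 2 0 + N 1 2 * N 2 1) := by
      linear_combination (-2 * c0) * hl0 - 2 * c1 * hl1 - 2 * c2 * hl2
        + (c0 * m 0 + c1 * m 1 + c2 * m 2) * hc
    have d : m 0 * (N 2 1 - c2 * m 1 - (N 1 2 - c1 * m 2)) + m 1 * (N 0 2 - c0 * m 2
        - (N 2 0 - c2 * m 0)) + m 2 * (N 1 0 - c1 * m 0 - (N 0 1 - c0 * m 1))
        = m 0 * (N 2 1 - N 1 2) + m 1 * (N 0 2 - N 2 0) + m 2 * (N 1 0 - N 0 1) := by ring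
    rw [e, d] at key
    linarith
  · intro j
    have := hl j
    simp only [dot3] at this
    simp
    linear_combination this - m j * hc
  · intro i
    fin_cases i <;> simp
    · linear_combination h1 - c0 * hm
    · linear_combination h2 - c1 * hm
    · linear_combination h3 - c2 * hm

section Elliptic

variable {M : ℝ} {x : Pt} {X : Fin 3 → Pt → ℝ} {t r : ℝ}

theorem rot_unitNormal (hM : 0 < M) (hx : x ∈ exterior M) (i : Fin 3) :
    rot i (fun z => unitNormal z i) x = 0 ∧
    rot i (fun z => unitNormal z (i + 1)) x = -unitNormal x (i + 2) ∧
    rot i (fun z => unitNormal z (i + 2)) x = unitNormal x (i + 1) := by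
  have hr := (radius_pos hM hx).ne'
  have ey : ∀ i : Fin 3, x i.succ = radius x * unitNormal x i := position_eq hM hx
  simp only [rot, (hasGrad_unitNormal hM hx _).pd_eq, dr_succ, ey]
  fin_cases i <;> refine ⟨?_, ?_, ?_⟩ <;> simp [Fin.ext_iff] <;> field_simp <;> ring

theorem rot_dot3 {X Y : Fin 3 → Pt → ℝ} (hX : ∀ i, Smooth M (X i)) (hY : ∀ i, Smooth M (Y i))
    (hx : x ∈ exterior M) (i : Fin 3) :
    rot i (fun z => dot3 (fun i => X i z) (fun i => Y i z)) x
      = dot3 (fun j => rot i (X j) x) (fun j => Y j x)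
        + dot3 (fun j => X j x) (fun j => rot i (Y j) x) := by
  simp only [rot, pd_dot3 hX hY hx]
  simp only [dot3]
  ring

/-- Derivatives of the condition that `X` is tangential. -/
theorem sum_rot_mul_unitNormal (hM : 0 < M) (hX : ∀ i, Smooth M (X i))
    (hn : ∀ x ∈ exterior M, dot3 (unitNormal x) (fun i => X i x) = 0) (hx : x ∈ exterior M)
    (i : Fin 3) : dot3 (unitNormal x) (fun j => rot i (X j) x)
      = unitNormal x (i + 2) * X (i + 1) x - unitNormal x (i + 1) * X (i + 2) x := by
  have h0 : rot i (fun _ => (0 : ℝ)) x = 0 := by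
    have : ∀ a, pd a (fun _ => (0 : ℝ)) x = 0 := fun a => (HasGrad.const 0).pd_eq a
    simp [rot, this]
  have h := rot_dot3 (Smooth.unitNormal hM) hX hx i
  rw [rot_congr hn hx, h0] at h
  obtain ⟨h1, h2, h3⟩ := rot_unitNormal hM hx i
  fin_cases i <;> simp [dot3] at h h1 h2 h3 ⊢ <;> rw [h1, h2, h3] at h <;> linarith

theorem rotDiv_crossN (hM : 0 < M) (hX : ∀ i, Smooth M (X i))
    (hn : ∀ x ∈ exterior M, dot3 (unitNormal x) (fun i => X i x) = 0) (hx : x ∈ exterior M) :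
    rotDiv (crossN X) x = unitNormal x 0 * (rot 2 (X 1) x - rot 1 (X 2) x)
      + unitNormal x 1 * (rot 0 (X 2) x - rot 2 (X 0) x)
      + unitNormal x 2 * (rot 1 (X 0) x - rot 0 (X 1) x) := by
  have hN := Smooth.unitNormal hM
  have hs : ∀ i j k l m : Fin 3, rot i (fun z => unitNormal z j * X k z - unitNormal z l * X m z) x
      = rot i (fun z => unitNormal z j) x * X k x + unitNormal x j * rot i (X k) x
        - (rot i (fun z => unitNormal z l) x * X m x + unitNormal x l * rot i (X m) x) :=
    fun i j k l m => by
      rw [rot_sub ((hN j).mul (hX k)) ((hN l).mul (hX m)) hx, rot_mul (hN j) (hX k) hx,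
        rot_mul (hN l) (hX m) hx]
  have e : rotDiv (crossN X) x = _ :=
    congrArg₂ (· + ·) (congrArg₂ (· + ·) (hs 0 1 2 2 1) (hs 1 2 0 0 2)) (hs 2 0 1 1 0)
  have h0 := hn x hx
  obtain ⟨a1, a2, a3⟩ := rot_unitNormal hM hx 0
  obtain ⟨b1, b2, b3⟩ := rot_unitNormal hM hx 1
  obtain ⟨c1, c2, c3⟩ := rot_unitNormal hM hx 2
  simp [dot3] at h0 a2 a3 b2 b3 c2 c3
  rw [e, a2, a3, b2, b3, c2, c3]
  linear_combination (-2) * h0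

/-- Bochner's argument: (tr N)² - tr N² for N_ij = `rot i (X j)` is an angular divergence up to
commutators. By `rot_comm` the latter are first order; for tangential `X` they amount to |X|², the
curvature of the sphere. -/
theorem rotDiv_minors (hX : ∀ i, Smooth M (X i)) (hx : x ∈ exterior M) :
    rotDiv (fun i x => X i x * rotDiv X x
      - dot3 (fun j => X j x) (fun j => rot j (X i) x)) x
      = rotDiv X x ^ 2 - (rot 0 (X 0) x ^ 2 + rot 1 (X 1) x ^ 2 + rot 2 (X 2) x ^ 2
        + 2 * (rot 0 (X 1) x * rot 1 (X 0) x + rot 0 (X 2) x * rot 2 (X 0) x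
          + rot 1 (X 2) x * rot 2 (X 1) x))
        - (X 0 x * rot 2 (X 1) x - X 1 x * rot 2 (X 0) x + X 1 x * rot 0 (X 2) x
          - X 2 x * rot 0 (X 1) x + X 2 x * rot 1 (X 0) x - X 0 x * rot 1 (X 2) x) := by
  have hR : ∀ i j, Smooth M (rot i (X j)) := fun i j => (hX j).rot i
  have hD : Smooth M (rotDiv X) := (((hX 0).rot 0).add ((hX 1).rot 1)).add ((hX 2).rot 2)
  have hrd : ∀ i, rot i (rotDiv X) x = rot i (rot 0 (X 0)) x + rot i (rot 1 (X 1)) x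
      + rot i (rot 2 (X 2)) x := fun i => by
    have : rot i (rotDiv X) x = _ := rot_add ((hR 0 0).add (hR 1 1)) (hR 2 2) hx i
    rw [this, rot_add (hR 0 0) (hR 1 1) hx]
  have e : ∀ i j : Fin 3, rot j (fun x => X i x * rotDiv X x
      - dot3 (fun j => X j x) (fun j => rot j (X i) x)) x = _ := fun i j => by
    rw [rot_sub ((hX i).mul hD) (smooth_dot3 hX fun j => hR j i) hx,
      rot_mul (hX i) hD hx, rot_dot3 hX (fun j => hR j i) hx, hrd]
  have c01 := fun j => rot_comm (hX j) hx 0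
  have c12 := fun j => rot_comm (hX j) hx 1
  have c20 := fun j => rot_comm (hX j) hx 2
  simp only [show (0 : Fin 3) + 1 = 1 from rfl, show (0 : Fin 3) + 2 = 2 from rfl,
    show (1 : Fin 3) + 1 = 2 from rfl, show (1 : Fin 3) + 2 = 0 from rfl,
    show (2 : Fin 3) + 1 = 0 from rfl, show (2 : Fin 3) + 2 = 1 from rfl] at c01 c12 c20
  rw [rotDiv, e, e, e]
  simp only [rotDiv, dot3]
  linear_combination X 0 x * (c01 1) - X 1 x * (c01 0) + X 1 x * (c12 2) - X 2 x * (c12 1)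
    + X 2 x * (c20 0) - X 0 x * (c20 2)

/-- The pointwise inequality `normSq_add_minors_le` integrated, with `rotDiv_minors` as the null
term. The constant 2 is the lowest eigenvalue for tangential fields on the unit sphere, attained by
gradients of spherical harmonics of degree one. -/
theorem two_mul_sphereAvg_normSq_le (hM : 0 < M) (hX : ∀ i, Smooth M (X i))
    (hn : ∀ x ∈ exterior M, dot3 (unitNormal x) (fun i => X i x) = 0) (hr : 2 * M < r) :
    2 * sphereAvg (fun x => dot3 (fun i => X i x) (fun i => X i x)) t r
      ≤ sphereAvg (fun x => rotDiv X x * rotDiv X x + rotDiv (crossN X) x * rotDiv (crossN X) x)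
        t r := by
  have hR : ∀ i j, Smooth M (rot i (X j)) := fun i j => (hX j).rot i
  have hC := Smooth.crossN hM hX
  have hD : ∀ {Y : Fin 3 → Pt → ℝ}, (∀ i, Smooth M (Y i)) → Smooth M (rotDiv Y) := fun hY =>
    (((hY 0).rot 0).add ((hY 1).rot 1)).add ((hY 2).rot 2)
  have hZ : ∀ i, Smooth M fun x => X i x * rotDiv X x
      - dot3 (fun j => X j x) (fun j => rot j (X i) x) := fun i =>
    ((hX i).mul (hD hX)).sub (smooth_dot3 hX fun j => hR j i)
  have hS := smooth_dot3 hX hX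
  have hz0 := LocalLaw.sphereAvg_rotDiv hM hZ hr (t := t)
  have hsum := sphereAvg_add (t := t) hM hr ((Smooth.const 2).mul hS) ((Smooth.const 2).mul (hD hZ))
  rw [sphereAvg_const_mul, sphereAvg_const_mul, hz0, mul_zero, add_zero] at hsum
  rw [← hsum]
  refine sphereAvg_mono hM hr (((Smooth.const 2).mul hS).add ((Smooth.const 2).mul (hD hZ)))
    (((hD hX).mul (hD hX)).add ((hD hC).mul (hD hC))) fun x hx => ?_
  have hu := unitNormal_sq_sum hM hx
  have hk := sum_rot_mul_unitNormal hM hX hn hx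
  have h0 := hn x hx
  have eZ := rotDiv_minors hX hx
  have ec := rotDiv_crossN hM hX hn hx
  have hl := fun j => dot3_unitNormal_rot hM hx (X j)
  change 2 * dot3 (fun i => X i x) (fun i => X i x) + 2 * rotDiv (fun i x => X i x * rotDiv X x
    - dot3 (fun j => X j x) (fun j => rot j (X i) x)) x
    ≤ rotDiv X x * rotDiv X x + rotDiv (crossN X) x * rotDiv (crossN X) x
  rw [eZ, ec, rotDiv]
  have hk0 := hk 0
  have hk1 := hk 1
  have hk2 := hk 2
  simp only [show (0 : Fin 3) + 1 = 1 from rfl, show (0 : Fin 3) + 2 = 2 from rfl,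
    show (1 : Fin 3) + 1 = 2 from rfl, show (1 : Fin 3) + 2 = 0 from rfl,
    show (2 : Fin 3) + 1 = 0 from rfl, show (2 : Fin 3) + 2 = 1 from rfl] at hk0 hk1 hk2
  exact normSq_add_minors_le (m := unitNormal x) (X := fun i => X i x)
    (N := fun i j => rot i (X j) x) hu h0 hl hk0 hk1 hk2

end Elliptic

/-! ### The Morawetz multiplier: inequalities for real numbers -/

/-- The current of the multiplier is dominated by the energy current. -/
theorem abs_multiplier_le {u r P G Y X : ℝ} (hu : 0 < u) (hu' : u < 1 / 2) (hr : 0 < r)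
    (hG : 0 ≤ G) (hX : 0 ≤ X) (hP : 2 * X ≤ P)
    (hY : ∀ s : ℝ, 0 ≤ s ^ 2 * G + 2 * s * Y + 2 * X) :
    |-(1 / 2 * (36 / 5 * (1 - 3 * u)) * (P - (1 - 2 * u) / r ^ 2 * G))
        - 1 / 2 * (9 * (36 / 5) * u ^ 2 * (3 - 14 * u + 15 * u ^ 2)) * X
        + 9 * (36 / 5) * u ^ 2 * (1 - 2 * u) * (1 - 3 / 2 * u) / r * Y|
      ≤ 36 / 5 * (1 / 2 * (P + (1 - 2 * u) / r ^ 2 * G)) := by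
  have hf : 0 < 1 - 2 * u := by linarith
  -- Cauchy-Schwarz between gradient and fields with parameter s = ±8/(9r). Weighted by `hw` and
  -- doubled, it costs 8u²(1 - 3u/2) of the angular energy, which both available coefficients 2 - 3u
  -- (`k3`) and 3u (`k4`) can afford.
  have h1 := mul_nonneg hf.le (hY (8 / (9 * r)))
  have h2 := mul_nonneg hf.le (hY (-(8 / (9 * r))))
  have e1 : (1 - 2 * u) * ((8 / (9 * r)) ^ 2 * G + 2 * (8 / (9 * r)) * Y + 2 * X)
      = 64 / 81 * ((1 - 2 * u) / r ^ 2 * G) + 16 / 9 * ((1 - 2 * u) / r * Y)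
        + 2 * (1 - 2 * u) * X := by field_simp; ring
  have e2 : (1 - 2 * u) * ((-(8 / (9 * r))) ^ 2 * G + 2 * (-(8 / (9 * r))) * Y + 2 * X)
      = 64 / 81 * ((1 - 2 * u) / r ^ 2 * G) - 16 / 9 * ((1 - 2 * u) / r * Y)
        + 2 * (1 - 2 * u) * X := by field_simp; ring
  rw [e1] at h1
  rw [e2] at h2
  have e3 : 9 * (36 / 5) * u ^ 2 * (1 - 2 * u) * (1 - 3 / 2 * u) / r * Y
      = 9 * (36 / 5) * u ^ 2 * (1 - 3 / 2 * u) * ((1 - 2 * u) / r * Y) := by ring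
  rw [e3]
  have hG' : 0 ≤ (1 - 2 * u) / r ^ 2 * G := by positivity
  generalize (1 - 2 * u) / r * Y = y at *
  generalize (1 - 2 * u) / r ^ 2 * G = H at *
  have hw : 0 ≤ 9 * u ^ 2 * (1 - 3 / 2 * u) * (9 / 16) := by
    have : 0 < 1 - 3 / 2 * u := by linarith
    positivity
  have h1' := mul_nonneg hw h1
  have h2' := mul_nonneg hw h2
  -- `u * q1` and `q2` are the coefficients left to `X` in the lower and in the upper bound, after
  -- 2X ≤ P has been used.
  have q1 : 0 ≤ 6 - 189 / 4 * u + 1575 / 8 * u ^ 2 - 783 / 4 * u ^ 3 := by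
    nlinarith [mul_nonneg (sq_nonneg u) (by linarith : 0 ≤ 1 / 2 - u), sq_nonneg (u - 47 / 198)]
  have q2 : 0 ≤ 4 - 6 * u + 27 / 4 * u ^ 2 - 441 / 8 * u ^ 3 + 297 / 4 * u ^ 4 := by
    have a1 : 0 ≤ 297 / 4 * u ^ 2 - 441 / 8 * u + 41 / 4 := by nlinarith [sq_nonneg (u - 49 / 132)]
    nlinarith [mul_nonneg (sq_nonneg u) a1, mul_nonneg hu.le (by linarith : 0 ≤ 1 / 2 - u)]
  have k1 := mul_nonneg (mul_nonneg hu.le q1) hX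
  have k2 := mul_nonneg q2 hX
  have k3 : 0 ≤ (2 - 3 * u) * (1 - 4 * u ^ 2) * H :=
    mul_nonneg (mul_nonneg (by linarith) (by nlinarith)) hG'
  have k4 : 0 ≤ (3 * u - 8 * u ^ 2 * (1 - 3 / 2 * u)) * H := by
    refine mul_nonneg ?_ hG'
    nlinarith [mul_nonneg hu.le (sq_nonneg (u - 1 / 3))]
  have k5 : 0 ≤ 3 * u * (P - 2 * X) := mul_nonneg (by linarith) (by linarith)
  have k6 : 0 ≤ (2 - 3 * u) * (P - 2 * X) := mul_nonneg (by linarith) (by linarith)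
  rw [abs_le]
  constructor
  · linear_combination (18 / 5) * (k5 + k1 + k3 + 2 * h1')
  · linear_combination (18 / 5) * (k6 + k2 + k4 + 2 * h2')

/-- Positivity of the bulk term of the multiplier. -/
theorem multiplier_source_ge {u r TT XX GG NN : ℝ} (hu : 0 < u) (hu' : u < 1 / 2) (hr : 0 < r)
    (hT : 0 ≤ TT) (hX : 0 ≤ XX) (hG : 0 ≤ GG) (hN : 0 ≤ NN) (hNN : 2 * NN ≤ TT + XX) :
    u * (1 - 3 * u) ^ 2 / r * TT + u / r * XX + (1 - 3 * u) ^ 2 / r ^ 3 * GG + 2 * u / (25 * r) * NN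
      ≤ 3 / 2 * (36 / 5) * u * (1 - 3 * u) ^ 2 / r * TT
        + (3 / 2 * (36 / 5) * u + 9 * (36 / 5) * u ^ 2 * (1 - 3 / 2 * u)) / r * XX
        + 36 / 5 * (1 - 3 * u) ^ 2 * (1 - 3 / 2 * u + 3 * u ^ 2) / r ^ 3 * GG
        - 27 * (36 / 5) * u ^ 2 * (1 - 2 * u) * (1 - 5 * u) / r * NN := by
  -- What is left for `TT` after `NN` has been absorbed by 2 NN ≤ TT + XX. The critical radius is
  -- near u = 1/7. The number 49/5 is (3/2)(36/5) - 1, the surplus over the term to be bounded.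
  have hc : 0 ≤ 49 / 5 * (1 - 3 * u) ^ 2
      - 1 / 2 * (972 / 5 * u * (1 - 2 * u) * (1 - 5 * u) + 2 / 25) := by
    nlinarith [mul_nonneg hu.le (sq_nonneg (u - 1 / 7)), sq_nonneg (u - 1 / 7),
      mul_nonneg (by linarith : 0 ≤ 1 / 2 - u) (sq_nonneg (u - 1 / 7))]
  have h1 : 0 ≤ 49 / 5 * (1 - 3 * u) ^ 2 * TT + (49 / 5 + 324 / 5 * u * (1 - 3 / 2 * u)) * XX
      - (972 / 5 * u * (1 - 2 * u) * (1 - 5 * u) + 2 / 25) * NN := by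
    generalize 972 / 5 * u * (1 - 2 * u) * (1 - 5 * u) + 2 / 25 = c at *
    have a1 : 0 ≤ 324 / 5 * u * (1 - 3 / 2 * u) * XX :=
      mul_nonneg (mul_nonneg (by linarith) (by linarith)) hX
    have a2 : 49 / 5 * (1 - 3 * u) ^ 2 * XX ≤ 49 / 5 * XX := by
      refine mul_le_mul_of_nonneg_right ?_ hX
      nlinarith
    -- If c ≤ 0 the field term has the good sign; this covers the photon sphere u = 1/3, where the
    -- coefficient of `TT` degenerates. If c ≥ 0 it is absorbed by `hNN` and `hc`.
    rcases le_total c 0 with h | h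
    · nlinarith [mul_nonneg (sq_nonneg (1 - 3 * u)) hT]
    · have b1 := mul_le_mul_of_nonneg_left hNN h
      nlinarith [mul_nonneg hc hT, mul_nonneg hc hX]
  have h2 : 0 ≤ ((36 / 5) * (1 - 3 / 2 * u + 3 * u ^ 2) - 1) * (1 - 3 * u) ^ 2 * GG := by
    refine mul_nonneg (mul_nonneg ?_ (sq_nonneg _)) hG
    nlinarith [sq_nonneg (u - 1 / 4)]
  have h3 := mul_nonneg (div_pos hu hr).le h1
  have h4 := mul_nonneg (by positivity : 0 ≤ 1 / r ^ 3) h2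
  have e : 3 / 2 * (36 / 5) * u * (1 - 3 * u) ^ 2 / r * TT
        + (3 / 2 * (36 / 5) * u + 9 * (36 / 5) * u ^ 2 * (1 - 3 / 2 * u)) / r * XX
        + 36 / 5 * (1 - 3 * u) ^ 2 * (1 - 3 / 2 * u + 3 * u ^ 2) / r ^ 3 * GG
        - 27 * (36 / 5) * u ^ 2 * (1 - 2 * u) * (1 - 5 * u) / r * NN
      - (u * (1 - 3 * u) ^ 2 / r * TT + u / r * XX + (1 - 3 * u) ^ 2 / r ^ 3 * GG
        + 2 * u / (25 * r) * NN)
      = u / r * (49 / 5 * (1 - 3 * u) ^ 2 * TT + (49 / 5 + 324 / 5 * u * (1 - 3 / 2 * u)) * XX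
      - (972 / 5 * u * (1 - 2 * u) * (1 - 5 * u) + 2 / 25) * NN)
      + 1 / r ^ 3 * (((36 / 5) * (1 - 3 / 2 * u + 3 * u ^ 2) - 1) * (1 - 3 * u) ^ 2 * GG) := by
    field_simp
    ring
  linarith

/-! ### Quadratic densities of the reduced system -/

section Densities

variable (M : ℝ) (D K : Pt → ℝ) (e b : Fin 3 → Pt → ℝ)

/-- The squares of the time derivatives. -/
def timeSq (x : Pt) : ℝ := pd 0 D x * pd 0 D x + pd 0 K x * pd 0 K x

/-- The squares of the tortoise derivatives. -/
def tortoiseSq (x : Pt) : ℝ := tortoiseD M D x * tortoiseD M D x + tortoiseD M K x * tortoiseD M K x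

/-- The products of time and tortoise derivatives. -/
def timeTortoise (x : Pt) : ℝ := pd 0 D x * tortoiseD M D x + pd 0 K x * tortoiseD M K x

/-- The squares of the angular derivatives. -/
def angularSq (x : Pt) : ℝ := rotNormSq D x + rotNormSq K x

/-- The angular derivatives paired with the potentials of the time derivatives. -/
def timePairing (x : Pt) : ℝ := dot3 (fun i => rot i D x) (fun i => crossN b i x)
  + dot3 (fun i => rot i K x) (fun i => e i x)

/-- The angular derivatives paired with the potentials of the radial derivatives. -/
def radialPairing (x : Pt) : ℝ := dot3 (fun i => rot i D x) (fun i => crossN e i x)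
  + dot3 (fun i => rot i K x) (fun i => b i x)

/-- The inner product of the tangential fields. -/
def fieldProd (x : Pt) : ℝ := dot3 (fun i => e i x) (fun i => b i x)

/-- The squares of the tangential fields. -/
def fieldSq (x : Pt) : ℝ := dot3 (fun i => e i x) (fun i => e i x)
  + dot3 (fun i => b i x) (fun i => b i x)

/-- The energy density. -/
def energyDensity (x : Pt) : ℝ := (lapse M (radius x))⁻¹ * (1 / 2 * (timeSq D K x
  + tortoiseSq M D K x + lapse M (radius x) / radius x ^ 2 * angularSq D K x))

end Densities

/-! ### The Morawetz identity as a weighted sum of local laws -/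

section MorawetzLaw

variable {M : ℝ} {D K : Pt → ℝ} {e b : Fin 3 → Pt → ℝ}

theorem RadialWeight.inv_pow (hM : 0 < M) (n : ℕ) :
    RadialWeight M (fun r => r⁻¹ ^ n) (fun r => -(n * r⁻¹ ^ (n + 1))) := by
  have h : Smooth M fun z => (radius z)⁻¹ := (Schwarzschild.RadialWeight.inv_radius hM).smooth
  have hp : ∀ n : ℕ, Smooth M fun z => (radius z)⁻¹ ^ n := fun n => ContDiffOn.pow h n
  refine ⟨hp n, ((Smooth.const n).mul (hp (n + 1))).neg, fun r hr => ?_⟩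
  have h0 : r ≠ 0 := by linarith
  refine ((hasDerivAt_inv h0).pow n).congr_deriv ?_
  rcases n with - | n
  · simp
  · simp only [Nat.add_sub_cancel]
    ring

theorem RadialWeight.const_mul (c : ℝ) {φ φ' : ℝ → ℝ} (h : RadialWeight M φ φ') :
    RadialWeight M (fun r => c * φ r) (fun r => c * φ' r) :=
  ((RadialWeight.const c).mul h).congr (fun _ _ => rfl) fun _ _ => by ring

/-- The radial weight of the momentum law. -/
theorem radialWeight_momentum (hM : 0 < M) :
    RadialWeight M (fun r => -(36 / 5 * (1 - 3 * (M / r))))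
      (fun r => -(36 / 5 * (3 * M * r⁻¹ ^ 2))) :=
  ((RadialWeight.const (-(36 / 5))).add
    ((RadialWeight.inv_pow hM 1).const_mul (36 / 5 * (3 * M)))).congr
    (fun r _ => by ring) fun r _ => by push_cast; ring

/-- The radial weight of the laws for the potentials. -/
theorem radialWeight_potential (hM : 0 < M) :
    RadialWeight M (fun r => 9 * (36 / 5) * (M / r) ^ 2 * (1 - 2 * (M / r))
        * (1 - 3 / 2 * (M / r)) / r)
      (fun r => -(9 * (36 / 5) * M ^ 2 * r⁻¹ ^ 4
        * (3 - 14 * (M / r) + 15 * (M / r) ^ 2))) :=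
  (((RadialWeight.inv_pow hM 3).const_mul (9 * (36 / 5) * M ^ 2)).add
    (((RadialWeight.inv_pow hM 4).const_mul (9 * (36 / 5) * M ^ 2 * (-(7 / 2) * M))).add
    ((RadialWeight.inv_pow hM 5).const_mul (9 * (36 / 5) * M ^ 2 * (3 * M ^ 2))))).congr
    (fun r _ => by ring) fun r _ => by push_cast; ring

/-- The radial weight of the law for the product of the fields. -/
theorem radialWeight_product (hM : 0 < M) :
    RadialWeight M (fun r => 9 * (36 / 5) * (M / r) ^ 2 * (3 - 14 * (M / r) + 15 * (M / r) ^ 2))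
      (fun r => -(54 * (36 / 5) * M ^ 2 * r⁻¹ ^ 3 * (1 - 7 * (M / r) + 10 * (M / r) ^ 2))) :=
  (((RadialWeight.inv_pow hM 2).const_mul (9 * (36 / 5) * M ^ 2 * 3)).add
    (((RadialWeight.inv_pow hM 3).const_mul (9 * (36 / 5) * M ^ 2 * (-14 * M))).add
    ((RadialWeight.inv_pow hM 4).const_mul (9 * (36 / 5) * M ^ 2 * (15 * M ^ 2))))).congr
    (fun r _ => by ring) fun r _ => by push_cast; ring

/-- The radial weight of the angular flux. -/
theorem radialWeight_angularFlux (hM : 0 < M) :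
    RadialWeight M (fun r => 1 / 2 * (36 / 5 * (1 - 3 * (M / r))) * ((1 - 2 * (M / r)) / r ^ 2))
      (fun r => -(36 / 5 * r⁻¹ ^ 3 * (1 - 15 / 2 * (M / r) + 12 * (M / r) ^ 2))) :=
  (((RadialWeight.inv_pow hM 2).const_mul (1 / 2 * (36 / 5))).add
    (((RadialWeight.inv_pow hM 3).const_mul (1 / 2 * (36 / 5) * (-5 * M))).add
    ((RadialWeight.inv_pow hM 4).const_mul (1 / 2 * (36 / 5) * (6 * M ^ 2))))).congr
    (fun r _ => by ring) fun r _ => by push_cast; ring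

namespace ReducedSystem

theorem smooth_timeSq (h : ReducedSystem M D K e b) : Smooth M (timeSq D K) :=
  ((h.smooth_D.pd 0).mul (h.smooth_D.pd 0)).add ((h.smooth_K.pd 0).mul (h.smooth_K.pd 0))

theorem smooth_tortoiseSq (hM : 0 < M) (h : ReducedSystem M D K e b) :
    Smooth M (tortoiseSq M D K) :=
  ((h.smooth_D.tortoiseD hM).mul (h.smooth_D.tortoiseD hM)).add
    ((h.smooth_K.tortoiseD hM).mul (h.smooth_K.tortoiseD hM))

theorem smooth_timeTortoise (hM : 0 < M) (h : ReducedSystem M D K e b) :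
    Smooth M (timeTortoise M D K) :=
  ((h.smooth_D.pd 0).mul (h.smooth_D.tortoiseD hM)).add
    ((h.smooth_K.pd 0).mul (h.smooth_K.tortoiseD hM))

theorem smooth_angularSq (h : ReducedSystem M D K e b) : Smooth M (angularSq D K) :=
  h.smooth_D.rotNormSq.add h.smooth_K.rotNormSq

theorem smooth_timePairing (hM : 0 < M) (h : ReducedSystem M D K e b) :
    Smooth M (timePairing D K e b) :=
  (smooth_dot3 (fun i => h.smooth_D.rot i) (Smooth.crossN hM h.smooth_b)).add
    (smooth_dot3 (fun i => h.smooth_K.rot i) h.smooth_e)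

theorem smooth_radialPairing (hM : 0 < M) (h : ReducedSystem M D K e b) :
    Smooth M (radialPairing D K e b) :=
  (smooth_dot3 (fun i => h.smooth_D.rot i) (Smooth.crossN hM h.smooth_e)).add
    (smooth_dot3 (fun i => h.smooth_K.rot i) h.smooth_b)

theorem smooth_fieldProd (h : ReducedSystem M D K e b) :
    Smooth M (fieldProd e b) :=
  smooth_dot3 h.smooth_e h.smooth_b

theorem smooth_fieldSq (h : ReducedSystem M D K e b) : Smooth M (fieldSq e b) :=
  (smooth_dot3 h.smooth_e h.smooth_e).add (smooth_dot3 h.smooth_b h.smooth_b)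

theorem energy_law (hM : 0 < M) (h : ReducedSystem M D K e b) :
    LocalLaw M (energyDensity M D K) (timeTortoise M D K) (fun _ => 0) :=
  (((h.pair_D hM).energy_law hM).add (h.pair_K.energy_law hM)).congr
    (fun x _ => by simp only [energyDensity, timeSq, tortoiseSq, angularSq]; ring)
    (fun _ _ => rfl) fun _ _ => by ring

/-- Put u = M/r. The momentum weight -(36/5)(1 - 3u) vanishes at the photon sphere and puts
(36/5)(3u/2)/r in front of the time and tortoise squares. The potential weight ψ completes the
square: 3u/2 - 9u²(1 - 3u/2) = (3u/2)(1 - 3u)², and it likewise gives the angular coefficient a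
factor (1 - 3u)². The product weight is -r² ψ', so that the radial pairing cancels. The law `l4`
integrates the radial derivative of the angular squares by parts. -/
theorem morawetz_law (hM : 0 < M) (h : ReducedSystem M D K e b) :
    LocalLaw M
      (fun x => (lapse M (radius x))⁻¹ * (-(36 / 5 * (1 - 3 * (M / radius x))))
          * timeTortoise M D K x
        + (lapse M (radius x))⁻¹ * (9 * (36 / 5) * (M / radius x) ^ 2 * (1 - 2 * (M / radius x))
          * (1 - 3 / 2 * (M / radius x)) / radius x) * timePairing D K e b x
        + (lapse M (radius x))⁻¹ * (9 * (36 / 5) * (M / radius x) ^ 2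
          * (3 - 14 * (M / radius x) + 15 * (M / radius x) ^ 2)) * fieldProd e b x)
      (fun x => -(1 / 2 * (36 / 5 * (1 - 3 * (M / radius x)))) * timeSq D K x
        + -(1 / 2 * (36 / 5 * (1 - 3 * (M / radius x)))) * tortoiseSq M D K x
        + 1 / 2 * (36 / 5 * (1 - 3 * (M / radius x))) * ((1 - 2 * (M / radius x)) / radius x ^ 2)
          * angularSq D K x
        + -(9 * (36 / 5) * (M / radius x) ^ 2 * (1 - 2 * (M / radius x))
          * (1 - 3 / 2 * (M / radius x)) / radius x) * radialPairing D K e b x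
        + -(1 / 2 * (9 * (36 / 5) * (M / radius x) ^ 2
          * (3 - 14 * (M / radius x) + 15 * (M / radius x) ^ 2))) * fieldSq e b x)
      (fun x => 3 / 2 * (36 / 5) * (M / radius x) * (1 - 3 * (M / radius x)) ^ 2 / radius x
          * timeSq D K x
        + (3 / 2 * (36 / 5) * (M / radius x) + 9 * (36 / 5) * (M / radius x) ^ 2
          * (1 - 3 / 2 * (M / radius x))) / radius x * tortoiseSq M D K x
        + 36 / 5 * (1 - 3 * (M / radius x)) ^ 2 * (1 - 3 / 2 * (M / radius x)
          + 3 * (M / radius x) ^ 2) / radius x ^ 3 * angularSq D K x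
        + -(27 * (36 / 5) * (M / radius x) ^ 2 * (1 - 2 * (M / radius x))
          * (1 - 5 * (M / radius x)) / radius x) * fieldSq e b x) := by
  have hD := h.pair_D hM
  have hK := h.pair_K
  have hW := radialWeight_angularFlux hM
  have l1 := ((hD.momentum_law hM).add (hK.momentum_law hM)).radial_mul hM
    (radialWeight_momentum hM)
  have l2 := ((hD.potential_law hM).add (hK.potential_law hM)).radial_mul hM
    (radialWeight_potential hM)
  have l3 := (h.product_law hM).radial_mul hM (radialWeight_product hM)
  have l4 := LocalLaw.of_flux hM (hW.smooth.mul h.smooth_angularSq)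
  refine (((l1.add l2).add l3).add l4).congr (fun x hx => ?_) (fun x hx => ?_) fun x hx => ?_
  · simp only [timeTortoise, timePairing, fieldProd]
    ring
  · simp only [timeSq, tortoiseSq, angularSq, radialPairing, fieldSq]
    ring
  · have hr := (radius_pos hM hx).ne'
    have hl := (lapse_pos hM hx).ne'
    have hf : lapse M (radius x) = 1 - 2 * (M / radius x) := by rw [lapse]; ring
    have hd : radialD (fun x => rotNormSq D x + rotNormSq K x) x
        = radialD (rotNormSq D) x + radialD (rotNormSq K) x :=
      radialD_add h.smooth_D.rotNormSq h.smooth_K.rotNormSq hx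
    rw [radialD_mul hW.smooth h.smooth_angularSq hx, hW.radialD hM hx]
    have hd' : radialD (angularSq D K) x = _ := hd
    rw [hd']
    simp only [timeSq, tortoiseSq, angularSq, fieldSq]
    rw [hf] at hl
    simp only [hf]
    generalize hU : M / radius x = U at *
    have hMU : M = U * radius x := by rw [← hU]; field_simp
    subst hMU
    field_simp
    ring

end ReducedSystem

end MorawetzLaw

/-! ### Estimates for spherical integrals of the quadratic densities -/

section AverageBounds

variable {M : ℝ} {D K : Pt → ℝ} {e b : Fin 3 → Pt → ℝ} {t r : ℝ}

theorem sphereAvg_sum_radial (hM : 0 < M) (hr : 2 * M < r) {ι : Type*} (s : Finset ι)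
    (c : ι → ℝ → ℝ) {u : ι → Pt → ℝ} (hu : ∀ i ∈ s, Smooth M (u i)) :
    sphereAvg (fun x => ∑ i ∈ s, c i (radius x) * u i x) t r
      = ∑ i ∈ s, c i r * sphereAvg (u i) t r := by
  have h1 : sphereAvg (fun x => ∑ i ∈ s, c i (radius x) * u i x) t r
      = sphereAvg (fun x => ∑ i ∈ s, c i r * u i x) t r := by
    refine setIntegral_congr_fun isCompact_unitSphere.measurableSet fun θ hθ => ?_
    simp only [radius_polarPoint (by linarith : 0 ≤ r) hθ]
  rw [h1, sphereAvg_sum hM hr fun i hi => (Smooth.const (c i r)).mul (hu i hi)]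
  exact Finset.sum_congr rfl fun i _ => sphereAvg_const_mul _ _

theorem sphereAvg_radial₃ (hM : 0 < M) (hr : 2 * M < r) (c₁ c₂ c₃ : ℝ → ℝ) {u₁ u₂ u₃ : Pt → ℝ}
    (h₁ : Smooth M u₁) (h₂ : Smooth M u₂) (h₃ : Smooth M u₃) :
    sphereAvg (fun x => c₁ (radius x) * u₁ x + c₂ (radius x) * u₂ x + c₃ (radius x) * u₃ x) t r
      = c₁ r * sphereAvg u₁ t r + c₂ r * sphereAvg u₂ t r + c₃ r * sphereAvg u₃ t r := by
  have := sphereAvg_sum_radial (t := t) hM hr Finset.univ ![c₁, c₂, c₃] (u := ![u₁, u₂, u₃])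
    fun i _ => by fin_cases i; exacts [h₁, h₂, h₃]
  simpa [Fin.sum_univ_three] using this

theorem sphereAvg_radial₄ (hM : 0 < M) (hr : 2 * M < r) (c₁ c₂ c₃ c₄ : ℝ → ℝ)
    {u₁ u₂ u₃ u₄ : Pt → ℝ}
    (h₁ : Smooth M u₁) (h₂ : Smooth M u₂) (h₃ : Smooth M u₃) (h₄ : Smooth M u₄) :
    sphereAvg (fun x => c₁ (radius x) * u₁ x + c₂ (radius x) * u₂ x + c₃ (radius x) * u₃ x
      + c₄ (radius x) * u₄ x) t r
      = c₁ r * sphereAvg u₁ t r + c₂ r * sphereAvg u₂ t r + c₃ r * sphereAvg u₃ t r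
        + c₄ r * sphereAvg u₄ t r := by
  have := sphereAvg_sum_radial (t := t) hM hr Finset.univ ![c₁, c₂, c₃, c₄]
    (u := ![u₁, u₂, u₃, u₄]) fun i _ => by fin_cases i; exacts [h₁, h₂, h₃, h₄]
  simpa [Fin.sum_univ_four] using this

theorem sphereAvg_radial₅ (hM : 0 < M) (hr : 2 * M < r) (c₁ c₂ c₃ c₄ c₅ : ℝ → ℝ)
    {u₁ u₂ u₃ u₄ u₅ : Pt → ℝ} (h₁ : Smooth M u₁) (h₂ : Smooth M u₂) (h₃ : Smooth M u₃)
    (h₄ : Smooth M u₄) (h₅ : Smooth M u₅) :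
    sphereAvg (fun x => c₁ (radius x) * u₁ x + c₂ (radius x) * u₂ x + c₃ (radius x) * u₃ x
      + c₄ (radius x) * u₄ x + c₅ (radius x) * u₅ x) t r
      = c₁ r * sphereAvg u₁ t r + c₂ r * sphereAvg u₂ t r + c₃ r * sphereAvg u₃ t r
        + c₄ r * sphereAvg u₄ t r + c₅ r * sphereAvg u₅ t r := by
  have := sphereAvg_sum_radial (t := t) hM hr Finset.univ ![c₁, c₂, c₃, c₄, c₅]
    (u := ![u₁, u₂, u₃, u₄, u₅]) fun i _ => by fin_cases i; exacts [h₁, h₂, h₃, h₄, h₅]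
  simpa [Fin.sum_univ_five] using this

namespace ReducedSystem

/-- The elliptic estimate for `e + c b`, `c² = 1`. -/
theorem fieldSq_add_le (hM : 0 < M) (h : ReducedSystem M D K e b) (hr : 2 * M < r) {c : ℝ}
    (hc : c ^ 2 = 1) :
    2 * (sphereAvg (fieldSq e b) t r + 2 * c * sphereAvg (fieldProd e b) t r)
      ≤ sphereAvg (timeSq D K) t r + sphereAvg (tortoiseSq M D K) t r
        - 2 * c * sphereAvg (timeTortoise M D K) t r := by
  have hX : ∀ i, Smooth M fun x => e i x + c * b i x :=
    fun i => (h.smooth_e i).add ((Smooth.const c).mul (h.smooth_b i))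
  have hn : ∀ x ∈ exterior M, dot3 (unitNormal x) (fun i => e i x + c * b i x) = 0 :=
    fun x hx => by
      have h1 := h.normal_e x hx
      have h2 := h.normal_b x hx
      simp only [dot3] at *
      linear_combination h1 + c * h2
  -- The elliptic estimate is applied to a null component. By the reduced system, the angular
  -- divergences of `e + c b` and of its rotation are (∂_t - c ∂_{r*}) K and c (∂_t - c ∂_{r*}) D.
  have key := two_mul_sphereAvg_normSq_le (t := t) (X := fun i x => e i x + c * b i x) hM hX hn hr
  have e1 := sphereAvg_radial₃ (t := t) hM hr (fun _ => 1) (fun _ => 2 * c) (fun _ => 0)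
    h.smooth_fieldSq h.smooth_fieldProd h.smooth_fieldSq
  have e2 := sphereAvg_radial₃ (t := t) hM hr (fun _ => 1) (fun _ => 1) (fun _ => -(2 * c))
    h.smooth_timeSq (h.smooth_tortoiseSq hM) (h.smooth_timeTortoise hM)
  have c1 : sphereAvg (fun x => dot3 (fun i => e i x + c * b i x) (fun i => e i x + c * b i x)) t r
      = sphereAvg (fun x => 1 * fieldSq e b x + 2 * c * fieldProd e b x + 0 * fieldSq e b x) t r :=
    sphereAvg_congr hM hr fun x _ => by
      simp only [dot3, fieldSq, fieldProd]
      linear_combination (b 0 x ^ 2 + b 1 x ^ 2 + b 2 x ^ 2) * hc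
  have hdiv : ∀ {X Y : Fin 3 → Pt → ℝ}, (∀ i, Smooth M (X i)) → (∀ i, Smooth M (Y i)) →
      ∀ x ∈ exterior M, rotDiv (fun i x => X i x + c * Y i x) x = rotDiv X x + c * rotDiv Y x := by
    intro X Y hX hY x hx
    have hcs := Smooth.const (M := M) c
    have hz : ∀ i : Fin 3, rot i (fun _ => c) x = 0 := fun i => by
      have : ∀ a, pd a (fun _ => c) x = 0 := fun a => (HasGrad.const c).pd_eq a
      simp [rot, this]
    simp only [rotDiv, rot_add (hX _) (hcs.mul (hY _)) hx, rot_mul hcs (hY _) hx, hz]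
    ring
  have hcr : crossN (fun i x => e i x + c * b i x)
      = fun i x => crossN e i x + c * crossN b i x := by
    funext i x
    simp only [crossN, cross_apply]
    fin_cases i <;> simp <;> ring
  have c2 : sphereAvg (fun x => rotDiv (fun i x => e i x + c * b i x) x
        * rotDiv (fun i x => e i x + c * b i x) x
        + rotDiv (crossN (fun i x => e i x + c * b i x)) x
          * rotDiv (crossN (fun i x => e i x + c * b i x)) x) t r
      = sphereAvg (fun x => 1 * timeSq D K x + 1 * tortoiseSq M D K x
        + -(2 * c) * timeTortoise M D K x) t r :=
    sphereAvg_congr hM hr fun x hx => by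
      have r1 : tortoiseD M D x = -rotDiv (crossN e) x := h.radial_D x hx
      have r2 : tortoiseD M K x = -rotDiv b x := h.radial_K x hx
      rw [hcr, hdiv h.smooth_e h.smooth_b x hx,
        hdiv (Smooth.crossN hM h.smooth_e) (Smooth.crossN hM h.smooth_b) x hx]
      simp only [timeSq, tortoiseSq, timeTortoise, h.time_D x hx, h.time_K x hx, r1, r2]
      linear_combination (rotDiv b x ^ 2 + rotDiv (crossN b) x ^ 2 - 0) * hc
  rw [c1, c2, e1, e2] at key
  linarith

/-- The Cauchy-Schwarz inequality for the pairings. -/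
theorem pairing_nonneg (hM : 0 < M) (h : ReducedSystem M D K e b) (hr : 2 * M < r) {c : ℝ}
    (hc : c ^ 2 = 1) (s : ℝ) :
    0 ≤ s ^ 2 * sphereAvg (angularSq D K) t r + 2 * s * (sphereAvg (timePairing D K e b) t r
        + c * sphereAvg (radialPairing D K e b) t r)
      + 2 * (sphereAvg (fieldSq e b) t r + 2 * c * sphereAvg (fieldProd e b) t r) := by
  have e1 := sphereAvg_radial₅ (t := t) hM hr (fun _ => s ^ 2) (fun _ => 2 * s)
    (fun _ => 2 * s * c) (fun _ => 2) (fun _ => 4 * c) h.smooth_angularSq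
    (h.smooth_timePairing hM) (h.smooth_radialPairing hM) h.smooth_fieldSq h.smooth_fieldProd
  have h0 : 0 ≤ sphereAvg (fun x => s ^ 2 * angularSq D K x + 2 * s * timePairing D K e b x
      + 2 * s * c * radialPairing D K e b x + 2 * fieldSq e b x + 4 * c * fieldProd e b x) t r := by
    refine sphereAvg_nonneg hM hr fun x hx => ?_
    have hn := unitNormal_sq_sum hM hx
    have n1 := h.normal_e x hx
    have n2 := h.normal_b x hx
    have hcr : ∀ i, crossN b i x + c * crossN e i x
        = (unitNormal x ⨯₃ fun j => b j x + c * e j x) i := fun i => by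
      simp only [crossN, cross_apply]
      fin_cases i <;> simp <;> ring
    have hsq : (crossN b 0 x + c * crossN e 0 x) ^ 2 + (crossN b 1 x + c * crossN e 1 x) ^ 2
        + (crossN b 2 x + c * crossN e 2 x) ^ 2
        = (b 0 x + c * e 0 x) ^ 2 + (b 1 x + c * e 1 x) ^ 2 + (b 2 x + c * e 2 x) ^ 2 := by
      have n3 : unitNormal x 0 * (b 0 x + c * e 0 x) + unitNormal x 1 * (b 1 x + c * e 1 x)
          + unitNormal x 2 * (b 2 x + c * e 2 x) = 0 := by
        simp only [dot3] at n1 n2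
        linear_combination n2 + c * n1
      simp only [hcr, cross_apply]
      simp
      generalize b 0 x + c * e 0 x = v0 at *
      generalize b 1 x + c * e 1 x = v1 at *
      generalize b 2 x + c * e 2 x = v2 at *
      linear_combination (v0 ^ 2 + v1 ^ 2 + v2 ^ 2) * hn
        - (unitNormal x 0 * v0 + unitNormal x 1 * v1 + unitNormal x 2 * v2) * n3
    -- A sum of squares, because `crossN` preserves the length of tangential vectors (`hsq`) and |b
    -- + c e| = |e + c b| when c² = 1.
    have key : s ^ 2 * angularSq D K x + 2 * s * timePairing D K e b x
        + 2 * s * c * radialPairing D K e b x + 2 * fieldSq e b x + 4 * c * fieldProd e b x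
        = (s * rot 0 D x + (crossN b 0 x + c * crossN e 0 x)) ^ 2
          + (s * rot 1 D x + (crossN b 1 x + c * crossN e 1 x)) ^ 2
          + (s * rot 2 D x + (crossN b 2 x + c * crossN e 2 x)) ^ 2
          + (s * rot 0 K x + (e 0 x + c * b 0 x)) ^ 2 + (s * rot 1 K x + (e 1 x + c * b 1 x)) ^ 2
          + (s * rot 2 K x + (e 2 x + c * b 2 x)) ^ 2 := by
      simp only [angularSq, rotNormSq, timePairing, radialPairing, fieldSq, fieldProd, dot3]
      linear_combination (-1) * hsq - (b 0 x ^ 2 + b 1 x ^ 2 + b 2 x ^ 2 + e 0 x ^ 2 + e 1 x ^ 2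
        + e 2 x ^ 2) * hc
    rw [key]
    positivity
  rw [e1] at h0
  linarith

theorem fieldSq_add_nonneg (hM : 0 < M) (h : ReducedSystem M D K e b) (hr : 2 * M < r) {c : ℝ}
    (hc : c ^ 2 = 1) :
    0 ≤ sphereAvg (fieldSq e b) t r + 2 * c * sphereAvg (fieldProd e b) t r := by
  have := h.pairing_nonneg (t := t) hM hr hc 0
  linarith

end ReducedSystem

theorem sphereAvg_timeSq_nonneg (hM : 0 < M) (hr : 2 * M < r) :
    0 ≤ sphereAvg (timeSq D K) t r :=
  sphereAvg_nonneg hM hr fun _ _ => add_nonneg (mul_self_nonneg _) (mul_self_nonneg _)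

theorem sphereAvg_tortoiseSq_nonneg (hM : 0 < M) (hr : 2 * M < r) :
    0 ≤ sphereAvg (tortoiseSq M D K) t r :=
  sphereAvg_nonneg hM hr fun _ _ => add_nonneg (mul_self_nonneg _) (mul_self_nonneg _)

theorem sphereAvg_angularSq_nonneg (hM : 0 < M) (hr : 2 * M < r) :
    0 ≤ sphereAvg (angularSq D K) t r :=
  sphereAvg_nonneg hM hr fun x _ => by
    simp only [angularSq, rotNormSq]
    positivity

theorem sphereAvg_fieldSq_nonneg (hM : 0 < M) (hr : 2 * M < r) :
    0 ≤ sphereAvg (fieldSq e b) t r :=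
  sphereAvg_nonneg hM hr fun x _ => by
    simp only [fieldSq, dot3]
    nlinarith [mul_self_nonneg (e 0 x), mul_self_nonneg (e 1 x), mul_self_nonneg (e 2 x),
      mul_self_nonneg (b 0 x), mul_self_nonneg (b 1 x), mul_self_nonneg (b 2 x)]

end AverageBounds

/-! ### Domination of the Morawetz current and positivity of its source -/

section Multiplier

variable {M : ℝ} {D K : Pt → ℝ} {e b : Fin 3 → Pt → ℝ}

/-- The density of the weighted bulk integral, times `r²`. -/
def bulkDensity (M : ℝ) (D K : Pt → ℝ) (e b : Fin 3 → Pt → ℝ) (x : Pt) : ℝ :=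
  M / radius x * (1 - 3 * (M / radius x)) ^ 2 / radius x * timeSq D K x
    + M / radius x / radius x * tortoiseSq M D K x
    + (1 - 3 * (M / radius x)) ^ 2 / radius x ^ 3 * angularSq D K x
    + 2 * (M / radius x) / (25 * radius x) * fieldSq e b x

namespace ReducedSystem

theorem sphereAvg_energyDensity (hM : 0 < M) (h : ReducedSystem M D K e b) {t r : ℝ}
    (hr : 2 * M < r) : sphereAvg (energyDensity M D K) t r
      = (lapse M r)⁻¹ * (1 / 2 * (sphereAvg (timeSq D K) t r + sphereAvg (tortoiseSq M D K) t r
        + lapse M r / r ^ 2 * sphereAvg (angularSq D K) t r)) := by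
  have e1 := sphereAvg_radial₃ (t := t) hM hr (fun r => (lapse M r)⁻¹ * (1 / 2))
    (fun r => (lapse M r)⁻¹ * (1 / 2)) (fun r => (lapse M r)⁻¹ * (1 / 2) * (lapse M r / r ^ 2))
    h.smooth_timeSq (h.smooth_tortoiseSq hM) h.smooth_angularSq
  have e2 : sphereAvg (energyDensity M D K) t r = _ := sphereAvg_congr hM hr fun x _ => by
    rw [energyDensity, ← mul_assoc, mul_add, mul_add, ← mul_assoc]
  rw [e2, e1]
  ring

theorem energyDensity_sub (hM : 0 < M) (h : ReducedSystem M D K e b) {t r : ℝ}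
    (hr : 2 * M < r) (c : ℝ) : sphereAvg (energyDensity M D K) t r
      - c * ((lapse M r)⁻¹ * sphereAvg (timeTortoise M D K) t r)
      = (lapse M r)⁻¹ * (1 / 2 * ((sphereAvg (timeSq D K) t r + sphereAvg (tortoiseSq M D K) t r
          - 2 * c * sphereAvg (timeTortoise M D K) t r)
        + lapse M r / r ^ 2 * sphereAvg (angularSq D K) t r)) := by
  rw [h.sphereAvg_energyDensity hM hr]
  ring

/-- The derivative part is a square along one null direction; here its positivity is read off from
the chain 0 ≤ 2X ≤ P of field estimates. -/
theorem energyDensity_sub_nonneg (hM : 0 < M) (h : ReducedSystem M D K e b) {t r : ℝ}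
    (hr : 2 * M < r) {c : ℝ} (hc : c ^ 2 = 1) : 0 ≤ sphereAvg (energyDensity M D K) t r
      - c * ((lapse M r)⁻¹ * sphereAvg (timeTortoise M D K) t r) := by
  have hl := lapse_pos hM hr
  have h1 := h.fieldSq_add_le (t := t) hM hr hc
  have h2 := h.fieldSq_add_nonneg (t := t) hM hr hc
  have h3 : 0 ≤ lapse M r / r ^ 2 * sphereAvg (angularSq D K) t r :=
    mul_nonneg (by positivity) (sphereAvg_angularSq_nonneg hM hr)
  rw [h.energyDensity_sub hM hr]
  exact mul_nonneg (by positivity) (by linarith)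

theorem energyLaw (hM : 0 < M) (h : ReducedSystem M D K e b) :
    EnergyLaw (2 * M) (lapse M) (sphereAvg (energyDensity M D K))
      (sphereAvg (timeTortoise M D K)) where
  law := by
    have hb := (h.energy_law hM).balanceLaw hM
    have : sphereAvg (fun _ => (0 : ℝ)) = fun _ _ => 0 := by
      funext t r
      simp [sphereAvg]
    rwa [this] at hb
  outgoing t r hr := by
    have := h.energyDensity_sub_nonneg (t := t) hM hr (c := -1) (by norm_num)
    linarith
  ingoing t r hr := by
    have := h.energyDensity_sub_nonneg (t := t) hM hr (c := 1) (by norm_num)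
    linarith

/-- The Morawetz current: a balance law dominated by the energy whose source bounds the bulk. -/
theorem exists_morawetz (hM : 0 < M) (h : ReducedSystem M D K e b) :
    ∃ j v κ : ℝ → ℝ → ℝ, BalanceLaw (2 * M) j v κ ∧
      Dominated (2 * M) (lapse M) (36 / 5) (sphereAvg (energyDensity M D K))
        (sphereAvg (timeTortoise M D K)) j v ∧
      ∀ t r, 2 * M < r → sphereAvg (bulkDensity M D K e b) t r ≤ κ t r := by
  refine ⟨_, _, _, (h.morawetz_law hM).balanceLaw hM, ?_, ?_⟩
  · have key : ∀ t r c : ℝ, 2 * M < r → c ^ 2 = 1 → ∀ P V : ℝ,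
        P = sphereAvg (energyDensity M D K) t r
          - c * ((lapse M r)⁻¹ * sphereAvg (timeTortoise M D K) t r) →
        V = (lapse M r)⁻¹ * (-(36 / 5 * (1 - 3 * (M / r)))) * sphereAvg (timeTortoise M D K) t r
          + (lapse M r)⁻¹ * (9 * (36 / 5) * (M / r) ^ 2 * (1 - 2 * (M / r))
          * (1 - 3 / 2 * (M / r)) / r) * sphereAvg (timePairing D K e b) t r
          + (lapse M r)⁻¹ * (9 * (36 / 5) * (M / r) ^ 2
          * (3 - 14 * (M / r) + 15 * (M / r) ^ 2)) * sphereAvg (fieldProd e b) t r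
          - c * ((lapse M r)⁻¹ * (-(1 / 2 * (36 / 5 * (1 - 3 * (M / r))))
          * sphereAvg (timeSq D K) t r
        + -(1 / 2 * (36 / 5 * (1 - 3 * (M / r)))) * sphereAvg (tortoiseSq M D K) t r
        + 1 / 2 * (36 / 5 * (1 - 3 * (M / r))) * ((1 - 2 * (M / r)) / r ^ 2)
          * sphereAvg (angularSq D K) t r
        + -(9 * (36 / 5) * (M / r) ^ 2 * (1 - 2 * (M / r))
          * (1 - 3 / 2 * (M / r)) / r) * sphereAvg (radialPairing D K e b) t r
        + -(1 / 2 * (9 * (36 / 5) * (M / r) ^ 2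
          * (3 - 14 * (M / r) + 15 * (M / r) ^ 2))) * sphereAvg (fieldSq e b) t r)) →
        |V| ≤ 36 / 5 * P := by
      intro t r c hr hc P V hP hV
      have hr0 : 0 < r := by linarith
      have hl := lapse_pos hM hr
      have hu' : M / r < 1 / 2 := by rw [div_lt_iff₀ hr0]; linarith
      have hf : lapse M r = 1 - 2 * (M / r) := by rw [lapse]; ring
      -- The choices c = -1 and c = 1 are the outgoing and ingoing directions. The sign -c in `Y`
      -- makes both cases instances of one inequality, up to the overall sign of the current.
      have hmul := abs_multiplier_le (div_pos hM hr0) hu' hr0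
        (sphereAvg_angularSq_nonneg (D := D) (K := K) (t := t) hM hr)
        (h.fieldSq_add_nonneg (t := t) hM hr hc) (h.fieldSq_add_le (t := t) hM hr hc)
        (Y := -c * (sphereAvg (timePairing D K e b) t r
          + c * sphereAvg (radialPairing D K e b) t r)) fun s => by
          have := h.pairing_nonneg (t := t) hM hr hc (-c * s)
          rw [mul_pow, neg_sq, hc] at this
          linarith
      have hce : c = 1 ∨ c = -1 := by grind
      rw [hP, h.energyDensity_sub hM hr, ← mul_assoc, mul_comm (36 / 5 : ℝ), mul_assoc]
      rw [← hf] at hmul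
      refine le_trans (le_of_eq ?_) (mul_le_mul_of_nonneg_left hmul (inv_pos.2 hl).le)
      rw [← abs_of_pos (inv_pos.2 hl), ← abs_mul, hV, hf]
      rcases hce with rfl | rfl
      · rw [← abs_neg]
        congr 1
        ring
      · congr 1
        ring
    intro t r hr
    have ej := sphereAvg_radial₃ (t := t) hM hr
      (fun r => (lapse M r)⁻¹ * (-(36 / 5 * (1 - 3 * (M / r)))))
      (fun r => (lapse M r)⁻¹ * (9 * (36 / 5) * (M / r) ^ 2 * (1 - 2 * (M / r))
        * (1 - 3 / 2 * (M / r)) / r))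
      (fun r => (lapse M r)⁻¹ * (9 * (36 / 5) * (M / r) ^ 2
        * (3 - 14 * (M / r) + 15 * (M / r) ^ 2)))
      (h.smooth_timeTortoise hM) (h.smooth_timePairing hM) h.smooth_fieldProd
    have ev := sphereAvg_radial₅ (t := t) hM hr
      (fun r => -(1 / 2 * (36 / 5 * (1 - 3 * (M / r)))))
      (fun r => -(1 / 2 * (36 / 5 * (1 - 3 * (M / r)))))
      (fun r => 1 / 2 * (36 / 5 * (1 - 3 * (M / r))) * ((1 - 2 * (M / r)) / r ^ 2))
      (fun r => -(9 * (36 / 5) * (M / r) ^ 2 * (1 - 2 * (M / r)) * (1 - 3 / 2 * (M / r)) / r))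
      (fun r => -(1 / 2 * (9 * (36 / 5) * (M / r) ^ 2 * (3 - 14 * (M / r) + 15 * (M / r) ^ 2))))
      h.smooth_timeSq (h.smooth_tortoiseSq hM) h.smooth_angularSq (h.smooth_radialPairing hM)
      h.smooth_fieldSq
    rw [ej, ev]
    exact ⟨key t r (-1) hr (by norm_num) _ _ (by ring) (by ring),
      key t r 1 hr (by norm_num) _ _ (by ring) (by ring)⟩
  · intro t r hr
    have hr0 : 0 < r := by linarith
    have hu' : M / r < 1 / 2 := by rw [div_lt_iff₀ hr0]; linarith
    have eb := sphereAvg_radial₄ (t := t) hM hr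
      (fun r => M / r * (1 - 3 * (M / r)) ^ 2 / r) (fun r => M / r / r)
      (fun r => (1 - 3 * (M / r)) ^ 2 / r ^ 3) (fun r => 2 * (M / r) / (25 * r))
      h.smooth_timeSq (h.smooth_tortoiseSq hM) h.smooth_angularSq h.smooth_fieldSq
    have es := sphereAvg_radial₄ (t := t) hM hr
      (fun r => 3 / 2 * (36 / 5) * (M / r) * (1 - 3 * (M / r)) ^ 2 / r)
      (fun r => (3 / 2 * (36 / 5) * (M / r) + 9 * (36 / 5) * (M / r) ^ 2
        * (1 - 3 / 2 * (M / r))) / r)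
      (fun r => 36 / 5 * (1 - 3 * (M / r)) ^ 2 * (1 - 3 / 2 * (M / r) + 3 * (M / r) ^ 2) / r ^ 3)
      (fun r => -(27 * (36 / 5) * (M / r) ^ 2 * (1 - 2 * (M / r)) * (1 - 5 * (M / r)) / r))
      h.smooth_timeSq (h.smooth_tortoiseSq hM) h.smooth_angularSq h.smooth_fieldSq
    have eb' : sphereAvg (bulkDensity M D K e b) t r = _ := eb
    rw [eb', es]
    -- The mean of the estimates for c = 1 and c = -1 removes the mixed products and leaves 2 NN ≤
    -- TT + XX.
    have h1 := h.fieldSq_add_le (t := t) hM hr (c := 1) (by norm_num)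
    have h2 := h.fieldSq_add_le (t := t) hM hr (c := -1) (by norm_num)
    have := multiplier_source_ge (div_pos hM hr0) hu' hr0
      (sphereAvg_timeSq_nonneg (D := D) (K := K) (t := t) hM hr)
      (sphereAvg_tortoiseSq_nonneg (D := D) (K := K) (t := t) hM hr)
      (sphereAvg_angularSq_nonneg (D := D) (K := K) (t := t) hM hr)
      (sphereAvg_fieldSq_nonneg (e := e) (b := b) (t := t) hM hr) (by linarith)
    linarith

end ReducedSystem

end Multiplier

/-! ### The geometry of spherically symmetric hypersurfaces -/

section Geometry

variable {M : ℝ}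

theorem hasDerivAt_tortoise (hM : 0 < M) {r : ℝ} (hr : 2 * M < r) :
    HasDerivAt (tortoise M) (lapse M r)⁻¹ r := by
  have h0 : r / (2 * M) - 1 ≠ 0 := by
    have : 1 < r / (2 * M) := by rw [lt_div_iff₀ (by linarith)]; linarith
    linarith
  have h1 := (((hasDerivAt_id r).div_const (2 * M)).sub_const 1).log h0
  refine ((hasDerivAt_id r).add (h1.const_mul (2 * M))).congr_deriv ?_
  have : r - 2 * M ≠ 0 := by linarith
  have : r ≠ 0 := by linarith
  have hl : lapse M r = (r - 2 * M) / r := by rw [lapse]; field_simp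
  rw [hl]
  have : r / (2 * M) - 1 = (r - 2 * M) / (2 * M) := by field_simp
  simp only [id_eq, this]
  field_simp
  ring

theorem tortoiseChart (hM : 0 < M) : TortoiseChart (2 * M) (lapse M) (tortoise M) where
  pos _ hr := lapse_pos hM hr
  cont := by
    unfold lapse
    exact continuousOn_const.sub (continuousOn_const.div continuousOn_id fun r hr => by
      have : 2 * M < r := hr
      exact (by linarith : r ≠ 0))
  deriv _ hr := hasDerivAt_tortoise hM hr

namespace SphericalHypersurface

theorem spacelikeGraph (hM : 0 < M) (S : SphericalHypersurface M) :
    SpacelikeGraph (2 * M) (lapse M) S.I S.h (deriv S.h) where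
  isOpen := S.isOpen
  ordConnected := S.ordConnected
  subset := S.subset
  deriv _ hr := S.hasDerivAt hr
  cont := S.smooth.continuousOn_deriv_of_isOpen S.isOpen (by simp)
  spacelike r hr := by
    have hl := lapse_pos hM (S.subset hr)
    refine abs_lt_of_sq_lt_sq ?_ (inv_pos.2 hl).le
    have h := S.spacelike r hr
    rw [← sub_neg]
    have e : deriv S.h r ^ 2 - (lapse M r)⁻¹ ^ 2
        = (lapse M r)⁻¹ * (lapse M r * deriv S.h r ^ 2 - (lapse M r)⁻¹) := by
      field_simp
    rw [e]
    exact mul_neg_of_pos_of_neg (inv_pos.2 hl) h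

theorem radialNullGeodesic_inter_nonempty_iff (hM : 0 < M) (S : SphericalHypersurface M)
    {s c : ℝ} {e : Fin 3 → ℝ} (he : ∑ i, e i ^ 2 = 1) :
    (radialNullGeodesic M s c e ∩ S.carrier).Nonempty
      ↔ ∃ r ∈ S.I, S.h r = c + s * tortoise M r := by
  have he' : e ∈ unitSphere := by
    rw [Fin.sum_univ_three] at he
    exact he
  have hrad : ∀ {r : ℝ}, 2 * M < r →
      radius (Matrix.vecCons (c + s * tortoise M r) (r • e)) = r := fun hr =>
    radius_polarPoint (by linarith) he'
  constructor
  · rintro ⟨x, ⟨r, hr, rfl⟩, hx, hx'⟩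
    rw [hrad hr] at hx hx'
    exact ⟨r, hx, hx'.symm⟩
  · rintro ⟨r, hr, h⟩
    have hr' : 2 * M < r := S.subset hr
    refine ⟨_, ⟨r, hr', rfl⟩, ?_, ?_⟩
    · rwa [hrad hr']
    · rw [hrad hr', h]
      rfl

end SphericalHypersurface

/-- The surfaces are spherically symmetric, so one direction on the sphere carries all the
information. -/
theorem Bounds.exists_radius_iff (hM : 0 < M) {S₁ S₂ : SphericalHypersurface M}
    (h : Bounds S₁ S₂) {s : ℝ} (hs : s = 1 ∨ s = -1) (c : ℝ) :
    (∃ r ∈ S₁.I, S₁.h r = c + s * tortoise M r) ↔ ∃ r ∈ S₁.I, S₂.h r = c + s * tortoise M r := by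
  have he : ∑ i, (![1, 0, 0] : Fin 3 → ℝ) i ^ 2 = 1 := by simp [Fin.sum_univ_three]
  have := h.no_further_boundary s hs c _ he
  rwa [S₁.radialNullGeodesic_inter_nonempty_iff hM he,
    S₂.radialNullGeodesic_inter_nonempty_iff hM he, ← h.same_radii] at this

end Geometry

/-! ### Integration over hypersurfaces and regions -/

section Integration

theorem measurable_indicator_ofReal {α : Type*} [TopologicalSpace α] [MeasurableSpace α]
    [OpensMeasurableSpace α] {s : Set α} {g : α → ℝ} (hs : IsOpen s) (hg : ContinuousOn g s) :
    Measurable (s.indicator fun x => ENNReal.ofReal (g x)) := by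
  classical
  rw [← piecewise_eq_indicator]
  exact ContinuousOn.measurable_piecewise (ENNReal.continuous_ofReal.comp_continuousOn hg)
    continuousOn_const hs.measurableSet

theorem spatialRadius_smul {r : ℝ} (hr : 0 ≤ r) {θ : Fin 3 → ℝ} (hθ : θ ∈ unitSphere) :
    SphericalHypersurface.spatialRadius (r • θ) = r :=
  radius_polarPoint (t := 0) hr hθ

theorem continuous_spatialRadius : Continuous SphericalHypersurface.spatialRadius := by
  unfold SphericalHypersurface.spatialRadius
  fun_prop

theorem lintegral_shell {I : Set ℝ} (hI : IsOpen I) (h0 : I ⊆ Ioi 0) {g : (Fin 3 → ℝ) → ℝ}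
    (hg : ContinuousOn g {y | SphericalHypersurface.spatialRadius y ∈ I}) :
    ∫⁻ y in {y | SphericalHypersurface.spatialRadius y ∈ I}, ENNReal.ofReal (g y)
      = ∫⁻ r in I, ENNReal.ofReal (r ^ 2)
        * ∫⁻ θ in unitSphere, ENNReal.ofReal (g (r • θ)) ∂sphereMeasure := by
  have ho : IsOpen {y | SphericalHypersurface.spatialRadius y ∈ I} :=
    hI.preimage continuous_spatialRadius
  have e : volume.restrict I = volume.restrict (I ∩ Ioi 0) := by
    rw [inter_eq_self_of_subset_left h0]
  rw [← lintegral_indicator ho.measurableSet, lintegral_polar (measurable_indicator_ofReal ho hg),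
    e, ← setLIntegral_indicator hI.measurableSet]
  refine setLIntegral_congr_fun measurableSet_Ioi fun r hr => ?_
  have hr0 : (0 : ℝ) ≤ r := le_of_lt hr
  by_cases hrI : r ∈ I
  · simp only [indicator_of_mem hrI]
    congr 1
    refine setLIntegral_congr_fun isCompact_unitSphere.measurableSet fun θ hθ => ?_
    exact indicator_of_mem (by simpa [spatialRadius_smul hr0 hθ] using hrI) _
  · simp only [indicator_of_notMem hrI]
    rw [setLIntegral_congr_fun isCompact_unitSphere.measurableSet (g := fun _ => 0)]
    · simp
    · exact fun θ hθ => indicator_of_notMem (by simpa [spatialRadius_smul hr0 hθ] using hrI) _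

/-- The radius is the outer variable because Ω is fibred over `I` by intervals of time. -/
theorem lintegral_spacetime_polar {f : Pt → ℝ≥0∞} (hf : Measurable f) :
    ∫⁻ x, f x = ∫⁻ r in Ioi (0 : ℝ), ∫⁻ t, ENNReal.ofReal (r ^ 2)
      * ∫⁻ θ in unitSphere, f (polarPoint t r θ) ∂sphereMeasure := by
  have hmp := (volume_preserving_piFinSuccAbove (fun _ : Fin 4 => ℝ) 0).symm
  have hcons : ∀ p : ℝ × (Fin 3 → ℝ),
      (MeasurableEquiv.piFinSuccAbove (fun _ : Fin 4 => ℝ) 0).symm p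
        = Matrix.vecCons p.1 p.2 := fun p => by
    simp [MeasurableEquiv.piFinSuccAbove, Fin.insertNthEquiv]
    rfl
  have hcm : Measurable fun p : ℝ × (Fin 3 → ℝ) => (Matrix.vecCons p.1 p.2 : Pt) := by
    simp_rw [← hcons]
    exact MeasurableEquiv.measurable _
  have hfm : Measurable fun p : ℝ × (Fin 3 → ℝ) => f (Matrix.vecCons p.1 p.2) := hf.comp hcm
  rw [← hmp.lintegral_comp hf]
  simp_rw [hcons]
  rw [Measure.volume_eq_prod, lintegral_prod _ hfm.aemeasurable]
  have e : ∀ t : ℝ, ∫⁻ y : Fin 3 → ℝ, f (Matrix.vecCons t y) = ∫⁻ r in Ioi (0 : ℝ),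
      ENNReal.ofReal (r ^ 2) * ∫⁻ θ in unitSphere, f (polarPoint t r θ) ∂sphereMeasure :=
    fun t => lintegral_polar (f := fun y => f (Matrix.vecCons t y))
      (hfm.comp (measurable_const.prodMk measurable_id))
  simp_rw [e]
  refine lintegral_lintegral_swap (Measurable.aemeasurable ?_)
  refine (by fun_prop : Measurable fun p : ℝ × ℝ => ENNReal.ofReal (p.2 ^ 2)).mul ?_
  refine Measurable.lintegral_prod_right' (f := fun q : (ℝ × ℝ) × (Fin 3 → ℝ) =>
    f (polarPoint q.1.1 q.1.2 q.2)) ?_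
  exact hfm.comp (by fun_prop : Measurable fun q : (ℝ × ℝ) × (Fin 3 → ℝ) =>
    ((q.1.1, q.1.2 • q.2) : ℝ × (Fin 3 → ℝ)))

end Integration

/-! ### Superenergy and bulk term as integrals over the half-plane -/

section Reduction

variable {M : ℝ} {F : Tensor2} {E B : Fin 3 → Pt → ℝ}

theorem ReducedSystem.continuousOn_energyDensity {D K : Pt → ℝ} {e b : Fin 3 → Pt → ℝ}
    (hM : 0 < M) (h : ReducedSystem M D K e b) :
    ContinuousOn (energyDensity M D K) (exterior M) := by
  have hr : ∀ x ∈ exterior M, radius x ≠ 0 := fun x hx => (radius_pos hM hx).ne'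
  have hl : ContinuousOn (fun x => lapse M (radius x)) (exterior M) :=
    (tortoiseChart hM).cont.comp continuous_radius.continuousOn fun _ hx => hx
  have hl0 : ∀ x ∈ exterior M, lapse M (radius x) ≠ 0 := fun x hx => (lapse_pos hM hx).ne'
  have hc := continuous_radius.continuousOn (s := exterior M)
  exact (hl.inv₀ hl0).mul (continuousOn_const.mul
    ((h.smooth_timeSq.continuousOn.add (h.smooth_tortoiseSq hM).continuousOn).add
      ((hl.div (hc.pow 2) fun x hx => pow_ne_zero 2 (hr x hx)).mul
        h.smooth_angularSq.continuousOn)))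

theorem ReducedSystem.continuousOn_bulkDensity {D K : Pt → ℝ} {e b : Fin 3 → Pt → ℝ}
    (hM : 0 < M) (h : ReducedSystem M D K e b) :
    ContinuousOn (bulkDensity M D K e b) (exterior M) := by
  have hr : ∀ x ∈ exterior M, radius x ≠ 0 := fun x hx => (radius_pos hM hx).ne'
  have hc := continuous_radius.continuousOn (s := exterior M)
  have hu : ContinuousOn (fun x => M / radius x) (exterior M) := continuousOn_const.div hc hr
  have hv : ContinuousOn (fun x => (1 - 3 * (M / radius x)) ^ 2) (exterior M) :=
    (continuousOn_const.sub (continuousOn_const.mul hu)).pow 2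
  refine (((((hu.mul hv).div hc hr).mul h.smooth_timeSq.continuousOn).add
    ((hu.div hc hr).mul (h.smooth_tortoiseSq hM).continuousOn)).add
    ((hv.div (hc.pow 3) fun x hx => pow_ne_zero 3 (hr x hx)).mul
      h.smooth_angularSq.continuousOn)).add
    (((continuousOn_const.mul hu).div (continuousOn_const.mul hc) fun x hx => ?_).mul
      h.smooth_fieldSq.continuousOn)
  exact mul_ne_zero (by norm_num) (hr x hx)

theorem rotNormSq_nonneg (u : Pt → ℝ) (x : Pt) : 0 ≤ rotNormSq u x := by
  unfold rotNormSq
  positivity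

theorem bulkDensity_nonneg (hM : 0 < M) {x : Pt} (hx : x ∈ exterior M) {D K : Pt → ℝ}
    {e b : Fin 3 → Pt → ℝ} : 0 ≤ bulkDensity M D K e b x := by
  have hr := radius_pos hM hx
  have h1 : 0 ≤ timeSq D K x := add_nonneg (mul_self_nonneg _) (mul_self_nonneg _)
  have h2 : 0 ≤ tortoiseSq M D K x := add_nonneg (mul_self_nonneg _) (mul_self_nonneg _)
  have hd : ∀ v : Fin 3 → ℝ, 0 ≤ dot3 v v := fun v =>
    add_nonneg (add_nonneg (mul_self_nonneg _) (mul_self_nonneg _)) (mul_self_nonneg _)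
  have h3 : 0 ≤ angularSq D K x :=
    add_nonneg (rotNormSq_nonneg D x) (rotNormSq_nonneg K x)
  have h4 : 0 ≤ fieldSq e b x := add_nonneg (hd _) (hd _)
  unfold bulkDensity
  positivity

/-- The dominant energy condition before averaging. It is needed pointwise in order to move
`ENNReal.ofReal` out of the integral over the sphere. -/
theorem energyDensity_add_nonneg (hM : 0 < M) {x : Pt} (hx : x ∈ exterior M) {D K : Pt → ℝ}
    {c : ℝ} (hc : |c| ≤ (lapse M (radius x))⁻¹) :
    0 ≤ energyDensity M D K x + c * timeTortoise M D K x := by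
  have hl := lapse_pos hM hx
  have hr := radius_pos hM hx
  have h3 : 0 ≤ angularSq D K x :=
    add_nonneg (rotNormSq_nonneg D x) (rotNormSq_nonneg K x)
  have h4 : 0 ≤ lapse M (radius x) / radius x ^ 2 * angularSq D K x := by positivity
  have h5 : |c * timeTortoise M D K x|
      ≤ (lapse M (radius x))⁻¹ * (1 / 2 * (timeSq D K x + tortoiseSq M D K x)) := by
    rw [abs_mul]
    refine mul_le_mul hc (abs_le.2 ⟨?_, ?_⟩) (abs_nonneg _) (inv_pos.2 hl).le
    · simp only [timeTortoise, timeSq, tortoiseSq]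
      nlinarith [sq_nonneg (pd 0 D x + tortoiseD M D x), sq_nonneg (pd 0 K x + tortoiseD M K x)]
    · simp only [timeTortoise, timeSq, tortoiseSq]
      nlinarith [sq_nonneg (pd 0 D x - tortoiseD M D x), sq_nonneg (pd 0 K x - tortoiseD M K x)]
  have h6 := (abs_le.1 h5).1
  have h7 := mul_nonneg (inv_pos.2 hl).le h4
  simp only [energyDensity]
  linarith

theorem SphericalHypersurface.flux_eq_energyDensity (hM : 0 < M) (S : SphericalHypersurface M)
    {y : Fin 3 → ℝ} (hy : y ∈ S.domain) (h : MaxwellEB M E B)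
    (hF : ∀ z ∈ exterior M, F z = ofEB (fun i => E i z) (fun i => B i z)) :
    S.fluxIntegrand F xi (S.embed y) * S.inducedVolDensity y
      = 1 / (9 * spatialRadius y ^ 2)
        * (energyDensity M (radialScalar E) (radialScalar B) (S.embed y)
        + deriv S.h (spatialRadius y)
          * timeTortoise M (radialScalar E) (radialScalar B) (S.embed y)) := by
  have hl := (lapse_pos hM (S.subset hy)).ne'
  rw [S.flux_eq_radialScalar hM hy h hF rfl rfl rfl]
  simp only [energyDensity, timeSq, tortoiseSq, timeTortoise, angularSq, tortoiseD, radius_embed]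
  congr 1
  field_simp

/-- The factor (9r²)⁻¹ from |β|² meets the r² of polar coordinates, and only 1/9 survives. -/
theorem SphericalHypersurface.energy_eq (hM : 0 < M) (S : SphericalHypersurface M)
    (h : MaxwellEB M E B)
    (hF : ∀ z ∈ exterior M, F z = ofEB (fun i => E i z) (fun i => B i z)) :
    S.energy F = ENNReal.ofReal (1 / 9)
      * graphEnergy (sphereAvg (energyDensity M (radialScalar E) (radialScalar B)))
        (sphereAvg (timeTortoise M (radialScalar E) (radialScalar B))) S.I S.h (deriv S.h) := by
  have G := S.spacelikeGraph hM
  have R := h.reducedSystem hM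
  have hp := R.continuousOn_energyDensity hM
  have hw := (R.smooth_timeTortoise hM).continuousOn
  set p := energyDensity M (radialScalar E) (radialScalar B) with hpdef
  set w := timeTortoise M (radialScalar E) (radialScalar B) with hwdef
  have h0 : S.I ⊆ Ioi 0 := fun r hr => by
    have : 2 * M < r := S.subset hr
    exact (by linarith : 0 < r)
  have hrad : MapsTo spatialRadius S.domain S.I := fun _ hy => hy
  have hcr := continuous_spatialRadius.continuousOn (s := S.domain)
  have hemb : ContinuousOn S.embed S.domain := by
    refine continuousOn_pi.2 fun i => Fin.cases ?_ (fun j => ?_) i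
    · exact G.continuousOn.comp hcr hrad
    · exact (continuous_apply j).continuousOn
  have hmaps : MapsTo S.embed S.domain (exterior M) := fun _ hy => S.embed_mem hy
  have hcont : ContinuousOn (fun y => 1 / (9 * spatialRadius y ^ 2) * (p (S.embed y)
      + deriv S.h (spatialRadius y) * w (S.embed y))) S.domain := by
    refine (continuousOn_const.div (continuousOn_const.mul (hcr.pow 2)) fun y hy => ?_).mul
      ((hp.comp hemb hmaps).add ((G.cont.comp hcr hrad).mul (hw.comp hemb hmaps)))
    have : 0 < spatialRadius y := h0 hy
    exact (by positivity : 9 * spatialRadius y ^ 2 ≠ 0)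
  have hdm : MeasurableSet S.domain :=
    (S.isOpen.preimage continuous_spatialRadius).measurableSet
  rw [energy, setLIntegral_congr_fun hdm fun y hy => by
    rw [S.flux_eq_energyDensity hM hy h hF], graphEnergy,
    ← lintegral_const_mul' _ _ ENNReal.ofReal_ne_top]
  refine (lintegral_shell S.isOpen h0 hcont).trans
    (setLIntegral_congr_fun S.isOpen.measurableSet fun r hr => ?_)
  have hr2 : 2 * M < r := S.subset hr
  have hr0 : 0 < r := h0 hr
  have hsp := (G.spacelike r hr).le
  have e1 : ∫⁻ θ in unitSphere, ENNReal.ofReal (1 / (9 * spatialRadius (r • θ) ^ 2)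
        * (p (S.embed (r • θ)) + deriv S.h (spatialRadius (r • θ)) * w (S.embed (r • θ))))
          ∂sphereMeasure
      = ∫⁻ θ in unitSphere, ENNReal.ofReal ((fun x => 1 / (9 * r ^ 2) * (p x + deriv S.h r * w x))
        (polarPoint (S.h r) r θ)) ∂sphereMeasure := by
    refine setLIntegral_congr_fun isCompact_unitSphere.measurableSet fun θ hθ => ?_
    simp only [embed, spatialRadius_smul hr0.le hθ, polarPoint]
  have hcx : ContinuousOn (fun x => p x + deriv S.h r * w x) (exterior M) :=
    hp.add (continuousOn_const.mul hw)
  rw [e1, lintegral_sphere_eq_ofReal hM hr2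
    (u := fun x => 1 / (9 * r ^ 2) * (p x + deriv S.h r * w x)) (continuousOn_const.mul hcx),
    sphereAvg_const_mul,
    ← ENNReal.ofReal_mul (by positivity), ← ENNReal.ofReal_mul (by norm_num)]
  · congr 1
    have : sphereAvg (fun x => p x + deriv S.h r * w x) (S.h r) r
        = sphereAvg p (S.h r) r + deriv S.h r * sphereAvg w (S.h r) r := by
      rw [← sphereAvg_const_mul]
      exact integral_add (integrableOn_sphere hM hp hr2)
        (integrableOn_sphere hM (continuousOn_const.mul hw) hr2)
    rw [this, graphFlux]
    field_simp
  · intro θ hθ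
    have := energyDensity_add_nonneg hM (polarPoint_mem (t := S.h r) hM hr2 hθ)
      (D := radialScalar E) (K := radialScalar B) (c := deriv S.h r)
      (by rwa [radius_polarPoint hr0.le hθ])
    positivity

theorem bulk_integrand_eq (hM : 0 < M) {x : Pt} (hx : x ∈ exterior M) (h : MaxwellEB M E B)
    (hF : ∀ z ∈ exterior M, F z = ofEB (fun i => E i z) (fun i => B i z)) :
    (betaDegNormSq M F x + 2 * M / (25 * radius x ^ 4) * ZNormSq M F x)
      * volDensity (metric M) x
      = 1 / (9 * radius x ^ 2) * bulkDensity M (radialScalar E) (radialScalar B) (tangentialE E)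
        (tangentialB M B) x := by
  have hr := (radius_pos hM hx).ne'
  have hn := unitNormal_sq_sum hM hx
  have hE : dot3 (position x ⨯₃ fun i => E i x) (position x ⨯₃ fun i => E i x)
      = dot3 (fun i => tangentialE E i x) (fun i => tangentialE E i x) := by
    have hp := position_eq hM hx
    simp only [dot3, cross_apply, tangentialE, hp]
    simp
    grind
  have hB : dot3 (fun i => tangentialB M B i x) (fun i => tangentialB M B i x)
      = lapse M (radius x) ^ 2
        * dot3 (position x ⨯₃ fun i => B i x) (position x ⨯₃ fun i => B i x) := by
    simp only [dot3, tangentialB]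
    ring
  rw [volDensity_metric hM hx, mul_one, betaDegNormSq_eq hM hx h hF, ZNormSq_eq hM hx (hF x hx), hE,
    ← hB]
  simp only [bulkDensity, timeSq, tortoiseSq, angularSq, fieldSq, tortoiseD]
  field_simp
  ring

theorem morawetzBulk_eq (hM : 0 < M) {S₁ S₂ : SphericalHypersurface M} (hI : S₁.I = S₂.I)
    (h : MaxwellEB M E B)
    (hF : ∀ z ∈ exterior M, F z = ofEB (fun i => E i z) (fun i => B i z)) :
    morawetzBulk M F (regionBetween S₁ S₂) = ENNReal.ofReal (1 / 9)
      * ∫⁻ r in S₁.I, ∫⁻ t in Ioo (S₁.h r) (S₂.h r), ENNReal.ofReal (sphereAvg (bulkDensity M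
        (radialScalar E) (radialScalar B) (tangentialE E) (tangentialB M B)) t r) := by
  have R := h.reducedSystem hM
  have hk := R.continuousOn_bulkDensity hM
  have hk0 : ∀ x ∈ exterior M, 0 ≤ bulkDensity M (radialScalar E) (radialScalar B)
      (tangentialE E) (tangentialB M B) x := fun x hx => bulkDensity_nonneg hM hx
  set κ := bulkDensity M (radialScalar E) (radialScalar B) (tangentialE E) (tangentialB M B)
  have h0 : S₁.I ⊆ Ioi 0 := fun r hr => by
    have : 2 * M < r := S₁.subset hr
    exact (by linarith : 0 < r)
  have hext : regionBetween S₁ S₂ ⊆ exterior M := fun x hx => S₁.subset hx.1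
  -- The half-open conditions defining Ω are continuous only over the radii in `I`, hence the detour
  -- through relatively open preimages.
  have hopen : IsOpen (regionBetween S₁ S₂) := by
    have hU : IsOpen {x : Pt | radius x ∈ S₁.I} := S₁.isOpen.preimage continuous_radius
    have h1 : ContinuousOn (fun x : Pt => x 0 - S₁.h (radius x)) {x | radius x ∈ S₁.I} :=
      (continuous_apply 0).continuousOn.sub
        ((S₁.spacelikeGraph hM).continuousOn.comp continuous_radius.continuousOn fun _ hx => hx)
    have h2 : ContinuousOn (fun x : Pt => S₂.h (radius x) - x 0) {x | radius x ∈ S₁.I} :=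
      ((S₂.spacelikeGraph hM).continuousOn.comp continuous_radius.continuousOn
        fun _ hx => hI ▸ hx).sub (continuous_apply 0).continuousOn
    convert (h1.isOpen_inter_preimage hU isOpen_Ioi (t := Ioi 0)).inter
      (h2.isOpen_inter_preimage hU (isOpen_Ioi (a := (0 : ℝ)))) using 1
    ext x
    simp only [regionBetween, mem_ofPred_eq, mem_inter_iff, mem_preimage, mem_Ioi, sub_pos]
    tauto
  have hcr := continuous_radius.continuousOn (s := regionBetween S₁ S₂)
  have hg : ContinuousOn (fun x => 1 / (9 * radius x ^ 2) * κ x) (regionBetween S₁ S₂) := by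
    refine (continuousOn_const.div (continuousOn_const.mul (hcr.pow 2)) fun x hx => ?_).mul
      (hk.mono hext)
    have := radius_pos hM (hext hx)
    exact (by positivity : 9 * radius x ^ 2 ≠ 0)
  have e : volume.restrict S₁.I = volume.restrict (S₁.I ∩ Ioi 0) := by
    rw [inter_eq_self_of_subset_left h0]
  rw [morawetzBulk, setLIntegral_congr_fun hopen.measurableSet fun x hx => by
    rw [bulk_integrand_eq hM (hext hx) h hF], ← lintegral_indicator hopen.measurableSet,
    lintegral_spacetime_polar (measurable_indicator_ofReal hopen hg),
    ← lintegral_const_mul' _ _ ENNReal.ofReal_ne_top, e,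
    ← setLIntegral_indicator S₁.isOpen.measurableSet]
  refine setLIntegral_congr_fun measurableSet_Ioi fun r hr => ?_
  have hr0 : 0 < r := hr
  have hmem : ∀ t, ∀ θ ∈ unitSphere, polarPoint t r θ ∈ regionBetween S₁ S₂
      ↔ r ∈ S₁.I ∧ t ∈ Ioo (S₁.h r) (S₂.h r) := fun t θ hθ => by
    simp only [regionBetween, mem_ofPred_eq, radius_polarPoint hr0.le hθ, polarPoint_zero, mem_Ioo]
  by_cases hrI : r ∈ S₁.I
  · have hr2 : 2 * M < r := S₁.subset hrI
    rw [indicator_of_mem hrI, ← lintegral_const_mul' _ _ ENNReal.ofReal_ne_top,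
      ← lintegral_indicator measurableSet_Ioo]
    refine lintegral_congr fun t => ?_
    by_cases ht : t ∈ Ioo (S₁.h r) (S₂.h r)
    · rw [indicator_of_mem ht, ← ENNReal.ofReal_mul (by norm_num)]
      have e1 : ∫⁻ θ in unitSphere, (regionBetween S₁ S₂).indicator
            (fun x => ENNReal.ofReal (1 / (9 * radius x ^ 2) * κ x)) (polarPoint t r θ)
              ∂sphereMeasure
          = ∫⁻ θ in unitSphere, ENNReal.ofReal ((fun x => 1 / (9 * r ^ 2) * κ x)
            (polarPoint t r θ)) ∂sphereMeasure := by
        refine setLIntegral_congr_fun isCompact_unitSphere.measurableSet fun θ hθ => ?_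
        simp only [indicator_of_mem ((hmem t θ hθ).2 ⟨hrI, ht⟩), radius_polarPoint hr0.le hθ]
      rw [e1, lintegral_sphere_eq_ofReal hM hr2 (u := fun x => 1 / (9 * r ^ 2) * κ x)
        (continuousOn_const.mul hk), sphereAvg_const_mul,
        ← ENNReal.ofReal_mul (by positivity)]
      · congr 1
        field_simp
      · intro θ hθ
        have := hk0 _ (polarPoint_mem (t := t) hM hr2 hθ)
        positivity
    · rw [indicator_of_notMem ht, setLIntegral_congr_fun isCompact_unitSphere.measurableSet
        (g := fun _ => 0)]
      · simp
      · exact fun θ hθ => indicator_of_notMem (fun hm => ht ((hmem t θ hθ).1 hm).2) _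
  · rw [indicator_of_notMem hrI]
    refine (lintegral_congr fun t => ?_).trans lintegral_zero
    rw [setLIntegral_congr_fun isCompact_unitSphere.measurableSet (g := fun _ => 0)]
    · simp
    · exact fun θ hθ => indicator_of_notMem (fun hm => hrI ((hmem t θ hθ).1 hm).1) _

end Reduction

/-- Energy equality and the weighted bulk estimate for Maxwell fields. -/
theorem IsMaxwellField.energy_eq_and_bulk_le {M : ℝ} (hM : 0 < M) {F : Tensor2}
    (hF : IsMaxwellField M F) {S₁ S₂ : SphericalHypersurface M} (hS : Bounds S₁ S₂) :
    S₂.energy F = S₁.energy F ∧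
      morawetzBulk M F (regionBetween S₁ S₂) ≤ ENNReal.ofReal (72 / 5) * S₁.energy F := by
  have hEB : ∀ z ∈ exterior M, F z = ofEB (fun i => elec F i z) (fun i => magn F i z) :=
    fun z hz => eq_ofEB_of_antisymm (hF.antisymm z hz)
  have h := hF.maxwellEB hM
  have R := h.reducedSystem hM
  have X := tortoiseChart hM
  have G₁ := S₁.spacelikeGraph hM
  have G₂ := S₂.spacelikeGraph hM
  rw [← hS.same_radii] at G₂
  -- The null line through the point of Σ₂ at radius r meets Σ₂, hence also Σ₁.
  have hpos : ∀ (s : ℝ), s = 1 ∨ s = -1 → ∀ r ∈ S₁.I, ∃ q ∈ S₁.I,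
      S₁.h q - s * tortoise M q = S₂.h r - s * tortoise M r := fun s hs r hr => by
    obtain ⟨q, hq, e⟩ := (hS.exists_radius_iff hM hs (S₂.h r - s * tortoise M r)).2
      ⟨r, hr, by ring⟩
    exact ⟨q, hq, by linarith⟩
  have hneg : ∀ (s : ℝ), s = 1 ∨ s = -1 → ∀ r ∈ S₁.I, ∃ q ∈ S₁.I,
      S₂.h q - s * tortoise M q = S₁.h r - s * tortoise M r := fun s hs r hr => by
    obtain ⟨q, hq, e⟩ := (hS.exists_radius_iff hM hs (S₁.h r - s * tortoise M r)).1
      ⟨r, hr, by ring⟩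
    exact ⟨q, hq, by linarith⟩
  have hout := hpos 1 (Or.inl rfl)
  have hin := hpos (-1) (Or.inr rfl)
  have hout' := hneg 1 (Or.inl rfl)
  have hin' := hneg (-1) (Or.inr rfl)
  simp only [one_mul, neg_one_mul, sub_neg_eq_add] at hout hin hout' hin'
  have E := R.energyLaw hM
  have hbulk : ∀ t r, 2 * M < r → 0 ≤ sphereAvg (bulkDensity M (radialScalar (elec F))
      (radialScalar (magn F)) (tangentialE (elec F)) (tangentialB M (magn F))) t r :=
    fun t r hr => sphereAvg_nonneg hM hr fun x hx => bulkDensity_nonneg hM hx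
  refine ⟨?_, ?_⟩
  · rw [S₁.energy_eq hM h hEB, S₂.energy_eq hM h hEB, ← hS.same_radii,
      graphEnergy_eq X G₁ G₂ hS.future hout hin hout' hin' E]
  · obtain ⟨j, v, κ, L, D, hκ⟩ := R.exists_morawetz hM
    rw [morawetzBulk_eq hM hS.same_radii h hEB, S₁.energy_eq hM h hEB, mul_left_comm]
    gcongr
    have := lintegral_source_le X G₁ G₂ hS.future hout hin E L
      (fun t r hr => (hbulk t r hr).trans (hκ t r hr)) hκ (by norm_num) D
    rwa [show (2 * (36 / 5) : ℝ) = 72 / 5 by norm_num] at this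

/-! ### Coulomb fields -/

/-- The inverse-square field `c y / r³`. -/
def inverseSquare (c : ℝ) (i : Fin 3) (x : Pt) : ℝ := c / radius x ^ 2 * unitNormal x i

section Coulomb

variable {M : ℝ} {x : Pt}

theorem smooth_inverseSquare (hM : 0 < M) (c : ℝ) (i : Fin 3) : Smooth M (inverseSquare c i) :=
  ((Smooth.const c).div (ContDiffOn.pow (Smooth.radius hM) 2) fun _ hx =>
    pow_ne_zero 2 (radius_pos hM hx).ne').mul (Smooth.unitNormal hM i)

theorem pd_inverseSquare (hM : 0 < M) (hx : x ∈ exterior M) (c : ℝ) (i : Fin 3) (a : Fin 4) :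
    pd a (inverseSquare c i) x = c / radius x ^ 3
      * ((if a = i.succ then 1 else 0) - 3 * unitNormal x i * dr x a) := by
  have hr := (radius_pos hM hx).ne'
  have h1 : HasDerivAt (fun r : ℝ => c / r ^ 2) (-(2 * c) / radius x ^ 3) (radius x) := by
    refine ((hasDerivAt_const _ c).div (hasDerivAt_pow 2 (radius x))
      (pow_ne_zero 2 hr)).congr_deriv ?_
    simp
    field_simp
  refine (((HasGrad.comp h1 (HasGrad.radius hM hx)).mul (hasGrad_unitNormal hM hx i)).pd_eq
    a).trans ?_
  field_simp
  ring

theorem radialScalar_inverseSquare (hM : 0 < M) (hx : x ∈ exterior M) (c : ℝ) :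
    radialScalar (inverseSquare c) x = c := by
  have hr := (radius_pos hM hx).ne'
  have hn := unitNormal_sq_sum hM hx
  simp only [radialScalar, dot3, inverseSquare, position_eq hM hx]
  field_simp
  linear_combination c * hn

/-- The inverse-square field is static, with vanishing divergence and curl. In Gauss' law the two
corrections by the mass cancel, and in Ampère's law the radial derivative is parallel to the normal.
-/
theorem maxwellEB_inverseSquare (hM : 0 < M) (c d : ℝ) :
    MaxwellEB M (inverseSquare c) (inverseSquare d) := by
  have hrad : ∀ x ∈ exterior M, ∀ (c : ℝ) (i : Fin 3),
      radialD (inverseSquare c i) x = -(2 * c) / radius x ^ 3 * unitNormal x i := by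
    intro x hx c i
    have hn := unitNormal_sq_sum hM hx
    have d1 : dr x 1 = unitNormal x 0 := rfl
    have d2 : dr x 2 = unitNormal x 1 := rfl
    have d3 : dr x 3 = unitNormal x 2 := rfl
    simp only [radialD_eq, pd_inverseSquare hM hx, d1, d2, d3]
    fin_cases i <;> simp [Fin.ext_iff] <;> grind
  have hdiv : ∀ x ∈ exterior M, ∀ c : ℝ, div3 (inverseSquare c) x = 0 := by
    intro x hx c
    have hn := unitNormal_sq_sum hM hx
    have d1 : dr x 1 = unitNormal x 0 := rfl
    have d2 : dr x 2 = unitNormal x 1 := rfl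
    have d3 : dr x 3 = unitNormal x 2 := rfl
    simp only [div3, pd_inverseSquare hM hx, d1, d2, d3]
    simp
    grind
  have hcurl : ∀ x ∈ exterior M, ∀ (c : ℝ) (i : Fin 3), curl3 (inverseSquare c) x i = 0 := by
    intro x hx c i
    have d1 : dr x 1 = unitNormal x 0 := rfl
    have d2 : dr x 2 = unitNormal x 1 := rfl
    have d3 : dr x 3 = unitNormal x 2 := rfl
    simp only [curl3, pd_inverseSquare hM hx, d1, d2, d3]
    fin_cases i <;> simp [Fin.ext_iff] <;> ring
  have htime : ∀ x ∈ exterior M, ∀ (c : ℝ) (i : Fin 3), pd 0 (inverseSquare c i) x = 0 := by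
    intro x hx c i
    rw [pd_inverseSquare hM hx]
    simp [(Fin.succ_ne_zero i).symm]
  refine ⟨smooth_inverseSquare hM c, smooth_inverseSquare hM d, fun x hx => ?_, fun x hx i => ?_,
    fun x hx => hdiv x hx d, fun x hx i => ?_⟩
  · have hr := (radius_pos hM hx).ne'
    have hn := unitNormal_sq_sum hM hx
    simp only [hdiv x hx, hrad x hx, dot3, inverseSquare, lapse]
    field_simp
    ring
  · simp only [htime x hx, hcurl x hx, hrad x hx, cross_apply]
    fin_cases i <;> simp <;> grind
  · rw [htime x hx, hcurl x hx]

theorem coulomb_eq (hM : 0 < M) (hx : x ∈ exterior M) (qE qB : ℝ) :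
    coulomb M qE qB x = ofEB (fun i => inverseSquare (-(2 * qE)) i x)
      (fun i => inverseSquare (2 * qB) i x) := by
  have hr := (radius_pos hM hx).ne'
  have hl := lapse_pos hM hx
  have hn := unitNormal_sq_sum hM hx
  have hs := Real.mul_self_sqrt hl.le
  have hs0 := (Real.sqrt_pos.2 hl).ne'
  have hZ : ∀ i : Fin 3, frameZ M x i.succ = Real.sqrt (lapse M (radius x)) * unitNormal x i :=
    fun i => by simp [frameZ, unitNormal_apply]
  have hg : ∀ i j : Fin 3, metric M x i.succ j.succ = (1 - (lapse M (radius x))⁻¹)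
      * unitNormal x i * unitNormal x j - if i = j then 1 else 0 := fun i j => by
    simp [metric, dt, dr_succ]
    ring
  have hT0 : ∑ c, metric M x 0 c * frameT M x c = Real.sqrt (lapse M (radius x)) := by
    simp [Fin.sum_univ_succ (n := 3), frameT, metric, dt, Fin.succ_ne_zero]
    field_simp
    linarith
  have hTi : ∀ i : Fin 3, ∑ c, metric M x i.succ c * frameT M x c = 0 := fun i => by
    simp [Fin.sum_univ_succ (n := 3), frameT, metric, dt, Fin.succ_ne_zero]
  have hZ0 : ∑ c, metric M x 0 c * frameZ M x c = 0 := by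
    simp [Fin.sum_univ_succ (n := 3), frameZ, metric, dt, Fin.succ_ne_zero]
  have hZi : ∀ i : Fin 3, Real.sqrt (lapse M (radius x))
      * ∑ c, metric M x i.succ c * frameZ M x c = -unitNormal x i := fun i => by
    have h0 : frameZ M x 0 = 0 := rfl
    simp only [Fin.sum_univ_succ (n := 3), Fin.sum_univ_three, h0, hZ, hg]
    generalize Real.sqrt (lapse M (radius x)) = s at *
    rw [← hs]
    fin_cases i <;> simp <;> field_simp <;> grind
  have hkey : ∀ a b, coulomb M qE qB x a b = (2 * qE
      * ((∑ c, metric M x a c * frameT M x c) * (∑ c, metric M x b c * frameZ M x c)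
      - (∑ c, metric M x b c * frameT M x c) * (∑ c, metric M x a c * frameZ M x c))
    + 2 * qB * (-killingYano x a b / radius x)) / radius x ^ 2 := fun a b => rfl
  have hy := position_eq hM hx
  ext a b
  rw [hkey, killingYano_eq]
  refine Fin.cases (Fin.cases ?_ (fun j => ?_) b) (fun i => Fin.cases ?_ (fun j => ?_) b) a
  · simp [ofEB]
  · rw [hT0, hTi, hZ0, hZi, zero_mul, sub_zero]
    fin_cases j <;> simp [ofEB, inverseSquare] <;> ring
  · rw [hT0, hTi, hZ0, hZi, zero_mul, zero_sub]
    fin_cases i <;> simp [ofEB, inverseSquare] <;> ring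
  · rw [hTi, hTi]
    fin_cases i <;> fin_cases j <;> simp [ofEB, inverseSquare, hy] <;> field_simp

theorem isMaxwellField_coulomb (hM : 0 < M) (qE qB : ℝ) : IsMaxwellField M (coulomb M qE qB) :=
  (maxwellEB_inverseSquare hM _ _).isMaxwellField hM fun _ hz => coulomb_eq hM hz qE qB

/-- `Z` is built from the cross products of `y` with `E` and `B`, which are parallel to `y` here. -/
theorem Z_coulomb (hM : 0 < M) (hx : x ∈ exterior M) (qE qB : ℝ) :
    Z M (coulomb M qE qB) x = 0 := by
  have hc : ∀ c : ℝ, (position x ⨯₃ fun i => inverseSquare c i x) = 0 := fun c => by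
    have : (fun i => inverseSquare c i x) = (c / radius x ^ 3) • position x := by
      have hr := (radius_pos hM hx).ne'
      ext i
      simp only [inverseSquare, Pi.smul_apply, smul_eq_mul, position_eq hM hx]
      field_simp
    rw [this, map_smul, cross_self, smul_zero]
  rw [Z_ofEB hM hx (coulomb_eq hM hx qE qB), hc, hc]
  ext a b
  fin_cases a <;> fin_cases b <;> simp [ofEB]

/-- The radial scalars are the constant charges, and `β` is their gradient up to a factor. -/
theorem beta_coulomb (hM : 0 < M) (hx : x ∈ exterior M) (qE qB : ℝ) :
    beta M (coulomb M qE qB) x = 0 := by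
  have hp : ∀ (c : ℝ) (a : Fin 4), pd a (radialScalar (inverseSquare c)) x = 0 := fun c a => by
    rw [pd_congr (fun z hz => radialScalar_inverseSquare hM hz c) hx]
    exact (HasGrad.const c).pd_eq a
  ext a
  rw [beta_eq hM hx (maxwellEB_inverseSquare hM _ _) fun _ hz => coulomb_eq hM hz qE qB]
  simp [hp]

end Coulomb

end Schwarzschild

end

theorem theorem1 (M : ℝ) (hM : 0 < M) :
    (∀ (F : Schwarzschild.Tensor2), Schwarzschild.IsMaxwellField M F →
      ∀ S₁ S₂ : Schwarzschild.SphericalHypersurface M, Schwarzschild.Bounds S₁ S₂ →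
        S₂.energy F = S₁.energy F ∧
        Schwarzschild.morawetzBulk M F (Schwarzschild.regionBetween S₁ S₂)
          ≤ ENNReal.ofReal (72 / 5) * S₁.energy F) ∧
    (∀ qE qB : ℝ, Schwarzschild.IsMaxwellField M (Schwarzschild.coulomb M qE qB) ∧
      ∀ x ∈ Schwarzschild.exterior M,
        Schwarzschild.Z M (Schwarzschild.coulomb M qE qB) x = 0 ∧
        Schwarzschild.beta M (Schwarzschild.coulomb M qE qB) x = 0) := by
  exact ⟨fun _ hF _ _ hS => hF.energy_eq_and_bulk_le hM hS, fun qE qB =>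
    ⟨Schwarzschild.isMaxwellField_coulomb hM qE qB, fun _ hx =>
      ⟨Schwarzschild.Z_coulomb hM hx qE qB, Schwarzschild.beta_coulomb hM hx qE qB⟩⟩⟩
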